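/- Let $\mathfrak g=\mathfrak{sl}(2,\mathbb R)\ltimes\mathfrak h_3(\mathbb R)$, where the bracket of $\mathfrak h_3$ is $[(u,v,w),(u',v',w')]=(0,0,2(uv'-vu'))$ and $\mathfrak{sl}(2,\mathbb R)$ acts on $\mathfrak h_3$ by the standard action on $(u,v)$ and trivially on $w$. Let $q\in\mathbb Z/4$, $r=-\tfrac12$, $s=\tfrac i2$, and let $I''(q,r,s)$ be the space of smooth $F:\mathbb R^2\to\mathbb C$ with $F(\theta+j\pi,(-1)^jy)=i^{-jq}F(\theta,y)$ for all $j\in\mathbb Z$. The algebra $\mathfrak g$ acts on it by the first-order differential operators which, under $F(\theta,y)=(\cos\theta)^{r}e^{-sy^2\tan\theta}f(\tan\theta,y\sec\theta)$ for $|\theta|<\pi/2$, correspond to the operators $$(ct-a)x\,\partial_x+(ct^2-2at-b)\,\partial_t+(ra-csx^2-rct)\quad\text{for }\begin{pmatrix}a&b\\c&-a\end{pmatrix},\qquad (tv-u)\,\partial_x+s(w-2vx)\quad\text{for }(u,v,w)$$ on functions $f(t,x)$. Let $h=\mathrm{diag}(1,-1)$, let $e^+$, $e^-$ be the upper and lower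 triangular nilpotent elements of the standard $\mathfrak{sl}_2$-triple, let $\Omega=\tfrac12h^2-h+2e^+e^-$ be the Casimir element of $\mathfrak{sl}_2$, and $\Omega'=2\Omega-r(r+2)$. A vector $F$ is $K$-finite if its translates $F(\theta-\tau,y)$, $\tau\in\mathbb R$, span a finite-dimensional space, and $\ker(\Omega'-2\lambda)_K$ denotes the space of $K$-finite $F\in I''(q,r,s)$ with $\Omega'F=2\lambda F$. For $m\in\mathbb Z$, $k\in\mathbb Z_{\ge0}$ put $$\Psi_{m,k}(\theta,y)=e^{-im\theta/2}e^{-y^2/2}y^k\,{}_1F_1\!\left(\tfrac{1+2k-m}{4},k+\tfrac12,y^2\right),\qquad H_k=\operatorname{span}_{\mathbb C}\{\Psi_{m,k}: m\equiv 2k+q \bmod 4\}.$$ If $q\equiv1\bmod 4$, let $H_k^+=\operatorname{span}\{\Psi_{m,k}: m\ge 2k+1,\ m\equiv 2k+1\bmod 4\}$ (the lowest weight submodule of $H_k$). If $q\equiv-1\bmod 4$, let $H_k^-=\operatorname{span}\{\Psi_{m,k}: m\le-(2k+1),\ m\equiv-(2k+1)\bmod 4\}$ (the highest weight submodule of $H_k$).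 Then $H_l=\ker(\Omega'-l(l-1))_K$ for $l\ge2$, $H_0+H_1=\ker(\Omega')_K$, and the sum $H=\sum_{l\ge0}H_l$ is direct. With $H^\pm=\bigoplus_{l\ge2}H_l^\pm$, the following are composition series of $\mathfrak g$-modules (every term is a $\mathfrak g$-submodule and the successive quotients are irreducible): 1. if $q\equiv0$ or $q\equiv2\bmod 4$: $\;0\subset H_0\oplus H_1\subset H$; 2. if $q\equiv-1\bmod 4$: $\;0\subset H_0^-\oplus H_1^-\subset H_0\oplus H_1\subset H_0\oplus H_1\oplus H^-\subset H$; 3. if $q\equiv1\bmod 4$: $\;0\subset H_0^+\oplus H_1^+\subset H_0\oplus H_1\subset H_0\oplus H_1\oplus H^+\subset H$. -/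

import Mathlib

open scoped ContDiff

noncomputable section

namespace SchrodingerRep

/-! ### The Lie algebra `𝔤 = 𝔰𝔩(2,ℝ) ⋉ 𝔥₃(ℝ)` -/

/-- The Lie algebra `𝔰𝔩(2,ℝ)` of real traceless `2 × 2` matrices. -/
abbrev Sl2 : Type := LieAlgebra.SpecialLinear.sl (Fin 2) ℝ

/-- The three-dimensional Heisenberg Lie algebra, with elements `(u, v, w)`. -/
@[ext] structure Heis where
  u : ℝ
  v : ℝ
  w : ℝ

namespace Heis

/-- As a set, the Heisenberg algebra is `ℝ³`. -/
def equivProd : Heis ≃ ℝ × ℝ × ℝ where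
  toFun X := (X.u, X.v, X.w)
  invFun p := ⟨p.1, p.2.1, p.2.2⟩
  left_inv _ := rfl
  right_inv _ := rfl

instance : AddCommGroup Heis := equivProd.addCommGroup

instance : Module ℝ Heis := equivProd.module ℝ

@[simp] lemma zero_u : (0 : Heis).u = 0 := rfl
@[simp] lemma zero_v : (0 : Heis).v = 0 := rfl
@[simp] lemma zero_w : (0 : Heis).w = 0 := rfl
@[simp] lemma add_u (X Y : Heis) : (X + Y).u = X.u + Y.u := rfl
@[simp] lemma add_v (X Y : Heis) : (X + Y).v = X.v + Y.v := rfl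
@[simp] lemma add_w (X Y : Heis) : (X + Y).w = X.w + Y.w := rfl
@[simp] lemma sub_u (X Y : Heis) : (X - Y).u = X.u - Y.u := rfl
@[simp] lemma sub_v (X Y : Heis) : (X - Y).v = X.v - Y.v := rfl
@[simp] lemma sub_w (X Y : Heis) : (X - Y).w = X.w - Y.w := rfl
@[simp] lemma smul_u (t : ℝ) (X : Heis) : (t • X).u = t * X.u := rfl
@[simp] lemma smul_v (t : ℝ) (X : Heis) : (t • X).v = t * X.v := rfl
@[simp] lemma smul_w (t : ℝ) (X : Heis) : (t • X).w = t * X.w := rfl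

/-- The bracket coming from the group law
`(v₁,v₂,v₃)(v₁',v₂',v₃') = (v₁+v₁', v₂+v₂', v₃+v₃'+v₁v₂'-v₂v₁')`. -/
instance : Bracket Heis Heis := ⟨fun X Y => ⟨0, 0, 2 * (X.u * Y.v - X.v * Y.u)⟩⟩

@[simp] lemma lie_u (X Y : Heis) : ⁅X, Y⁆.u = 0 := rfl
@[simp] lemma lie_v (X Y : Heis) : ⁅X, Y⁆.v = 0 := rfl
@[simp] lemma lie_w (X Y : Heis) : ⁅X, Y⁆.w = 2 * (X.u * Y.v - X.v * Y.u) := rfl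

instance : LieRing Heis where
  add_lie X Y Z := by ext <;> simp; ring
  lie_add X Y Z := by ext <;> simp; ring
  lie_self X := by ext <;> simp; ring
  leibniz_lie X Y Z := by ext <;> simp

instance : LieAlgebra ℝ Heis where
  lie_smul t X Y := by ext <;> simp; ring

end Heis

lemma sl2_trace (A : Sl2) : A.1 1 1 = -A.1 0 0 := by
  have h : Matrix.trace A.1 = 0 := LinearMap.mem_ker.1 A.2
  rw [Matrix.trace_fin_two] at h
  linarith

/-- The matrix `(a, b; c, -a)`. -/
def sl2Mk (a b c : ℝ) : Sl2 :=
  ⟨!![a, b; c, -a], LinearMap.mem_ker.2 (by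
    rw [Matrix.traceLinearMap_apply, Matrix.trace_fin_two_of]; ring)⟩

/-- A matrix in `𝔰𝔩(2,ℝ)` acts on `𝔥₃` by the standard action on the column `(u, v)`, and by zero
on the centre. -/
def sl2Der (A : Sl2) : LieDerivation ℝ Heis Heis where
  toFun X := ⟨A.1 0 0 * X.u + A.1 0 1 * X.v, A.1 1 0 * X.u + A.1 1 1 * X.v, 0⟩
  map_add' X Y := by ext <;> simp <;> ring
  map_smul' t X := by ext <;> simp <;> ring
  leibniz' X Y := by
    ext <;> simp [sl2_trace]
    ring

/-- The action of `𝔰𝔩(2,ℝ)` on `𝔥₃(ℝ)` by derivations. -/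
def sl2Action : Sl2 →ₗ⁅ℝ⁆ LieDerivation ℝ Heis Heis where
  toFun := sl2Der
  map_add' A B := by
    ext X <;> simp [sl2Der] <;> ring
  map_smul' t A := by
    ext X <;> simp [sl2Der] <;> ring
  map_lie' {A B} := by
    ext X
    · simp [sl2Der, LieDerivation.lie_apply, Ring.lie_def, Matrix.mul_apply, Fin.sum_univ_two]
      ring
    · simp [sl2Der, LieDerivation.lie_apply, Ring.lie_def, Matrix.mul_apply, Fin.sum_univ_two]
      ring
    · simp [sl2Der, LieDerivation.lie_apply]

/-- The Lie algebra `𝔤 = 𝔰𝔩(2,ℝ) ⋉ 𝔥₃(ℝ)`. -/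
abbrev SchrAlg : Type := LieAlgebra.SemiDirectSum Heis Sl2 sl2Action

/-- `h = diag(1,-1)`. -/
def sl2H : SchrAlg := ⟨0, sl2Mk 1 0 0⟩

/-- `e⁺`, the upper triangular nilpotent element. -/
def sl2E : SchrAlg := ⟨0, sl2Mk 0 1 0⟩

/-- `e⁻`, the lower triangular nilpotent element. -/
def sl2F : SchrAlg := ⟨0, sl2Mk 0 0 1⟩

/-! ### The action by differential operators -/

/-- First-order operator with real vector field `ξ` and multiplier `μ`. -/
def firstOrder (ξ : ℝ × ℝ → ℝ × ℝ) (μ : ℝ × ℝ → ℂ) (F : ℝ × ℝ → ℂ) (p : ℝ × ℝ) : ℂ :=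
  fderiv ℝ F p (ξ p) + μ p * F p

/-- Vector field, in the coordinates `(t, x)` of the non-compact picture, of the element of `𝔤`
with matrix part `(a, b; c, -a)` and Heisenberg part `(u, v, w)`:
`(ct² - 2at - b) ∂ₜ + ((ct - a)x + tv - u) ∂ₓ`. -/
def fieldN (X : SchrAlg) (p : ℝ × ℝ) : ℝ × ℝ :=
  (X.right.1 1 0 * p.1 ^ 2 - 2 * X.right.1 0 0 * p.1 - X.right.1 0 1,
   (X.right.1 1 0 * p.1 - X.right.1 0 0) * p.2 + p.1 * X.left.v - X.left.u)

/-- Multiplier in the non-compact picture: `ra - csx² - rct + s(w - 2vx)`. -/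
def multN (r s : ℂ) (X : SchrAlg) (p : ℝ × ℝ) : ℂ :=
  r * X.right.1 0 0 - X.right.1 1 0 * s * p.2 ^ 2 - r * X.right.1 1 0 * p.1
    + s * (X.left.w - 2 * X.left.v * p.2)

/-- The action of `𝔤` in the non-compact picture. -/
def opN (r s : ℂ) (X : SchrAlg) : (ℝ × ℝ → ℂ) → ℝ × ℝ → ℂ :=
  firstOrder (fieldN X) (multN r s X)

/-- The passage from the non-compact picture to the compact picture on `-π/2 < θ < π/2`:
`F(θ,y) = (cos θ)^r e^{-s y² tan θ} f(tan θ, y sec θ)`. -/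
def toCompact (r s : ℂ) (f : ℝ × ℝ → ℂ) (p : ℝ × ℝ) : ℂ :=
  (Real.cos p.1 : ℂ) ^ r * Complex.exp (-s * p.2 ^ 2 * Real.tan p.1)
    * f (Real.tan p.1, p.2 / Real.cos p.1)

/-- Coefficient of `∂_θ` in the compact picture. -/
def angCoef (X : SchrAlg) (θ : ℝ) : ℝ :=
  -2 * X.right.1 0 0 * Real.sin θ * Real.cos θ - X.right.1 0 1 * Real.cos θ ^ 2
    + X.right.1 1 0 * Real.sin θ ^ 2

/-- Coefficient of `y ∂_y` in the compact picture. -/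
def radCoef (X : SchrAlg) (θ : ℝ) : ℝ :=
  -X.right.1 0 0 * (Real.cos θ ^ 2 - Real.sin θ ^ 2)
    + (X.right.1 0 1 + X.right.1 1 0) * Real.sin θ * Real.cos θ

/-- The `θ`-derivative of `radCoef`. -/
def radCoef' (X : SchrAlg) (θ : ℝ) : ℝ :=
  4 * X.right.1 0 0 * Real.sin θ * Real.cos θ
    + (X.right.1 0 1 + X.right.1 1 0) * (Real.cos θ ^ 2 - Real.sin θ ^ 2)

/-- Vector field of an element of `𝔤` in the coordinates `(θ, y)` of the compact picture. -/
def fieldC (X : SchrAlg) (p : ℝ × ℝ) : ℝ × ℝ :=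
  (angCoef X p.1,
   radCoef X p.1 * p.2 + (X.left.v * Real.sin p.1 - X.left.u * Real.cos p.1))

/-- Multiplier of an element of `𝔤` in the compact picture. -/
def multC (r s : ℂ) (X : SchrAlg) (p : ℝ × ℝ) : ℂ :=
  -r * radCoef X p.1 - s * radCoef' X p.1 * p.2 ^ 2
    - 2 * s * p.2 * (X.left.u * Real.sin p.1 + X.left.v * Real.cos p.1 : ℝ) + s * X.left.w

/-- The action of `𝔤` in the compact picture. -/
def opC (r s : ℂ) (X : SchrAlg) : (ℝ × ℝ → ℂ) → ℝ × ℝ → ℂ :=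
  firstOrder (fieldC X) (multC r s X)

/-- The operators `opC` are the operators `opN` of the non-compact picture, transported by
`toCompact`. -/
theorem opC_toCompact (r s : ℂ) (X : SchrAlg) (f : ℝ × ℝ → ℂ) (hf : Differentiable ℝ f)
    (p : ℝ × ℝ) (hp : 0 < Real.cos p.1) :
    opC r s X (toCompact r s f) p = toCompact r s (opN r s X f) p := by
  have f1 : HasFDerivAt (fun p : ℝ × ℝ => p.1) (ContinuousLinearMap.fst ℝ ℝ ℝ) p :=
    hasFDerivAt_fst
  have f2 : HasFDerivAt (fun p : ℝ × ℝ => p.2) (ContinuousLinearMap.snd ℝ ℝ ℝ) p :=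
    hasFDerivAt_snd
  have lift : ∀ {g : ℝ × ℝ → ℝ} {g' : ℝ × ℝ →L[ℝ] ℝ}, HasFDerivAt g g' p →
      HasFDerivAt (fun x => (g x : ℂ)) (Complex.ofRealCLM.comp g') p :=
    fun hg => Complex.ofRealCLM.hasFDerivAt.comp p hg
  have hne : Real.cos p.1 ≠ 0 := hp.ne'
  have hneC : (Real.cos p.1 : ℂ) ≠ 0 := by exact_mod_cast hne
  have hsc := Real.sin_sq_add_cos_sq p.1
  have hscC : (Real.sin p.1 : ℂ) ^ 2 + (Real.cos p.1 : ℂ) ^ 2 = 1 := by exact_mod_cast hsc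
  have hX := sl2_trace X.right
  have dcos := (Real.hasDerivAt_cos p.1).comp_hasFDerivAt p f1
  have dtan := (Real.hasDerivAt_tan hne).comp_hasFDerivAt p f1
  have hz : HasDerivAt (fun z : ℂ => z ^ r) (r * (Real.cos p.1 : ℂ) ^ (r - 1))
      (Real.cos p.1 : ℂ) := by
    have := (hasDerivAt_id (Real.cos p.1 : ℂ)).cpow_const (c := r)
      (Or.inl (by simpa only [id, Complex.ofReal_re] using hp))
    simpa using this
  have dpow1 : HasDerivAt (fun θ : ℝ => (Real.cos θ : ℂ) ^ r)
      (r * (Real.cos p.1 : ℂ) ^ (r - 1) * (-Real.sin p.1 : ℝ)) p.1 :=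
    HasDerivAt.comp (h₂ := fun z : ℂ => z ^ r) (h := fun θ : ℝ => (Real.cos θ : ℂ)) p.1 hz
      (Real.hasDerivAt_cos p.1).ofReal_comp
  have dpow := HasFDerivAt.comp p dpow1.hasFDerivAt f1
  have dexp := (((((lift f2).pow 2).const_mul (-s)).mul (lift dtan))).cexp
  have dinv := (hasDerivAt_inv hne).comp_hasFDerivAt p dcos
  have dφ := dtan.prodMk (f2.mul dinv)
  have df := HasFDerivAt.comp p (hf (Real.tan p.1, p.2 / Real.cos p.1)).hasFDerivAt dφ
  have hF : HasFDerivAt (toCompact r s f) _ p := (dpow.mul dexp).mul df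
  have hpow : (Real.cos p.1 : ℂ) ^ (r - 1) = (Real.cos p.1 : ℂ) ^ r / Real.cos p.1 := by
    rw [Complex.cpow_sub _ _ hneC, Complex.cpow_one]
  have e1 : (1 / Real.cos p.1 ^ 2 * angCoef X p.1,
      p.2 * (Real.sin p.1 / Real.cos p.1 ^ 2 * angCoef X p.1)
        + (fieldC X p).2 / Real.cos p.1) =
      fieldN X (Real.tan p.1, p.2 / Real.cos p.1) := by
    simp only [fieldC, fieldN, angCoef, radCoef, Real.tan_eq_sin_div_cos]
    generalize Real.sin p.1 = S at *
    generalize Real.cos p.1 = C at *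
    ext
    · simp only
      field_simp
      grind
    · simp only
      field_simp
      grind
  have e2 : multN r s X (Real.tan p.1, p.2 / Real.cos p.1) =
      multC r s X p - r * Real.sin p.1 / Real.cos p.1 * angCoef X p.1
      - s * (2 * p.2 * (fieldC X p).2 * (Real.sin p.1 / Real.cos p.1)
        + p.2 ^ 2 / Real.cos p.1 ^ 2 * angCoef X p.1) := by
    simp only [fieldC, multC, multN, angCoef, radCoef, radCoef', Real.tan_eq_sin_div_cos]
    push_cast [-Complex.ofReal_cos, -Complex.ofReal_sin]
    generalize (Real.sin p.1 : ℂ) = S at *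
    generalize (Real.cos p.1 : ℂ) = C at *
    field_simp
    grind
  have e0 : toCompact r s (opN r s X f) p =
    (Real.cos p.1 : ℂ) ^ r * Complex.exp (-s * p.2 ^ 2 * Real.tan p.1) *
      (fderiv ℝ f (Real.tan p.1, p.2 / Real.cos p.1)
          (fieldN X (Real.tan p.1, p.2 / Real.cos p.1))
        + multN r s X (Real.tan p.1, p.2 / Real.cos p.1)
          * f (Real.tan p.1, p.2 / Real.cos p.1)) := rfl
  have e3 : opC r s X (toCompact r s f) p = fderiv ℝ (toCompact r s f) p (fieldC X p)
    + multC r s X p * ((Real.cos p.1 : ℂ) ^ r * Complex.exp (-s * p.2 ^ 2 * Real.tan p.1)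
      * f (Real.tan p.1, p.2 / Real.cos p.1)) := rfl
  rw [e0, e3, hF.fderiv, ← e1, e2]
  have e4 : (fieldC X p).1 = angCoef X p.1 := rfl
  simp [hpow, e4, -Complex.ofReal_cos, -Complex.ofReal_sin, -Complex.ofReal_tan]
  have e5 : ((Real.cos p.1 ^ 2)⁻¹ * angCoef X p.1,
        p.2 * ((Real.cos p.1 ^ 2)⁻¹ * (Real.sin p.1 * angCoef X p.1))
          + (Real.cos p.1)⁻¹ * (fieldC X p).2) =
      ((Real.cos p.1 ^ 2)⁻¹ * angCoef X p.1,
        p.2 * (Real.sin p.1 / Real.cos p.1 ^ 2 * angCoef X p.1)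
          + (fieldC X p).2 / Real.cos p.1) := by
    ext
    · rfl
    · simp only
      ring
  have htan : (Real.tan p.1 : ℂ) = Real.sin p.1 / Real.cos p.1 := by
    rw [Real.tan_eq_sin_div_cos]; push_cast; rfl
  rw [e5]
  generalize Complex.exp (-(s * p.2 ^ 2 * Real.tan p.1)) = E
  rw [htan]
  ring

lemma hasDerivAt_angCoef (X : SchrAlg) (θ : ℝ) :
    HasDerivAt (angCoef X) (2 * radCoef X θ) θ := by
  have hs := Real.hasDerivAt_sin θ
  have hc := Real.hasDerivAt_cos θ
  have h := (((hs.const_mul (-2 * X.right.1 0 0)).mul hc).sub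
    ((hc.pow 2).const_mul (X.right.1 0 1))).add ((hs.pow 2).const_mul (X.right.1 1 0))
  have h' : HasDerivAt (angCoef X) _ θ := h
  convert h' using 1
  simp only [radCoef, Nat.cast_ofNat]
  ring

lemma hasDerivAt_radCoef (X : SchrAlg) (θ : ℝ) :
    HasDerivAt (radCoef X) (radCoef' X θ) θ := by
  have hs := Real.hasDerivAt_sin θ
  have hc := Real.hasDerivAt_cos θ
  have h := (((hc.pow 2).sub (hs.pow 2)).const_mul (-X.right.1 0 0)).add
    ((hs.const_mul (X.right.1 0 1 + X.right.1 1 0)).mul hc)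
  have h' : HasDerivAt (radCoef X) _ θ := h
  convert h' using 1
  simp only [radCoef', Nat.cast_ofNat]
  ring

lemma hasDerivAt_radCoef' (X : SchrAlg) (θ : ℝ) :
    HasDerivAt (radCoef' X) (-4 * radCoef X θ) θ := by
  have hs := Real.hasDerivAt_sin θ
  have hc := Real.hasDerivAt_cos θ
  have h := ((hs.const_mul (4 * X.right.1 0 0)).mul hc).add
    (((hc.pow 2).sub (hs.pow 2)).const_mul (X.right.1 0 1 + X.right.1 1 0))
  have h' : HasDerivAt (radCoef' X) _ θ := h
  convert h' using 1
  simp only [radCoef, Nat.cast_ofNat]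
  ring

lemma fderiv_fieldC (X : SchrAlg) (p v : ℝ × ℝ) :
    fderiv ℝ (fieldC X) p v =
      (2 * radCoef X p.1 * v.1,
       (radCoef' X p.1 * p.2 + (X.left.v * Real.cos p.1 + X.left.u * Real.sin p.1)) * v.1
         + radCoef X p.1 * v.2) := by
  have f1 : HasFDerivAt (fun p : ℝ × ℝ => p.1) (ContinuousLinearMap.fst ℝ ℝ ℝ) p :=
    hasFDerivAt_fst
  have f2 : HasFDerivAt (fun p : ℝ × ℝ => p.2) (ContinuousLinearMap.snd ℝ ℝ ℝ) p :=
    hasFDerivAt_snd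
  have a := (hasDerivAt_angCoef X p.1).comp_hasFDerivAt p f1
  have b := (hasDerivAt_radCoef X p.1).comp_hasFDerivAt p f1
  have g := (((Real.hasDerivAt_sin p.1).const_mul X.left.v).sub
    ((Real.hasDerivAt_cos p.1).const_mul X.left.u)).comp_hasFDerivAt p f1
  have h : HasFDerivAt (fieldC X) _ p := a.prodMk ((b.mul f2).add g)
  rw [h.fderiv]
  simp
  ring

lemma fderiv_multC (r s : ℂ) (X : SchrAlg) (p v : ℝ × ℝ) :
    fderiv ℝ (multC r s X) p v =
      (-r * radCoef' X p.1 + 4 * s * radCoef X p.1 * p.2 ^ 2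
        - 2 * s * p.2 * (X.left.u * Real.cos p.1 - X.left.v * Real.sin p.1 : ℝ)) * v.1
      + (-2 * s * radCoef' X p.1 * p.2
        - 2 * s * (X.left.u * Real.sin p.1 + X.left.v * Real.cos p.1 : ℝ)) * v.2 := by
  have f1 : HasFDerivAt (fun p : ℝ × ℝ => p.1) (ContinuousLinearMap.fst ℝ ℝ ℝ) p :=
    hasFDerivAt_fst
  have f2 : HasFDerivAt (fun p : ℝ × ℝ => p.2) (ContinuousLinearMap.snd ℝ ℝ ℝ) p :=
    hasFDerivAt_snd
  have lift : ∀ {g : ℝ × ℝ → ℝ} {g' : ℝ × ℝ →L[ℝ] ℝ}, HasFDerivAt g g' p →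
      HasFDerivAt (fun x => (g x : ℂ)) (Complex.ofRealCLM.comp g') p :=
    fun hg => Complex.ofRealCLM.hasFDerivAt.comp p hg
  have b := lift ((hasDerivAt_radCoef X p.1).comp_hasFDerivAt p f1)
  have b' := lift ((hasDerivAt_radCoef' X p.1).comp_hasFDerivAt p f1)
  have y := lift f2
  have g := lift ((((Real.hasDerivAt_sin p.1).const_mul X.left.u).add
    ((Real.hasDerivAt_cos p.1).const_mul X.left.v)).comp_hasFDerivAt p f1)
  have h : HasFDerivAt (multC r s X) _ p :=
    (((b.const_mul (-r)).sub ((b'.const_mul s).mul (y.pow 2))).sub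
      ((y.const_mul (2 * s)).mul g)).add_const (s * X.left.w)
  rw [h.fderiv]
  simp
  ring

lemma contDiff_fieldC (X : SchrAlg) : ContDiff ℝ ∞ (fieldC X) := by
  unfold fieldC angCoef radCoef
  fun_prop

lemma contDiff_multC (r s : ℂ) (X : SchrAlg) : ContDiff ℝ ∞ (multC r s X) := by
  have h : ∀ g : ℝ × ℝ → ℝ, ContDiff ℝ ∞ g → ContDiff ℝ ∞ fun p => (g p : ℂ) := fun g hg =>
    Complex.ofRealCLM.contDiff.comp hg
  have h1 := h (fun p => radCoef X p.1) (by unfold radCoef; fun_prop)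
  have h2 := h (fun p => radCoef' X p.1) (by unfold radCoef'; fun_prop)
  have h3 := h (fun p => p.2) (by fun_prop)
  have h4 := h (fun p => X.left.u * Real.sin p.1 + X.left.v * Real.cos p.1) (by fun_prop)
  unfold multC
  fun_prop

lemma contDiff_firstOrder {ξ : ℝ × ℝ → ℝ × ℝ} {μ F : ℝ × ℝ → ℂ} (hξ : ContDiff ℝ ∞ ξ)
    (hμ : ContDiff ℝ ∞ μ) (hF : ContDiff ℝ ∞ F) : ContDiff ℝ ∞ (firstOrder ξ μ F) := by
  have h : ContDiff ℝ ∞ (fderiv ℝ F) := hF.fderiv_right (by simp)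
  exact (h.clm_apply hξ).add (hμ.mul hF)

lemma contDiff_opC (r s : ℂ) (X : SchrAlg) {F : ℝ × ℝ → ℂ} (hF : ContDiff ℝ ∞ F) :
    ContDiff ℝ ∞ (opC r s X F) :=
  contDiff_firstOrder (contDiff_fieldC X) (contDiff_multC r s X) hF

/-- Commutator of two first-order operators. -/
lemma firstOrder_comm {ξ η : ℝ × ℝ → ℝ × ℝ} {μ ν F : ℝ × ℝ → ℂ} (hξ : ContDiff ℝ ∞ ξ)
    (hη : ContDiff ℝ ∞ η) (hμ : ContDiff ℝ ∞ μ) (hν : ContDiff ℝ ∞ ν) (hF : ContDiff ℝ ∞ F)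
    (p : ℝ × ℝ) :
    firstOrder ξ μ (firstOrder η ν F) p - firstOrder η ν (firstOrder ξ μ F) p =
      fderiv ℝ F p (fderiv ℝ η p (ξ p) - fderiv ℝ ξ p (η p))
        + (fderiv ℝ ν p (ξ p) - fderiv ℝ μ p (η p)) * F p := by
  have h : ContDiff ℝ ∞ (fderiv ℝ F) := hF.fderiv_right (by simp)
  have key : ∀ {ζ : ℝ × ℝ → ℝ × ℝ} {κ : ℝ × ℝ → ℂ}, ContDiff ℝ ∞ ζ → ContDiff ℝ ∞ κ →
      ∀ w, fderiv ℝ (firstOrder ζ κ F) p w = fderiv ℝ (fderiv ℝ F) p w (ζ p)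
        + fderiv ℝ F p (fderiv ℝ ζ p w) + (fderiv ℝ κ p w * F p + κ p * fderiv ℝ F p w) := by
    intro ζ κ hζ hκ w
    have d1 := (h.differentiable (by simp) p).hasFDerivAt
    have d2 := (hζ.differentiable (by simp) p).hasFDerivAt
    have d3 := (hκ.differentiable (by simp) p).hasFDerivAt
    have d4 := (hF.differentiable (by simp) p).hasFDerivAt
    have d := (d1.clm_apply d2).add (d3.mul d4)
    have e : firstOrder ζ κ F = (fun y => (fderiv ℝ F y) (ζ y)) + κ * F := rfl
    rw [e, d.fderiv]
    simp
    ring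
  have sym : fderiv ℝ (fderiv ℝ F) p (ξ p) (η p) = fderiv ℝ (fderiv ℝ F) p (η p) (ξ p) :=
    (hF.contDiffAt.isSymmSndFDerivAt (by
      rw [minSmoothness_of_isRCLikeNormedField]; exact WithTop.coe_le_coe.2 le_top)) _ _
  have e1 : firstOrder ξ μ (firstOrder η ν F) p = 
    fderiv ℝ (firstOrder η ν F) p (ξ p) + μ p * firstOrder η ν F p := rfl
  have e2 : firstOrder η ν (firstOrder ξ μ F) p = 
    fderiv ℝ (firstOrder ξ μ F) p (η p) + ν p * firstOrder ξ μ F p := rfl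
  rw [e1, e2, key hη hν, key hξ hμ, sym]
  simp only [firstOrder, map_sub]
  ring

lemma lie_right (X Y : SchrAlg) : (⁅X, Y⁆ : SchrAlg).right.1 =
    X.right.1 * Y.right.1 - Y.right.1 * X.right.1 := rfl

lemma lie_left (X Y : SchrAlg) : (⁅X, Y⁆ : SchrAlg).left =
    ⁅X.left, Y.left⁆ + sl2Der X.right Y.left - sl2Der Y.right X.left := rfl

lemma sl2Der_apply (A : Sl2) (X : Heis) : sl2Der A X =
    ⟨A.1 0 0 * X.u + A.1 0 1 * X.v, A.1 1 0 * X.u + A.1 1 1 * X.v, 0⟩ := rfl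

lemma opC_lie (r s : ℂ) (X Y : SchrAlg) {F : ℝ × ℝ → ℂ} (hF : ContDiff ℝ ∞ F) :
    opC r s ⁅X, Y⁆ F = opC r s X (opC r s Y F) - opC r s Y (opC r s X F) := by
  funext p
  rw [Pi.sub_apply]
  refine Eq.trans ?_ (firstOrder_comm (contDiff_fieldC X) (contDiff_fieldC Y)
    (contDiff_multC r s X) (contDiff_multC r s Y) hF p).symm
  have hX := sl2_trace X.right
  have hY := sl2_trace Y.right
  have hsc := Real.sin_sq_add_cos_sq p.1
  have hscC : (Real.sin p.1 : ℂ) ^ 2 + (Real.cos p.1 : ℂ) ^ 2 = 1 := by exact_mod_cast hsc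
  have e1 : fieldC ⁅X, Y⁆ p = fderiv ℝ (fieldC Y) p (fieldC X p)
      - fderiv ℝ (fieldC X) p (fieldC Y p) := by
    rw [fderiv_fieldC, fderiv_fieldC]
    simp only [fieldC, angCoef, radCoef, radCoef', lie_right, lie_left, sl2Der_apply,
      Matrix.sub_apply, Matrix.mul_apply, Fin.sum_univ_two, Heis.sub_u, Heis.sub_v, Heis.add_u,
      Heis.add_v, Heis.lie_u, Heis.lie_v, hX, hY]
    generalize Real.sin p.1 = S at *
    generalize Real.cos p.1 = C at *
    ext
    · simp only [Prod.fst_sub]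
      grind
    · simp only [Prod.snd_sub]
      grind
  have e2 : multC r s ⁅X, Y⁆ p = fderiv ℝ (multC r s Y) p (fieldC X p)
      - fderiv ℝ (multC r s X) p (fieldC Y p) := by
    rw [fderiv_multC, fderiv_multC]
    simp only [multC, fieldC, angCoef, radCoef, radCoef', lie_right, lie_left, sl2Der_apply,
      Matrix.sub_apply, Matrix.mul_apply, Fin.sum_univ_two, Heis.sub_u, Heis.sub_v, Heis.add_u,
      Heis.add_v, Heis.lie_u, Heis.lie_v, Heis.sub_w, Heis.add_w, Heis.lie_w, hX, hY]
    generalize Real.sin p.1 = S at *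
    generalize Real.cos p.1 = C at *
    push_cast
    grind
  rw [← e1, ← e2]
  rfl

/-! ### The compact picture -/

/-- The compact picture `I''(q,r,s)`: smooth functions `F(θ, y)` on `ℝ²` with
`F(θ + jπ, (-1)^j y) = i^{-jq} F(θ, y)` for all integers `j`.  The underlying vector space depends
only on `q`; the parameters `r, s` enter in the action of `𝔤`. -/
def CompactPicture (q : ZMod 4) (_r _s : ℂ) : Submodule ℂ (ℝ × ℝ → ℂ) where
  carrier := {F | ContDiff ℝ ∞ F ∧ ∀ (j : ℤ) (θ y : ℝ),
    F (θ + j * Real.pi, (-1) ^ j * y) = Complex.I ^ (-(j * (q.val : ℤ))) * F (θ, y)}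
  zero_mem' := ⟨contDiff_const, by simp⟩
  add_mem' := fun hF hG => ⟨hF.1.add hG.1, fun j θ y => by
    simp only [Pi.add_apply, hF.2 j θ y, hG.2 j θ y, mul_add]⟩
  smul_mem' := fun c F hF => ⟨contDiff_const.smul hF.1, fun j θ y => by
    simp only [Pi.smul_apply, hF.2 j θ y, smul_eq_mul]; ring⟩

variable {q : ZMod 4} {r s : ℂ}

lemma opC_mem (X : SchrAlg) {F : ℝ × ℝ → ℂ} (hF : F ∈ CompactPicture q r s) :
    opC r s X F ∈ CompactPicture q r s := by
  refine ⟨contDiff_opC r s X hF.1, fun j θ y => ?_⟩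
  set c : ℂ := Complex.I ^ (-(j * (q.val : ℤ))) with hc
  have hε : ((-1 : ℝ) ^ j) * (-1) ^ j = 1 := by
    rw [← mul_zpow]; simp
  set ε : ℝ := (-1) ^ j with hεd
  let L : ℝ × ℝ →L[ℝ] ℝ × ℝ :=
    (ContinuousLinearMap.fst ℝ ℝ ℝ).prod (ε • ContinuousLinearMap.snd ℝ ℝ ℝ)
  have hL : HasFDerivAt (fun p : ℝ × ℝ => L p + ((j : ℝ) * Real.pi, (0 : ℝ))) L (θ, y) :=
    L.hasFDerivAt.add_const _
  have hp : L (θ, y) + ((j : ℝ) * Real.pi, (0 : ℝ)) = (θ + j * Real.pi, ε * y) := by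
    simp [L]
  have hD : HasFDerivAt F (fderiv ℝ F (θ + j * Real.pi, ε * y))
      (L (θ, y) + ((j : ℝ) * Real.pi, (0 : ℝ))) := by
    rw [hp]
    exact (hF.1.differentiable (by simp) _).hasFDerivAt
  have hcomp := hD.comp (θ, y) hL
  have hfun : F ∘ (fun p : ℝ × ℝ => L p + ((j : ℝ) * Real.pi, (0 : ℝ))) = fun p => c * F p := by
    funext p
    have := hF.2 j p.1 p.2
    have e : L p + ((j : ℝ) * Real.pi, (0 : ℝ)) = (p.1 + j * Real.pi, ε * p.2) := by
      simp [L]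
    rw [Function.comp_apply, e]
    exact this
  rw [hfun] at hcomp
  have hu := hcomp.unique (((hF.1.differentiable (by simp) (θ, y)).hasFDerivAt).const_mul c)
  have hv : ∀ v, fderiv ℝ F (θ + j * Real.pi, ε * y) (L v) = c * fderiv ℝ F (θ, y) v := by
    intro v
    have := congrArg (fun T => T v) hu
    simpa using this
  have hsin : Real.sin (θ + j * Real.pi) = ε * Real.sin θ := Real.sin_add_int_mul_pi θ j
  have hcos : Real.cos (θ + j * Real.pi) = ε * Real.cos θ := Real.cos_add_int_mul_pi θ j
  have ha : angCoef X (θ + j * Real.pi) = angCoef X θ := by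
    simp only [angCoef, hsin, hcos]
    linear_combination (-2 * X.right.1 0 0 * Real.sin θ * Real.cos θ
      - X.right.1 0 1 * Real.cos θ ^ 2 + X.right.1 1 0 * Real.sin θ ^ 2) * hε
  have hr : radCoef X (θ + j * Real.pi) = radCoef X θ := by
    simp only [radCoef, hsin, hcos]
    linear_combination (-X.right.1 0 0 * (Real.cos θ ^ 2 - Real.sin θ ^ 2)
      + (X.right.1 0 1 + X.right.1 1 0) * Real.sin θ * Real.cos θ) * hε
  have hr' : radCoef' X (θ + j * Real.pi) = radCoef' X θ := by
    simp only [radCoef', hsin, hcos]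
    linear_combination (4 * X.right.1 0 0 * Real.sin θ * Real.cos θ
      + (X.right.1 0 1 + X.right.1 1 0) * (Real.cos θ ^ 2 - Real.sin θ ^ 2)) * hε
  have hξ : fieldC X (θ + j * Real.pi, ε * y) = L (fieldC X (θ, y)) := by
    simp only [fieldC, ha, hr, hsin, hcos, L]
    ext
    · simp
    · simp; ring
  have hεC : (ε : ℂ) * ε = 1 := by exact_mod_cast hε
  have hμ : multC r s X (θ + j * Real.pi, ε * y) = multC r s X (θ, y) := by
    simp only [multC, hr, hr', hsin, hcos]
    push_cast
    linear_combination (-s * radCoef' X θ * y ^ 2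
      - 2 * s * y * (X.left.u * Complex.sin θ + X.left.v * Complex.cos θ)) * hεC
  change fderiv ℝ F _ (fieldC X _) + multC r s X _ * F _ =
    c * (fderiv ℝ F _ (fieldC X _) + multC r s X _ * F _)
  rw [hξ, hv, hμ, hF.2 j θ y]
  ring

instance : LieRingModule SchrAlg (CompactPicture q r s) where
  bracket X F := ⟨opC r s X F.1, opC_mem X F.2⟩
  add_lie X Y F := by
    apply Subtype.ext
    funext p
    change opC r s (X + Y) F.1 p = opC r s X F.1 p + opC r s Y F.1 p
    have e1 : fieldC (X + Y) p = fieldC X p + fieldC Y p := by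
      ext <;> simp [fieldC, angCoef, radCoef] <;> ring
    have e2 : multC r s (X + Y) p = multC r s X p + multC r s Y p := by
      simp [multC, radCoef, radCoef']
      ring
    simp only [opC, firstOrder, e1, e2, map_add]
    ring
  lie_add X F G := by
    apply Subtype.ext
    funext p
    change opC r s X (F.1 + G.1) p = opC r s X F.1 p + opC r s X G.1 p
    simp only [opC, firstOrder]
    rw [fderiv_add (F.2.1.differentiable (by simp) p) (G.2.1.differentiable (by simp) p)]
    simp
    ring
  leibniz_lie X Y F := by
    apply Subtype.ext
    have h := opC_lie r s X Y F.2.1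
    change opC r s X (opC r s Y F.1) = opC r s ⁅X, Y⁆ F.1 + opC r s Y (opC r s X F.1)
    rw [h]; abel

lemma lie_complex_smul (X : SchrAlg) (c : ℂ) (F : CompactPicture q r s) :
    ⁅X, c • F⁆ = c • ⁅X, F⁆ := by
  apply Subtype.ext
  funext p
  change opC r s X (c • F.1) p = c * opC r s X F.1 p
  simp only [opC, firstOrder]
  rw [fderiv_const_smul (F.2.1.differentiable (by simp) p)]
  simp
  ring

instance : LieModule ℝ SchrAlg (CompactPicture q r s) where
  smul_lie t X F := by
    apply Subtype.ext
    funext p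
    change opC r s (t • X) F.1 p = (t : ℂ) * opC r s X F.1 p
    have e1 : fieldC (t • X) p = t • fieldC X p := by
      ext <;> simp [fieldC, angCoef, radCoef] <;> ring
    have e2 : multC r s (t • X) p = t * multC r s X p := by
      simp [multC, radCoef, radCoef']
      ring
    simp only [opC, firstOrder, e1, e2, map_smul, Complex.real_smul]
    ring
  lie_smul t X F := by
    have h := lie_complex_smul X (t : ℂ) F
    exact h

/-- The action of one element of `𝔤`, as a complex linear operator on `I''(q,r,s)`. -/
def act (X : SchrAlg) : Module.End ℂ (CompactPicture q r s) where
  toFun F := ⁅X, F⁆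
  map_add' F G := lie_add X F G
  map_smul' c F := lie_complex_smul X c F

/-- The operator by which the Casimir element `Ω = h²/2 - h + 2e⁺e⁻` of `𝔰𝔩(2)` acts. -/
def casimir (q : ZMod 4) (r s : ℂ) : Module.End ℂ (CompactPicture q r s) :=
  (1 / 2 : ℂ) • (act sl2H * act sl2H) - act sl2H + (2 : ℂ) • (act sl2E * act sl2F)

/-- The operator by which `Ω' = 2Ω - r(r+2)` acts. -/
def casimir' (q : ZMod 4) (r s : ℂ) : Module.End ℂ (CompactPicture q r s) :=
  (2 : ℂ) • casimir q r s - (r * (r + 2)) • 1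

/-- The translates `F(θ - τ, y)`, `τ ∈ ℝ`, of `F` under the group `K`, the covering of the rotation
group. -/
def kTranslate (F : ℝ × ℝ → ℂ) (τ : ℝ) (p : ℝ × ℝ) : ℂ := F (p.1 - τ, p.2)

/-- The subspace of `K`-finite vectors: those whose `K`-translates span a finite-dimensional
space. -/
def kFinite (q : ZMod 4) (r s : ℂ) : Submodule ℂ (CompactPicture q r s) where
  carrier := {F | FiniteDimensional ℂ (Submodule.span ℂ (Set.range (kTranslate F.1)))}
  zero_mem' := by
    have h : Submodule.span ℂ (Set.range (kTranslate (0 : ℝ × ℝ → ℂ))) ≤ ⊥ := by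
      rw [Submodule.span_le]
      rintro _ ⟨τ, rfl⟩
      rfl
    exact Submodule.finiteDimensional_of_le h
  add_mem' {F G} hF hG := by
    have hF' : FiniteDimensional ℂ (Submodule.span ℂ (Set.range (kTranslate F.1))) := hF
    have hG' : FiniteDimensional ℂ (Submodule.span ℂ (Set.range (kTranslate G.1))) := hG
    have h : Submodule.span ℂ (Set.range (kTranslate (F.1 + G.1))) ≤
        Submodule.span ℂ (Set.range (kTranslate F.1)) ⊔
          Submodule.span ℂ (Set.range (kTranslate G.1)) := by
      rw [Submodule.span_le]
      rintro _ ⟨τ, rfl⟩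
      exact Submodule.add_mem_sup (Submodule.subset_span ⟨τ, rfl⟩)
        (Submodule.subset_span ⟨τ, rfl⟩)
    exact Submodule.finiteDimensional_of_le h
  smul_mem' c F hF := by
    have hF' : FiniteDimensional ℂ (Submodule.span ℂ (Set.range (kTranslate F.1))) := hF
    have h : Submodule.span ℂ (Set.range (kTranslate (c • F.1))) ≤
        Submodule.span ℂ (Set.range (kTranslate F.1)) := by
      rw [Submodule.span_le]
      rintro _ ⟨τ, rfl⟩
      exact Submodule.smul_mem _ c (Submodule.subset_span ⟨τ, rfl⟩)
    exact Submodule.finiteDimensional_of_le h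

/-! ### The Schrödinger parameters `r = -1/2`, `s = i/2` -/

/-- The `𝔤`-module `I''(q, -1/2, i/2)`. -/
abbrev Pic (q : ZMod 4) : Submodule ℂ (ℝ × ℝ → ℂ) :=
  CompactPicture q (-1 / 2) (Complex.I / 2)

/-- The space `ker(Ω' - 2λ)_K` of `K`-finite solutions. -/
def kFiniteSol (q : ZMod 4) (lam : ℂ) : Submodule ℂ (Pic q) :=
  (casimir' q (-1 / 2) (Complex.I / 2)).eigenspace (2 * lam) ⊓ kFinite q (-1 / 2) (Complex.I / 2)

/-- Kummer's confluent hypergeometric function `₁F₁(a, b, z) = ∑ₙ (a)ₙ / (b)ₙ · zⁿ / n!`. -/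
def kummer (a b z : ℝ) : ℝ :=
  ∑' n : ℕ, (ascPochhammer ℝ n).eval a / (ascPochhammer ℝ n).eval b * z ^ n / (n.factorial : ℝ)

/-- `Ψ_{m,k}(θ,y) = e^{-imθ/2} e^{-y²/2} y^k ₁F₁((1+2k-m)/4, k+1/2, y²)`. -/
def Psi (m : ℤ) (k : ℕ) (p : ℝ × ℝ) : ℂ :=
  Complex.exp (-Complex.I * m * p.1 / 2) *
    (Real.exp (-p.2 ^ 2 / 2) * p.2 ^ k
      * kummer ((1 + 2 * (k : ℝ) - m) / 4) ((k : ℝ) + 1 / 2) (p.2 ^ 2) : ℝ)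

/-- The span, inside `I''(q)`, of the functions `Ψ_{m,k}` with `m` ranging over a set. -/
def spanPsi (q : ZMod 4) (k : ℕ) (S : Set ℤ) : Submodule ℂ (Pic q) :=
  Submodule.span ℂ {F | ∃ m ∈ S, F.1 = Psi m k}

/-- `H_k`, spanned by the `Ψ_{m,k}` with `m ≡ 2k + q (mod 4)`. -/
def solSpace (q : ZMod 4) (k : ℕ) : Submodule ℂ (Pic q) :=
  spanPsi q k {m | (m : ZMod 4) = 2 * (k : ZMod 4) + q}

/-- `H_k⁺` (used for `q ≡ 1`), spanned by the `Ψ_{m,k}` with `m ≥ 2k+1`, `m ≡ 2k+1 (mod 4)`: the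
lowest weight submodule of `H_k`. -/
def solPlus (q : ZMod 4) (k : ℕ) : Submodule ℂ (Pic q) :=
  spanPsi q k {m | 2 * (k : ℤ) + 1 ≤ m ∧ m ≡ 2 * (k : ℤ) + 1 [ZMOD 4]}

/-- `H_k⁻` (used for `q ≡ -1`), spanned by the `Ψ_{m,k}` with `m ≤ -(2k+1)`,
`m ≡ -(2k+1) (mod 4)`: the highest weight submodule of `H_k`. -/
def solMinus (q : ZMod 4) (k : ℕ) : Submodule ℂ (Pic q) :=
  spanPsi q k {m | m ≤ -(2 * (k : ℤ) + 1) ∧ m ≡ -(2 * (k : ℤ) + 1) [ZMOD 4]}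

/-- A list of subspaces `W₀, W₁, …, Wₙ` of a representation is (the list of terms of) a composition
series: all of them are `𝔤`-submodules, `Wᵢ` is properly contained in `Wᵢ₊₁`, and there is no
`𝔤`-submodule strictly between the two, i.e. the module `Wᵢ₊₁/Wᵢ` is irreducible. -/
def IsCompositionSeries {V : Type*} [AddCommGroup V] [Module ℂ V] [LieRingModule SchrAlg V]
    (W : List (Submodule ℂ V)) : Prop :=
  ∃ N : List (LieSubmodule ℂ SchrAlg V),
    N.map (fun U => U.toSubmodule) = W ∧ N.IsChain (fun U U' => U ⋖ U')

end SchrodingerRep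
end

noncomputable section

namespace SchrodingerRep

/-! ### Kummer's function -/

/-- The coefficients `(a)ₙ / ((b)ₙ n!)` of Kummer's series. -/
def kummerCoeff (a b : ℝ) (n : ℕ) : ℝ :=
  (ascPochhammer ℝ n).eval a / (ascPochhammer ℝ n).eval b / (n.factorial : ℝ)

lemma ascPochhammer_eval_succ_left (a : ℝ) (n : ℕ) :
    a * (ascPochhammer ℝ n).eval (a + 1) = (ascPochhammer ℝ n).eval a * (a + n) := by
  rw [← ascPochhammer_succ_eval, ascPochhammer_succ_left]
  simp

lemma ascPochhammer_eval_pos {b : ℝ} (hb : 0 < b) (n : ℕ) :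
    0 < (ascPochhammer ℝ n).eval b := ascPochhammer_pos n b hb

lemma kummerCoeff_zero (a b : ℝ) : kummerCoeff a b 0 = 1 := by simp [kummerCoeff]

lemma kummerCoeff_succ (a : ℝ) {b : ℝ} (hb : 0 < b) (n : ℕ) :
    (n + 1) * kummerCoeff a b (n + 1) = a / b * kummerCoeff (a + 1) (b + 1) n := by
  have hB := (ascPochhammer_eval_pos hb n).ne'
  have hB' := (ascPochhammer_eval_pos (add_pos hb one_pos) n).ne'
  have hbn : b + n ≠ 0 := by positivity
  have hn : (n : ℝ) + 1 ≠ 0 := by positivity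
  have hf : (n.factorial : ℝ) ≠ 0 := by positivity
  have e1 := ascPochhammer_eval_succ_left a n
  have e2 := ascPochhammer_eval_succ_left b n
  simp only [kummerCoeff, ascPochhammer_succ_eval, Nat.factorial_succ]
  push_cast
  rw [← e1, ← e2]
  field_simp

lemma kummerCoeff_sub (a : ℝ) {b : ℝ} (hb : 0 < b) (n : ℕ) :
    kummerCoeff a b n - a / b * kummerCoeff (a + 1) (b + 1) n =
      (b - a) / b * kummerCoeff a (b + 1) n := by
  have hB := (ascPochhammer_eval_pos hb n).ne'
  have hB' := (ascPochhammer_eval_pos (add_pos hb one_pos) n).ne'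
  have hbn : b + n ≠ 0 := by positivity
  have hf : (n.factorial : ℝ) ≠ 0 := by positivity
  have e1 := ascPochhammer_eval_succ_left a n
  have e2 := ascPochhammer_eval_succ_left b n
  simp only [kummerCoeff]
  field_simp
  linear_combination (-(ascPochhammer ℝ n).eval b) * e1 + (ascPochhammer ℝ n).eval a * e2

lemma kummerCoeff_shift (a : ℝ) {b : ℝ} (hb : 0 < b) (n : ℕ) :
    (b + n) * kummerCoeff a (b + 1) n = b * kummerCoeff a b n := by
  have hB := (ascPochhammer_eval_pos hb n).ne'
  have hB' := (ascPochhammer_eval_pos (add_pos hb one_pos) n).ne'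
  have hf : (n.factorial : ℝ) ≠ 0 := by positivity
  have e2 := ascPochhammer_eval_succ_left b n
  simp only [kummerCoeff]
  field_simp
  linear_combination (-(ascPochhammer ℝ n).eval a) * e2

lemma kummerCoeff_contig (a : ℝ) {b : ℝ} (hb : 0 < b) (n : ℕ) :
    b * kummerCoeff (a + 1) b (n + 1) - kummerCoeff (a + 1) (b + 1) n =
      b * kummerCoeff a b (n + 1) := by
  have hB := (ascPochhammer_eval_pos hb n).ne'
  have hB' := (ascPochhammer_eval_pos (add_pos hb one_pos) n).ne'
  have hbn : b + n ≠ 0 := by positivity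
  have hf : (n.factorial : ℝ) ≠ 0 := by positivity
  have hn : (n : ℝ) + 1 ≠ 0 := by positivity
  have e1 := ascPochhammer_eval_succ_left a n
  have e2 := ascPochhammer_eval_succ_left b n
  simp only [kummerCoeff, ascPochhammer_succ_eval, Nat.factorial_succ]
  push_cast
  rw [← e1, ← e2]
  field_simp
  ring

/-- Each factor (a+j)/(b+j) is at most |a|/b + 1 in absolute value. Comparison with an exponential
series then gives convergence everywhere. -/
lemma abs_kummerCoeff_le (a : ℝ) {b : ℝ} (hb : 0 < b) (n : ℕ) :
    |kummerCoeff a b n| ≤ (|a| / b + 1) ^ n / n.factorial := by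
  have key : |(ascPochhammer ℝ n).eval a / (ascPochhammer ℝ n).eval b| ≤ (|a| / b + 1) ^ n := by
    induction n with
    | zero => simp
    | succ n ih =>
      have hbn : 0 < b + n := by positivity
      rw [ascPochhammer_succ_eval, ascPochhammer_succ_eval, mul_div_mul_comm, abs_mul, pow_succ]
      refine mul_le_mul ih ?_ (abs_nonneg _) (by positivity)
      rw [abs_div, abs_of_pos hbn, div_le_iff₀ hbn]
      have h1 : |a + n| ≤ |a| + n := (abs_add_le _ _).trans (by simp)
      have h2 : (|a| / b + 1) * (b + n) = |a| + n + (|a| / b * n + b) := by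
        field_simp
        ring
      have h3 : 0 ≤ |a| / b * n + b := by positivity
      linarith
  rw [kummerCoeff, abs_div, Nat.abs_cast]
  gcongr

lemma kummer_eq (a b z : ℝ) : kummer a b z = ∑' n, kummerCoeff a b n * z ^ n := by
  unfold kummer kummerCoeff
  congr 1
  ext n
  ring

lemma hasSum_congr_fun {f g : ℕ → ℝ} {c : ℝ} (h : ∀ n, f n = g n) :
    HasSum f c ↔ HasSum g c := by rw [funext h]

lemma summable_kummer (a : ℝ) {b : ℝ} (hb : 0 < b) (z : ℝ) :
    Summable fun n => kummerCoeff a b n * z ^ n := by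
  refine Summable.of_norm_bounded (Real.summable_pow_div_factorial ((|a| / b + 1) * |z|)) fun n => ?_
  rw [norm_mul, norm_pow, Real.norm_eq_abs, Real.norm_eq_abs, mul_pow, mul_div_right_comm]
  gcongr
  exact abs_kummerCoeff_le a hb n

lemma hasSum_kummer (a : ℝ) {b : ℝ} (hb : 0 < b) (z : ℝ) :
    HasSum (fun n => kummerCoeff a b n * z ^ n) (kummer a b z) := by
  rw [kummer_eq]
  exact (summable_kummer a hb z).hasSum

lemma kummer_zero (a b : ℝ) : kummer a b 0 = 1 := by
  rw [kummer_eq, tsum_eq_single 0 (fun n hn => by simp [hn])]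
  simp [kummerCoeff_zero]

lemma hasSum_kummer_deriv (a : ℝ) {b : ℝ} (hb : 0 < b) (z : ℝ) :
    HasSum (fun n : ℕ => kummerCoeff a b n * (n * z ^ (n - 1)))
      (a / b * kummer (a + 1) (b + 1) z) := by
  have h := (hasSum_kummer (a + 1) (add_pos hb one_pos) z).mul_left (a / b)
  rw [← hasSum_nat_add_iff' 1]
  simp only [Finset.range_one, Finset.sum_singleton, Nat.cast_zero, zero_mul, mul_zero, sub_zero]
  refine (hasSum_congr_fun fun n => ?_).2 h
  have e := kummerCoeff_succ a hb n
  push_cast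
  linear_combination z ^ n * e

lemma hasDerivAt_kummer (a : ℝ) {b : ℝ} (hb : 0 < b) (z : ℝ) :
    HasDerivAt (kummer a b) (a / b * kummer (a + 1) (b + 1) z) z := by
  set C : ℝ := |a| / b + 1 with hC
  -- Termwise differentiation needs a bound uniform near z; the ball of radius |z| + 1 supplies it.
  set R : ℝ := |z| + 1 with hR
  have hR0 : 0 < R := by positivity
  have hu : Summable fun n : ℕ => C ^ n / n.factorial * (n * R ^ (n - 1)) := by
    rw [← summable_nat_add_iff 1]
    refine ((Real.summable_pow_div_factorial (C * R)).mul_left C).congr fun n => ?_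
    rw [Nat.factorial_succ, Nat.add_sub_cancel]
    push_cast
    have hf : (n.factorial : ℝ) ≠ 0 := by positivity
    have hn : (n : ℝ) + 1 ≠ 0 := by positivity
    rw [pow_succ C, mul_pow]
    field_simp
  have hz : z ∈ Metric.ball (0 : ℝ) R := by simp [hR]
  have h := hasDerivAt_tsum_of_isPreconnected (𝕜 := ℝ)
    (g := fun (n : ℕ) (y : ℝ) => kummerCoeff a b n * y ^ n)
    (g' := fun (n : ℕ) (y : ℝ) => kummerCoeff a b n * (n * y ^ (n - 1)))
    hu Metric.isOpen_ball (convex_ball (0 : ℝ) R).isPreconnected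
    (fun n y _ => (hasDerivAt_pow n y).const_mul _) (fun n y hy => ?_) hz
    (summable_kummer a hb z) hz
  · rw [(hasSum_kummer_deriv a hb z).tsum_eq] at h
    rwa [show kummer a b = fun w => ∑' n, kummerCoeff a b n * w ^ n from
      funext (kummer_eq a b)]
  · have hy' : |y| ≤ R := by simpa using (mem_ball_zero_iff.1 hy).le
    rw [norm_mul, norm_mul, norm_pow, Real.norm_eq_abs, Real.norm_eq_abs, Real.norm_eq_abs,
      Nat.abs_cast]
    gcongr
    exact abs_kummerCoeff_le a hb n

/-- The derivative is again a Kummer function, with both parameters raised by one, so smoothness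
follows by induction over all parameters at once. -/
lemma contDiff_kummer (n : ℕ) (a : ℝ) {b : ℝ} (hb : 0 < b) : ContDiff ℝ n (kummer a b) := by
  induction n generalizing a b with
  | zero =>
    exact contDiff_zero.2 (Differentiable.continuous fun z =>
      (hasDerivAt_kummer a hb z).differentiableAt)
  | succ n ih =>
    have hd : deriv (kummer a b) = fun z => a / b * kummer (a + 1) (b + 1) z :=
      funext fun z => (hasDerivAt_kummer a hb z).deriv
    push_cast
    refine contDiff_succ_iff_deriv.2 ⟨fun z => (hasDerivAt_kummer a hb z).differentiableAt,
      by simp, ?_⟩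
    rw [hd]
    exact contDiff_const.mul (ih (a + 1) (add_pos hb one_pos))

/-- The subtracted term is the derivative of the Kummer function. For the parameters of Ψ_{m,k} one
has b - a = (m+1+2k)/4, which becomes the factor of `raise`. -/
lemma kummer_sub_deriv (a : ℝ) {b : ℝ} (hb : 0 < b) (z : ℝ) :
    kummer a b z - a / b * kummer (a + 1) (b + 1) z = (b - a) / b * kummer a (b + 1) z := by
  have hb' := add_pos hb one_pos
  have h1 := (hasSum_kummer a hb z).sub ((hasSum_kummer (a + 1) hb' z).mul_left (a / b))
  have h2 := (hasSum_kummer a hb' z).mul_left ((b - a) / b)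
  refine h1.unique ((hasSum_congr_fun fun n => ?_).1 h2)
  linear_combination -z ^ n * kummerCoeff_sub a hb n

/-- The operator 1 + (z/b)d/dz multiplies the n-th coefficient by (b+n)/b, exactly the ratio of the
coefficients for b and b+1. -/
lemma kummer_add_deriv (a : ℝ) {b : ℝ} (hb : 0 < b) (z : ℝ) :
    kummer a (b + 1) z + z / b * (a / (b + 1) * kummer (a + 1) (b + 1 + 1) z) =
      kummer a b z := by
  have hb' := add_pos hb one_pos
  have h1 := (hasSum_kummer a hb' z).add ((hasSum_kummer_deriv a hb' z).mul_left (z / b))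
  have h2 := hasSum_kummer a hb z
  refine h1.unique ((hasSum_congr_fun fun n => ?_).1 h2)
  rcases n with _ | n
  · simp [kummerCoeff_zero]
  · have e := kummerCoeff_shift a hb (n + 1)
    rw [Nat.add_sub_cancel]
    push_cast at e ⊢
    field_simp
    linear_combination -z ^ (n + 1) * e

lemma kummer_contig (a : ℝ) {b : ℝ} (hb : 0 < b) (z : ℝ) :
    kummer (a + 1) b z - z / b * kummer (a + 1) (b + 1) z = kummer a b z := by
  have hb' := add_pos hb one_pos
  have h1 := hasSum_kummer (a + 1) hb z
  have h2 := (hasSum_kummer (a + 1) hb' z).mul_left (z / b)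
  have h3 := hasSum_kummer a hb z
  rw [← hasSum_nat_add_iff' 1] at h1 h3
  have h4 := (h1.sub h2).unique ((hasSum_congr_fun fun n => ?_).1 h3)
  · simp only [Finset.range_one, Finset.sum_singleton, kummerCoeff_zero, pow_zero] at h4
    linarith
  · have e := kummerCoeff_contig a hb n
    field_simp
    linear_combination -z ^ (n + 1) * e

/-! ### The radial functions -/

/-- The radial factor `e^{-y²/2} y^k ₁F₁((1+2k-m)/4, k+1/2, y²)` of `Ψ_{m,k}`. -/
def radial (m : ℤ) (k : ℕ) (y : ℝ) : ℝ :=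
  Real.exp (-y ^ 2 / 2) * y ^ k
    * kummer ((1 + 2 * (k : ℝ) - m) / 4) ((k : ℝ) + 1 / 2) (y ^ 2)

/-- The even factor `e^{-y²/2} ₁F₁((1+2k-m)/4, k+1/2, y²)` of `radial m k`. -/
def radialEven (m : ℤ) (k : ℕ) (y : ℝ) : ℝ :=
  Real.exp (-y ^ 2 / 2) * kummer ((1 + 2 * (k : ℝ) - m) / 4) ((k : ℝ) + 1 / 2) (y ^ 2)

lemma radial_eq (m : ℤ) (k : ℕ) : radial m k = fun y => y ^ k * radialEven m k y := by
  funext y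
  simp only [radial, radialEven]
  ring

lemma radialEven_zero (m : ℤ) (k : ℕ) : radialEven m k 0 = 1 := by
  simp [radialEven, kummer_zero]

lemma contDiff_radialEven (m : ℤ) (k : ℕ) : ContDiff ℝ ∞ (radialEven m k) := by
  have hk : ContDiff ℝ ∞ (kummer ((1 + 2 * (k : ℝ) - m) / 4) ((k : ℝ) + 1 / 2)) :=
    contDiff_infty.2 fun n => contDiff_kummer n _ (by positivity)
  exact (Real.contDiff_exp.comp (by fun_prop)).mul (hk.comp (by fun_prop))

lemma contDiff_radial (m : ℤ) (k : ℕ) : ContDiff ℝ ∞ (radial m k) := by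
  rw [radial_eq]
  exact (contDiff_id.pow k).mul (contDiff_radialEven m k)

lemma radial_neg (m : ℤ) (k : ℕ) (y : ℝ) : radial m k (-y) = (-1) ^ k * radial m k y := by
  simp only [radial, even_two.neg_pow, neg_pow y k]
  ring

lemma deriv_radial (m : ℤ) (k : ℕ) (y : ℝ) :
    deriv (radial m k) y = Real.exp (-y ^ 2 / 2) *
      ((k * y ^ (k - 1) - y ^ (k + 1)) *
          kummer ((1 + 2 * (k : ℝ) - m) / 4) ((k : ℝ) + 1 / 2) (y ^ 2)
        + 2 * y ^ (k + 1) * ((1 + 2 * (k : ℝ) - m) / 4 / ((k : ℝ) + 1 / 2) *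
          kummer ((1 + 2 * (k : ℝ) - m) / 4 + 1) ((k : ℝ) + 1 / 2 + 1) (y ^ 2))) := by
  have hb : (0 : ℝ) < (k : ℝ) + 1 / 2 := by positivity
  have h1 : HasDerivAt (fun y : ℝ => Real.exp (-y ^ 2 / 2)) (Real.exp (-y ^ 2 / 2) * (-y)) y := by
    have h := (((hasDerivAt_pow 2 y).fun_neg).div_const 2).exp
    convert h using 1
    push_cast
    ring
  have h2 := (hasDerivAt_kummer ((1 + 2 * (k : ℝ) - m) / 4) hb (y ^ 2)).comp y
    (hasDerivAt_pow 2 y)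
  have h : HasDerivAt (radial m k) _ y := (h1.mul (hasDerivAt_pow k y)).mul h2
  rw [h.deriv]
  simp only [Pi.mul_apply]
  push_cast
  ring

/-- Passing to m+4 lowers the first Kummer parameter by one. The factor vanishes at m = -(2k+1),
which makes Ψ_{m,k} a highest weight vector there. -/
lemma radial_raise (m : ℤ) (k : ℕ) (y : ℝ) :
    (y ^ 2 - (m + 1) / 2) * radial m k y - y * deriv (radial m k) y =
      -((m + 1 + 2 * k) / 2) * radial (m + 4) k y := by
  have hb : (0 : ℝ) < (k : ℝ) + 1 / 2 := by positivity
  have hk : y * (k * y ^ (k - 1)) = k * y ^ k := by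
    rcases k with _ | k
    · simp
    · rw [Nat.add_sub_cancel]; ring
  rw [deriv_radial]
  simp only [radial]
  have e1 := kummer_sub_deriv ((1 + 2 * (k : ℝ) - m) / 4) hb (y ^ 2)
  have e2 := kummer_contig ((1 + 2 * (k : ℝ) - m) / 4 - 1) hb (y ^ 2)
  have e3 : (1 + 2 * (k : ℝ) - (m + 4 : ℤ)) / 4 = (1 + 2 * (k : ℝ) - m) / 4 - 1 := by
    push_cast; ring
  rw [sub_add_cancel] at e2
  rw [e3]
  linear_combination (Real.exp (-y ^ 2 / 2) * y ^ k * (2 * y ^ 2)) * e1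
    - ((m + 1 + 2 * k) / 2 * Real.exp (-y ^ 2 / 2) * y ^ k) * e2
    - (Real.exp (-y ^ 2 / 2)
      * kummer ((1 + 2 * (k : ℝ) - m) / 4) ((k : ℝ) + 1 / 2) (y ^ 2)) * hk

/-- The factor is -2a with a the first Kummer parameter. It vanishes at m = 2k+1, where the Kummer
series reduces to 1. -/
lemma radial_lower (m : ℤ) (k : ℕ) (y : ℝ) :
    ((m - 1) / 2 - y ^ 2) * radial m k y - y * deriv (radial m k) y =
      (m - 1 - 2 * k) / 2 * radial (m - 4) k y := by
  have hb : (0 : ℝ) < (k : ℝ) + 1 / 2 := by positivity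
  have hk : y * (k * y ^ (k - 1)) = k * y ^ k := by
    rcases k with _ | k
    · simp
    · rw [Nat.add_sub_cancel]; ring
  rw [deriv_radial]
  simp only [radial]
  have e2 := kummer_contig ((1 + 2 * (k : ℝ) - m) / 4) hb (y ^ 2)
  have e3 : (1 + 2 * (k : ℝ) - (m - 4 : ℤ)) / 4 = (1 + 2 * (k : ℝ) - m) / 4 + 1 := by
    push_cast; ring
  rw [e3]
  linear_combination (-(m - 1 - 2 * k) / 2 * Real.exp (-y ^ 2 / 2) * y ^ k) * e2
    - (Real.exp (-y ^ 2 / 2)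
      * kummer ((1 + 2 * (k : ℝ) - m) / 4) ((k : ℝ) + 1 / 2) (y ^ 2)) * hk

lemma radial_annih_zero (m : ℤ) (y : ℝ) :
    y * radial m 0 y + deriv (radial m 0) y = (1 - m) * radial (m - 2) 1 y := by
  rw [deriv_radial]
  simp only [radial]
  have e3 : (1 + 2 * ((1 : ℕ) : ℝ) - (m - 2 : ℤ)) / 4 = (1 + 2 * ((0 : ℕ) : ℝ) - m) / 4 + 1 := by
    push_cast; ring
  have e4 : ((1 : ℕ) : ℝ) + 1 / 2 = ((0 : ℕ) : ℝ) + 1 / 2 + 1 := by push_cast; ring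
  rw [e3, e4]
  push_cast
  ring

lemma radial_create_zero (m : ℤ) (y : ℝ) :
    y * radial m 0 y - deriv (radial m 0) y = (1 + m) * radial (m + 2) 1 y := by
  rw [deriv_radial]
  simp only [radial]
  have e1 := kummer_sub_deriv ((1 + 2 * ((0 : ℕ) : ℝ) - m) / 4)
    (by norm_num : (0 : ℝ) < ((0 : ℕ) : ℝ) + 1 / 2) (y ^ 2)
  have e3 : (1 + 2 * ((1 : ℕ) : ℝ) - (m + 2 : ℤ)) / 4 = (1 + 2 * ((0 : ℕ) : ℝ) - m) / 4 := by
    push_cast; ring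
  have e4 : ((1 : ℕ) : ℝ) + 1 / 2 = ((0 : ℕ) : ℝ) + 1 / 2 + 1 := by push_cast; ring
  rw [e3, e4]
  linear_combination (exp := 1) (2 * Real.exp (-y ^ 2 / 2) * y) * e1

/-- The source has level k+1. The factor k of the upward term kills it for level 1, which is why H_0
+ H_1 is stable under the Heisenberg algebra. -/
lemma radial_annih_succ (m : ℤ) (k : ℕ) (y : ℝ) :
    y * radial m (k + 1) y + deriv (radial m (k + 1)) y =
      (k + 1) * radial (m - 2) k y
        + k * (2 * k + 3 - m) / ((2 * k + 1) * (2 * k + 3)) * radial (m - 2) (k + 2) y := by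
  have hb : (0 : ℝ) < (k : ℝ) + 1 / 2 := by positivity
  have h1 : (2 * (k : ℝ) + 1) ≠ 0 := by positivity
  have h3 : (2 * (k : ℝ) + 3) ≠ 0 := by positivity
  rw [deriv_radial]
  simp only [radial]
  set a : ℝ := (1 + 2 * ((k + 1 : ℕ) : ℝ) - m) / 4 with ha
  have e1 : (1 + 2 * (k : ℝ) - (m - 2 : ℤ)) / 4 = a := by
    rw [ha]; push_cast; ring
  have e2 : (1 + 2 * ((k + 2 : ℕ) : ℝ) - (m - 2 : ℤ)) / 4 = a + 1 := by
    rw [ha]; push_cast; ring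
  have e3 : ((k + 1 : ℕ) : ℝ) + 1 / 2 = (k : ℝ) + 1 / 2 + 1 := by push_cast; ring
  have e4 : ((k + 2 : ℕ) : ℝ) + 1 / 2 = (k : ℝ) + 1 / 2 + 1 + 1 := by push_cast; ring
  have e5 : (2 * k + 3 - m : ℝ) = 4 * a := by rw [ha]; push_cast; ring
  have e := kummer_add_deriv a hb (y ^ 2)
  rw [e1, e2, e3, e4, e5, ← e, Nat.add_sub_cancel]
  have e6 : (k : ℝ) + 1 / 2 + 1 = (2 * k + 3) / 2 := by ring
  have e7 : (k : ℝ) + 1 / 2 = (2 * k + 1) / 2 := by ring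
  generalize kummer (a + 1) ((k : ℝ) + 1 / 2 + 1 + 1) (y ^ 2) = N
  generalize kummer a ((k : ℝ) + 1 / 2 + 1) (y ^ 2) = M
  rw [e6, e7]
  push_cast
  field_simp
  ring

lemma radial_create_succ (m : ℤ) (k : ℕ) (y : ℝ) :
    y * radial m (k + 1) y - deriv (radial m (k + 1)) y =
      -(k + 1) * radial (m + 2) k y
        + k * (2 * k + 3 + m) / ((2 * k + 1) * (2 * k + 3)) * radial (m + 2) (k + 2) y := by
  have hb : (0 : ℝ) < (k : ℝ) + 1 / 2 := by positivity
  have hb' : (0 : ℝ) < (k : ℝ) + 1 / 2 + 1 := by positivity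
  have h1 : (2 * (k : ℝ) + 1) ≠ 0 := by positivity
  have h3 : (2 * (k : ℝ) + 3) ≠ 0 := by positivity
  rw [deriv_radial]
  simp only [radial]
  set a : ℝ := (1 + 2 * ((k + 1 : ℕ) : ℝ) - m) / 4 with ha
  have e1 : (1 + 2 * (k : ℝ) - (m + 2 : ℤ)) / 4 = a - 1 := by
    rw [ha]; push_cast; ring
  have e2 : (1 + 2 * ((k + 2 : ℕ) : ℝ) - (m + 2 : ℤ)) / 4 = a := by
    rw [ha]; push_cast; ring
  have e3 : ((k + 1 : ℕ) : ℝ) + 1 / 2 = (k : ℝ) + 1 / 2 + 1 := by push_cast; ring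
  have e4 : ((k + 2 : ℕ) : ℝ) + 1 / 2 = (k : ℝ) + 1 / 2 + 1 + 1 := by push_cast; ring
  have e5 : (2 * k + 3 + m : ℝ) = 4 * ((2 * k + 3) / 2 - a) := by rw [ha]; push_cast; ring
  have f1 := kummer_sub_deriv a hb' (y ^ 2)
  have f2 := kummer_add_deriv (a - 1) hb (y ^ 2)
  have f3 := kummer_contig (a - 1) hb' (y ^ 2)
  rw [sub_add_cancel] at f2 f3
  rw [← f3] at f2
  rw [e1, e2, e3, e4, e5, ← f2, Nat.add_sub_cancel]
  have e6 : (k : ℝ) + 1 / 2 + 1 = (2 * k + 3) / 2 := by ring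
  have e7 : (k : ℝ) + 1 / 2 = (2 * k + 1) / 2 := by ring
  generalize kummer (a + 1) ((k : ℝ) + 1 / 2 + 1 + 1) (y ^ 2) = M' at *
  generalize kummer a ((k : ℝ) + 1 / 2 + 1 + 1) (y ^ 2) = N at *
  generalize kummer a ((k : ℝ) + 1 / 2 + 1) (y ^ 2) = M at *
  rw [e6] at f1
  rw [e6, e7]
  rw [sub_eq_iff_eq_add] at f1
  rw [f1]
  push_cast
  field_simp
  ring

/-! ### Weight vectors and ladder operators -/

/-- The function `e^{-imθ/2} g(y)`. -/
def wave (m : ℤ) (g : ℝ → ℂ) (p : ℝ × ℝ) : ℂ :=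
  Complex.exp (-Complex.I * m * p.1 / 2) * g p.2

lemma Psi_eq_wave (m : ℤ) (k : ℕ) : Psi m k = wave m fun y => (radial m k y : ℂ) := rfl

lemma wave_smul (m : ℤ) (c : ℂ) (g : ℝ → ℂ) : (wave m fun y => c * g y) = c • wave m g := by
  funext p
  simp only [wave, Pi.smul_apply, smul_eq_mul]
  ring

lemma wave_add (m : ℤ) (f g : ℝ → ℂ) : (wave m fun y => f y + g y) = wave m f + wave m g := by
  funext p
  simp only [wave, Pi.add_apply]
  ring

lemma fderiv_wave (m : ℤ) {g : ℝ → ℂ} (hg : Differentiable ℝ g) (p v : ℝ × ℝ) :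
    fderiv ℝ (wave m g) p v = Complex.exp (-Complex.I * m * p.1 / 2) *
      (-Complex.I * m / 2 * v.1 * g p.2 + v.2 * deriv g p.2) := by
  have f1 : HasFDerivAt (fun p : ℝ × ℝ => p.1) (ContinuousLinearMap.fst ℝ ℝ ℝ) p :=
    hasFDerivAt_fst
  have f2 : HasFDerivAt (fun p : ℝ × ℝ => p.2) (ContinuousLinearMap.snd ℝ ℝ ℝ) p :=
    hasFDerivAt_snd
  have e0 : HasDerivAt (fun θ : ℝ => Complex.exp (-Complex.I * m * θ / 2))
      (Complex.exp (-Complex.I * m * p.1 / 2) * (-Complex.I * m * 1 / 2)) p.1 :=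
    (((Complex.ofRealCLM.hasDerivAt (x := p.1)).const_mul (-Complex.I * m)).div_const 2).cexp
  have e1 := HasFDerivAt.comp p e0.hasFDerivAt f1
  have e2 := HasFDerivAt.comp p (hg p.2).hasFDerivAt f2
  have h : HasFDerivAt (wave m g) _ p := e1.mul e2
  rw [h.fderiv]
  simp
  ring

lemma opC_wave (r s : ℂ) (X : SchrAlg) (m : ℤ) {g : ℝ → ℂ} (hg : Differentiable ℝ g)
    (p : ℝ × ℝ) :
    opC r s X (wave m g) p = Complex.exp (-Complex.I * m * p.1 / 2) *
      (-Complex.I * m / 2 * angCoef X p.1 * g p.2 + (fieldC X p).2 * deriv g p.2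
        + multC r s X p * g p.2) := by
  simp only [opC, firstOrder, fderiv_wave m hg]
  simp only [wave, fieldC]
  ring

/-- The element `(1, 0, 0)` of the Heisenberg algebra. -/
def heisU : SchrAlg := ⟨⟨1, 0, 0⟩, 0⟩

/-- The element `(0, 1, 0)` of the Heisenberg algebra. -/
def heisV : SchrAlg := ⟨⟨0, 1, 0⟩, 0⟩

/-- The central element `(0, 0, 1)` of the Heisenberg algebra. -/
def heisW : SchrAlg := ⟨⟨0, 0, 1⟩, 0⟩

variable {q : ZMod 4}

/-- The generator `e⁺ - e⁻` of rotations. -/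
def rot (q : ZMod 4) : Module.End ℂ (Pic q) := act sl2E - act sl2F

/-- The operator raising the weight by four. -/
def raise (q : ZMod 4) : Module.End ℂ (Pic q) :=
  act sl2H + Complex.I • (act sl2E + act sl2F)

/-- The operator lowering the weight by four. -/
def lower (q : ZMod 4) : Module.End ℂ (Pic q) :=
  act sl2H - Complex.I • (act sl2E + act sl2F)

/-- The operator of the Heisenberg algebra raising the weight by two. -/
def create (q : ZMod 4) : Module.End ℂ (Pic q) := act heisU + Complex.I • act heisV

/-- The operator of the Heisenberg algebra lowering the weight by two. -/
def annih (q : ZMod 4) : Module.End ℂ (Pic q) := Complex.I • act heisV - act heisU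

lemma exp_add_four (m : ℤ) (θ : ℝ) : Complex.exp (-Complex.I * (m + 4 : ℤ) * θ / 2) =
    Complex.exp (-Complex.I * m * θ / 2) * (Real.cos θ - Complex.I * Real.sin θ) ^ 2 := by
  have h : Complex.cos θ - Complex.I * Complex.sin θ = Complex.exp (-Complex.I * θ) := by
    rw [show -Complex.I * θ = (-θ : ℂ) * Complex.I by ring, Complex.exp_mul_I, Complex.cos_neg,
      Complex.sin_neg]
    ring
  push_cast
  rw [h, ← Complex.exp_nat_mul, ← Complex.exp_add]
  congr 1
  push_cast
  ring

lemma exp_add_two (m : ℤ) (θ : ℝ) : Complex.exp (-Complex.I * (m + 2 : ℤ) * θ / 2) =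
    Complex.exp (-Complex.I * m * θ / 2) * (Real.cos θ - Complex.I * Real.sin θ) := by
  have h : Complex.cos θ - Complex.I * Complex.sin θ = Complex.exp (-Complex.I * θ) := by
    rw [show -Complex.I * θ = (-θ : ℂ) * Complex.I by ring, Complex.exp_mul_I, Complex.cos_neg,
      Complex.sin_neg]
    ring
  push_cast
  rw [h, ← Complex.exp_add]
  congr 1
  ring

lemma exp_sub_two (m : ℤ) (θ : ℝ) : Complex.exp (-Complex.I * (m - 2 : ℤ) * θ / 2) =
    Complex.exp (-Complex.I * m * θ / 2) * (Real.cos θ + Complex.I * Real.sin θ) := by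
  have h : Complex.cos θ + Complex.I * Complex.sin θ = Complex.exp (Complex.I * θ) := by
    rw [show Complex.I * θ = (θ : ℂ) * Complex.I by ring, Complex.exp_mul_I]
    ring
  push_cast
  rw [h, ← Complex.exp_add]
  congr 1
  ring

lemma exp_sub_four (m : ℤ) (θ : ℝ) : Complex.exp (-Complex.I * (m - 4 : ℤ) * θ / 2) =
    Complex.exp (-Complex.I * m * θ / 2) * (Real.cos θ + Complex.I * Real.sin θ) ^ 2 := by
  rw [show m - 4 = m - 2 - 2 by ring, exp_sub_two, exp_sub_two]
  ring

lemma rot_wave {F : Pic q} {m : ℤ} {g : ℝ → ℂ} (hg : Differentiable ℝ g)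
    (hF : F.1 = wave m g) : rot q F = (Complex.I * m / 2) • F := by
  apply Subtype.ext
  funext p
  change opC _ _ sl2E F.1 p - opC _ _ sl2F F.1 p = Complex.I * m / 2 * F.1 p
  have hsc := Real.sin_sq_add_cos_sq p.1
  have hscC : (Real.sin p.1 : ℂ) ^ 2 + (Real.cos p.1 : ℂ) ^ 2 = 1 := by exact_mod_cast hsc
  simp only [hF, opC_wave _ _ _ _ hg, wave]
  simp [fieldC, multC, angCoef, radCoef, radCoef', sl2E, sl2F, sl2Mk,
    -Complex.ofReal_cos, -Complex.ofReal_sin]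
  linear_combination (Complex.exp (-(Complex.I * m * p.1) / 2) * Complex.I * m / 2 * g p.2) * hscC

lemma raise_wave {F : Pic q} {m : ℤ} {g : ℝ → ℂ} (hg : Differentiable ℝ g)
    (hF : F.1 = wave m g) :
    (raise q F).1 = wave (m + 4) fun y => (y ^ 2 - (m + 1) / 2) * g y - y * deriv g y := by
  funext p
  change opC _ _ sl2H F.1 p + Complex.I * (opC _ _ sl2E F.1 p + opC _ _ sl2F F.1 p) = _
  simp only [hF, opC_wave _ _ _ _ hg, wave, exp_add_four]
  simp [fieldC, multC, angCoef, radCoef, radCoef', sl2H, sl2E, sl2F, sl2Mk,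
    -Complex.ofReal_cos, -Complex.ofReal_sin]
  generalize Complex.exp (-(Complex.I * m * p.1) / 2) = E
  generalize (Real.cos p.1 : ℂ) = c
  generalize (Real.sin p.1 : ℂ) = s
  have hI := Complex.I_sq
  grind

lemma lower_wave {F : Pic q} {m : ℤ} {g : ℝ → ℂ} (hg : Differentiable ℝ g)
    (hF : F.1 = wave m g) :
    (lower q F).1 = wave (m - 4) fun y => ((m - 1) / 2 - y ^ 2) * g y - y * deriv g y := by
  funext p
  change opC _ _ sl2H F.1 p - Complex.I * (opC _ _ sl2E F.1 p + opC _ _ sl2F F.1 p) = _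
  simp only [hF, opC_wave _ _ _ _ hg, wave, exp_sub_four]
  simp [fieldC, multC, angCoef, radCoef, radCoef', sl2H, sl2E, sl2F, sl2Mk,
    -Complex.ofReal_cos, -Complex.ofReal_sin]
  generalize Complex.exp (-(Complex.I * m * p.1) / 2) = E
  generalize (Real.cos p.1 : ℂ) = c
  generalize (Real.sin p.1 : ℂ) = s
  have hI := Complex.I_sq
  grind

lemma create_wave {F : Pic q} {m : ℤ} {g : ℝ → ℂ} (hg : Differentiable ℝ g)
    (hF : F.1 = wave m g) :
    (create q F).1 = wave (m + 2) fun y => y * g y - deriv g y := by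
  funext p
  change opC _ _ heisU F.1 p + Complex.I * opC _ _ heisV F.1 p = _
  simp only [hF, opC_wave _ _ _ _ hg, wave, exp_add_two]
  simp [fieldC, multC, angCoef, radCoef, radCoef', heisU, heisV,
    -Complex.ofReal_cos, -Complex.ofReal_sin]
  generalize Complex.exp (-(Complex.I * m * p.1) / 2) = E
  generalize (Real.cos p.1 : ℂ) = c
  generalize (Real.sin p.1 : ℂ) = s
  have hI := Complex.I_sq
  grind

lemma annih_wave {F : Pic q} {m : ℤ} {g : ℝ → ℂ} (hg : Differentiable ℝ g)
    (hF : F.1 = wave m g) :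
    (annih q F).1 = wave (m - 2) fun y => y * g y + deriv g y := by
  funext p
  change Complex.I * opC _ _ heisV F.1 p - opC _ _ heisU F.1 p = _
  simp only [hF, opC_wave _ _ _ _ hg, wave, exp_sub_two]
  simp [fieldC, multC, angCoef, radCoef, radCoef', heisU, heisV,
    -Complex.ofReal_cos, -Complex.ofReal_sin]
  generalize Complex.exp (-(Complex.I * m * p.1) / 2) = E
  generalize (Real.cos p.1 : ℂ) = c
  generalize (Real.sin p.1 : ℂ) = s
  have hI := Complex.I_sq
  grind

/-! ### The action of 𝔤 and the Casimir operator in terms of ladder operators -/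

lemma act_heisW (F : Pic q) : act heisW F = (Complex.I / 2) • F := by
  apply Subtype.ext
  funext p
  change opC _ _ heisW F.1 p = Complex.I / 2 * F.1 p
  have h : fieldC heisW p = 0 := by
    ext <;> simp [fieldC, angCoef, radCoef, heisW]
  simp only [opC, firstOrder, h, map_zero]
  simp [multC, radCoef, radCoef', heisW]

lemma act_lie (X Y : SchrAlg) (F : Pic q) : act ⁅X, Y⁆ F = act X (act Y F) - act Y (act X F) :=
  lie_lie X Y F

lemma act_add (X Y : SchrAlg) : (act (X + Y) : Module.End ℂ (Pic q)) = act X + act Y := by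
  ext1 F
  exact add_lie X Y F

lemma act_smul (t : ℝ) (X : SchrAlg) :
    (act (t • X) : Module.End ℂ (Pic q)) = (t : ℂ) • act X := by
  ext1 F
  exact smul_lie t X F

lemma act_eq (X : SchrAlg) : (act X : Module.End ℂ (Pic q)) =
    (X.right.1 0 0 : ℂ) • act sl2H + (X.right.1 0 1 : ℂ) • act sl2E
      + (X.right.1 1 0 : ℂ) • act sl2F
      + (X.left.u : ℂ) • act heisU + (X.left.v : ℂ) • act heisV + (X.left.w : ℂ) • act heisW := by
  simp only [← act_smul, ← act_add]
  congr 1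
  have h := sl2_trace X.right
  ext i j
  any_goals simp [sl2H, sl2E, sl2F, heisU, heisV, heisW]
  fin_cases i <;> fin_cases j <;> simp [sl2Mk, h]

lemma act_H_E (F : Pic q) : act sl2H (act sl2E F) = act sl2E (act sl2H F) + (2 : ℂ) • act sl2E F := by
  have h : ⁅sl2H, sl2E⁆ = (2 : ℝ) • sl2E := by
    ext i j
    any_goals simp [sl2H, sl2E]
    fin_cases i <;> fin_cases j <;> simp [sl2Mk, Ring.lie_def]; norm_num
  have h1 := act_lie sl2H sl2E F
  rw [h, act_smul] at h1
  rw [← sub_eq_iff_eq_add', ← h1]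
  simp

lemma act_H_F (F : Pic q) : act sl2H (act sl2F F) = act sl2F (act sl2H F) - (2 : ℂ) • act sl2F F := by
  have h : ⁅sl2H, sl2F⁆ = (-2 : ℝ) • sl2F := by
    ext i j
    any_goals simp [sl2H, sl2F]
    fin_cases i <;> fin_cases j <;> simp [sl2Mk, Ring.lie_def]; norm_num
  have h1 := act_lie sl2H sl2F F
  rw [h, act_smul] at h1
  rw [sub_eq_add_neg, ← sub_eq_iff_eq_add', ← h1]
  simp

lemma act_E_F (F : Pic q) : act sl2E (act sl2F F) = act sl2F (act sl2E F) + act sl2H F := by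
  have h : ⁅sl2E, sl2F⁆ = sl2H := by
    ext i j
    any_goals simp [sl2H, sl2E, sl2F]
    fin_cases i <;> fin_cases j <;> simp [sl2Mk, Ring.lie_def]
  have h1 := act_lie sl2E sl2F F
  rw [h] at h1
  rw [← sub_eq_iff_eq_add', ← h1]

/-- The operator `Ω'` of the Schrödinger module. -/
abbrev cas (q : ZMod 4) : Module.End ℂ (Pic q) := casimir' q (-1 / 2) (Complex.I / 2)

-- Rewriting Ω' in the compact basis lets it be evaluated on weight vectors, where the rotation is a
-- scalar. The constant 3/4 is -r(r+2) for r = -1/2.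
set_option linter.unnecessarySeqFocus false in
lemma cas_eq : cas q =
    raise q * lower q + (2 * Complex.I) • rot q - rot q * rot q + (3 / 4 : ℂ) • 1 := by
  ext1 F
  simp only [cas, casimir', casimir, raise, lower, rot, LinearMap.add_apply, LinearMap.sub_apply,
    LinearMap.smul_apply, Module.End.mul_apply, Module.End.one_apply, map_add, map_sub, map_smul,
    act_H_E, act_H_F, act_E_F]
  match_scalars <;> simp <;> ring_nf <;> norm_num

lemma cas_rot : cas q * rot q = rot q * cas q := by
  ext1 F
  simp only [cas, casimir', casimir, rot, LinearMap.add_apply, LinearMap.sub_apply,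
    LinearMap.smul_apply, Module.End.mul_apply, Module.End.one_apply, map_add, map_sub, map_smul,
    act_H_E, act_H_F, act_E_F]
  module

/-- Lowering and then raising returns to weight m. The first-order terms cancel and leave y² times a
Hermite operator, so eigenvectors of Ω' of a given weight are governed by one second-order equation
in y. -/
lemma cas_wave {F : Pic q} {m : ℤ} {g : ℝ → ℂ} (hg : ContDiff ℝ ∞ g) (hF : F.1 = wave m g) :
    (cas q F).1 = wave m fun y => y ^ 2 * (deriv (deriv g) y + (m - y ^ 2) * g y) := by
  have hd : Differentiable ℝ g := hg.differentiable (by simp)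
  have hd' : Differentiable ℝ (deriv g) :=
    (contDiff_infty_iff_deriv.1 hg).2.differentiable (by simp)
  have ho : ∀ y : ℝ, HasDerivAt (fun y : ℝ => (y : ℂ)) 1 y := fun y => Complex.ofRealCLM.hasDerivAt
  have hL := lower_wave hd hF
  set g1 : ℝ → ℂ := fun y => ((m - 1) / 2 - y ^ 2) * g y - y * deriv g y with hg1
  have d1 : ∀ y, HasDerivAt g1 (-(2 * y) * g y + ((m - 1) / 2 - y ^ 2) * deriv g y
      - (deriv g y + y * deriv (deriv g) y)) y := by
    intro y
    have h := ((((ho y).pow 2).const_sub ((m - 1) / 2 : ℂ)).mul (hd y).hasDerivAt).sub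
      ((ho y).mul (hd' y).hasDerivAt)
    refine HasDerivAt.congr_deriv (f := g1) h ?_
    simp
  have hR := raise_wave (fun y => (d1 y).differentiableAt) hL
  have e1 : (cas q F).1 = (raise q (lower q F)).1
      + ((2 * Complex.I) * (Complex.I * m / 2) - (Complex.I * m / 2) * (Complex.I * m / 2) + 3 / 4)
        • F.1 := by
    have : cas q F = raise q (lower q F) + ((2 * Complex.I) * (Complex.I * m / 2)
        - (Complex.I * m / 2) * (Complex.I * m / 2) + 3 / 4) • F := by
      rw [cas_eq]
      simp only [LinearMap.add_apply, LinearMap.sub_apply, LinearMap.smul_apply,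
        Module.End.mul_apply, Module.End.one_apply, rot_wave hd hF, map_smul]
      module
    rw [this]
    rfl
  rw [e1, hR, hF]
  funext p
  simp only [Pi.add_apply, Pi.smul_apply, smul_eq_mul, wave, (d1 _).deriv]
  simp only [hg1]
  rw [show m - 4 + 4 = m by ring]
  have hI := Complex.I_sq
  push_cast
  generalize Complex.exp _ = E
  linear_combination ((m - m ^ 2 / 4) * E * g p.2) * hI

/-! ### The vectors `Ψ_{m,k}` of the module -/

lemma I_zpow_congr {a b : ℤ} (h : a ≡ b [ZMOD 4]) : Complex.I ^ a = Complex.I ^ b := by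
  obtain ⟨c, hc⟩ := h.dvd
  rw [show b = a + 4 * c by linarith, zpow_add₀ Complex.I_ne_zero, zpow_mul]
  have : Complex.I ^ (4 : ℤ) = 1 := by exact_mod_cast Complex.I_pow_four
  rw [this, one_zpow, mul_one]

lemma exp_int_mul_pi_half (n : ℤ) :
    Complex.exp (-Complex.I * n * Real.pi / 2) = Complex.I ^ (-n) := by
  rw [show -Complex.I * n * Real.pi / 2 = (-n : ℤ) * (Real.pi / 2 * Complex.I) by push_cast; ring,
    Complex.exp_int_mul, Complex.exp_pi_div_two_mul_I]

lemma exp_shift (m j : ℤ) (θ : ℝ) : Complex.exp (-Complex.I * m * (θ + j * Real.pi : ℝ) / 2) =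
    Complex.exp (-Complex.I * m * θ / 2) * Complex.I ^ (-(m * j)) := by
  rw [← exp_int_mul_pi_half, ← Complex.exp_add]
  congr 1
  push_cast
  ring

/-- The condition `m ≡ 2k + q (mod 4)` on the indices of the functions `Ψ_{m,k}`. -/
def Admissible (q : ZMod 4) (i : ℤ × ℕ) : Prop := (i.1 : ZMod 4) = 2 * (i.2 : ZMod 4) + q

lemma admissible_iff {q : ZMod 4} {i : ℤ × ℕ} :
    Admissible q i ↔ i.1 ≡ 2 * i.2 + q.val [ZMOD 4] := by
  rw [Admissible, show (4 : ℤ) = ((4 : ℕ) : ℤ) from rfl, ← ZMod.intCast_eq_intCast_iff]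
  push_cast
  rw [ZMod.natCast_zmod_val]

lemma radial_zpow (m : ℤ) (k : ℕ) (j : ℤ) (y : ℝ) :
    (radial m k ((-1) ^ j * y) : ℂ) = Complex.I ^ (2 * k * j) * radial m k y := by
  have h2 : Complex.I ^ (2 : ℤ) = -1 := by exact_mod_cast Complex.I_sq
  rw [mul_assoc, zpow_mul, h2, mul_comm (k : ℤ) j, zpow_mul]
  rcases Int.even_or_odd j with h | h
  · simp [h.neg_one_zpow]
  · simp [h.neg_one_zpow, radial_neg]

lemma contDiff_wave (m : ℤ) {g : ℝ → ℂ} (hg : ContDiff ℝ ∞ g) : ContDiff ℝ ∞ (wave m g) := by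
  have h1 : ContDiff ℝ ∞ fun p : ℝ × ℝ => Complex.exp (-Complex.I * m * p.1 / 2) := by
    have : ContDiff ℝ ∞ fun p : ℝ × ℝ => (p.1 : ℂ) := Complex.ofRealCLM.contDiff.comp contDiff_fst
    exact ((contDiff_const.mul this).div_const 2).cexp
  exact h1.mul (hg.comp contDiff_snd)

lemma contDiff_radial_complex (m : ℤ) (k : ℕ) : ContDiff ℝ ∞ fun y => (radial m k y : ℂ) :=
  Complex.ofRealCLM.contDiff.comp (contDiff_radial m k)

lemma differentiable_radial_complex (m : ℤ) (k : ℕ) :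
    Differentiable ℝ fun y => (radial m k y : ℂ) :=
  (contDiff_radial_complex m k).differentiable (by simp)

lemma deriv_radial_complex (m : ℤ) (k : ℕ) (y : ℝ) :
    deriv (fun y => (radial m k y : ℂ)) y = (deriv (radial m k) y : ℝ) :=
  (((contDiff_radial m k).differentiable (by simp) y).hasDerivAt.ofReal_comp).deriv

/-- Translation by jπ contributes i^{-mj} from the exponential, and the parity of the radial factor
contributes i^{2kj}. The congruence m ≡ 2k+q turns the product into i^{-jq}. -/
lemma Psi_mem {q : ZMod 4} {i : ℤ × ℕ} (h : Admissible q i) : Psi i.1 i.2 ∈ Pic q := by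
  refine ⟨contDiff_wave _ (contDiff_radial_complex i.1 i.2), fun j θ y => ?_⟩
  rw [Psi_eq_wave]
  simp only [wave, exp_shift, radial_zpow]
  rw [I_zpow_congr (a := -(j * (q.val : ℤ))) (b := -(i.1 * j) + 2 * i.2 * j),
    zpow_add₀ Complex.I_ne_zero]
  · ring
  · have := ((admissible_iff.1 h).mul_right j).neg.symm.add_right (2 * i.2 * j)
    convert this using 1
    ring

open Classical in
/-- The vector `Ψ_{m,k}` of `I''(q)`, and `0` if `m ≢ 2k + q (mod 4)`. -/
def psi (q : ZMod 4) (i : ℤ × ℕ) : Pic q :=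
  if h : Admissible q i then ⟨Psi i.1 i.2, Psi_mem h⟩ else 0

lemma psi_val {i : ℤ × ℕ} (h : Admissible q i) : (psi q i).1 = wave i.1 fun y => (radial i.1 i.2 y : ℂ) := by
  rw [psi, dif_pos h]
  rfl

lemma psi_of_not {i : ℤ × ℕ} (h : ¬Admissible q i) : psi q i = 0 := dif_neg h

lemma admissible_add_four {m : ℤ} {k : ℕ} : Admissible q (m + 4, k) ↔ Admissible q (m, k) := by
  simp only [admissible_iff, Int.ModEq]; omega

lemma admissible_sub_four {m : ℤ} {k : ℕ} : Admissible q (m - 4, k) ↔ Admissible q (m, k) := by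
  simp only [admissible_iff, Int.ModEq]; omega

lemma admissible_add_two {m : ℤ} {k : ℕ} :
    Admissible q (m + 2, k) ↔ Admissible q (m, k + 1) := by
  simp only [admissible_iff, Int.ModEq]; push_cast; omega

lemma admissible_sub_two {m : ℤ} {k : ℕ} :
    Admissible q (m - 2, k) ↔ Admissible q (m, k + 1) := by
  simp only [admissible_iff, Int.ModEq]; push_cast; omega

lemma admissible_add_two_nat {m : ℤ} {k : ℕ} :
    Admissible q (m, k + 2) ↔ Admissible q (m, k) := by
  simp only [admissible_iff, Int.ModEq]; push_cast; omega

lemma rot_psi (m : ℤ) (k : ℕ) : rot q (psi q (m, k)) = (Complex.I * m / 2) • psi q (m, k) := by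
  by_cases h : Admissible q (m, k)
  · exact rot_wave (differentiable_radial_complex m k) (psi_val h)
  · simp [psi_of_not h]

lemma raise_psi (m : ℤ) (k : ℕ) :
    raise q (psi q (m, k)) = (-((m + 1 + 2 * k) / 2) : ℂ) • psi q (m + 4, k) := by
  by_cases h : Admissible q (m, k)
  · apply Subtype.ext
    rw [raise_wave (differentiable_radial_complex m k) (psi_val h), Submodule.coe_smul,
      psi_val (admissible_add_four.2 h), ← wave_smul]
    congr 1
    funext y
    rw [deriv_radial_complex]
    exact_mod_cast radial_raise m k y
  -- For an inadmissible index both vectors are the default value 0, so the ladder formulas hold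
  -- without a congruence hypothesis.
  · rw [psi_of_not h, psi_of_not (mt admissible_add_four.1 h)]
    simp

lemma lower_psi (m : ℤ) (k : ℕ) :
    lower q (psi q (m, k)) = ((m - 1 - 2 * k) / 2 : ℂ) • psi q (m - 4, k) := by
  by_cases h : Admissible q (m, k)
  · apply Subtype.ext
    rw [lower_wave (differentiable_radial_complex m k) (psi_val h), Submodule.coe_smul,
      psi_val (admissible_sub_four.2 h), ← wave_smul]
    congr 1
    funext y
    rw [deriv_radial_complex]
    exact_mod_cast radial_lower m k y
  · rw [psi_of_not h, psi_of_not (mt admissible_sub_four.1 h)]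
    simp

lemma create_psi_zero (m : ℤ) :
    create q (psi q (m, 0)) = (1 + m : ℂ) • psi q (m + 2, 1) := by
  by_cases h : Admissible q (m, 0)
  · have h1 : Admissible q (m + 2, 1) := admissible_add_two.2 (admissible_add_two_nat.2 h)
    apply Subtype.ext
    rw [create_wave (differentiable_radial_complex m 0) (psi_val h), Submodule.coe_smul,
      psi_val h1, ← wave_smul]
    congr 1
    funext y
    rw [deriv_radial_complex]
    exact_mod_cast radial_create_zero m y
  · have h1 : ¬Admissible q (m + 2, 1) := fun h1 =>
      h (admissible_add_two_nat.1 (admissible_add_two.1 h1))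
    rw [psi_of_not h, psi_of_not h1]
    simp

lemma annih_psi_zero (m : ℤ) :
    annih q (psi q (m, 0)) = (1 - m : ℂ) • psi q (m - 2, 1) := by
  by_cases h : Admissible q (m, 0)
  · have h1 : Admissible q (m - 2, 1) := admissible_sub_two.2 (admissible_add_two_nat.2 h)
    apply Subtype.ext
    rw [annih_wave (differentiable_radial_complex m 0) (psi_val h), Submodule.coe_smul,
      psi_val h1, ← wave_smul]
    congr 1
    funext y
    rw [deriv_radial_complex]
    exact_mod_cast radial_annih_zero m y
  · have h1 : ¬Admissible q (m - 2, 1) := fun h1 =>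
      h (admissible_add_two_nat.1 (admissible_sub_two.1 h1))
    rw [psi_of_not h, psi_of_not h1]
    simp

lemma create_psi_succ (m : ℤ) (k : ℕ) :
    create q (psi q (m, k + 1)) = (-(k + 1) : ℂ) • psi q (m + 2, k)
      + (k * (2 * k + 3 + m) / ((2 * k + 1) * (2 * k + 3)) : ℂ) • psi q (m + 2, k + 2) := by
  by_cases h : Admissible q (m, k + 1)
  · apply Subtype.ext
    rw [create_wave (differentiable_radial_complex m (k + 1)) (psi_val h), Submodule.coe_add,
      Submodule.coe_smul, Submodule.coe_smul, psi_val (admissible_add_two.2 h),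
      psi_val (admissible_add_two_nat.2 (admissible_add_two.2 h)), ← wave_smul, ← wave_smul,
      ← wave_add]
    congr 1
    funext y
    rw [deriv_radial_complex]
    exact_mod_cast radial_create_succ m k y
  · rw [psi_of_not h, psi_of_not (mt admissible_add_two.1 h),
      psi_of_not (mt admissible_add_two_nat.1 (mt admissible_add_two.1 h))]
    simp

lemma annih_psi_succ (m : ℤ) (k : ℕ) :
    annih q (psi q (m, k + 1)) = (k + 1 : ℂ) • psi q (m - 2, k)
      + (k * (2 * k + 3 - m) / ((2 * k + 1) * (2 * k + 3)) : ℂ) • psi q (m - 2, k + 2) := by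
  by_cases h : Admissible q (m, k + 1)
  · apply Subtype.ext
    rw [annih_wave (differentiable_radial_complex m (k + 1)) (psi_val h), Submodule.coe_add,
      Submodule.coe_smul, Submodule.coe_smul, psi_val (admissible_sub_two.2 h),
      psi_val (admissible_add_two_nat.2 (admissible_sub_two.2 h)), ← wave_smul, ← wave_smul,
      ← wave_add]
    congr 1
    funext y
    rw [deriv_radial_complex]
    exact_mod_cast radial_annih_succ m k y
  · rw [psi_of_not h, psi_of_not (mt admissible_sub_two.1 h),
      psi_of_not (mt admissible_add_two_nat.1 (mt admissible_sub_two.1 h))]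
    simp

/-- The composite of `lower` and `raise` contributes ((2k-1)² - (m-2)²)/4 and the rotation terms
with the constant contribute ((m-2)² - 1)/4. The dependence on m cancels. -/
lemma cas_psi (m : ℤ) (k : ℕ) : cas q (psi q (m, k)) = (k * (k - 1) : ℂ) • psi q (m, k) := by
  have h := raise_psi (q := q) (m - 4) k
  rw [sub_add_cancel] at h
  rw [cas_eq]
  simp only [LinearMap.add_apply, LinearMap.sub_apply, LinearMap.smul_apply,
    Module.End.mul_apply, Module.End.one_apply, rot_psi, map_smul, lower_psi, h]
  match_scalars
  linear_combination (m - m ^ 2 / 4 : ℂ) * Complex.I_sq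

lemma psi_ne_zero {i : ℤ × ℕ} (h : Admissible q i) : psi q i ≠ 0 := by
  intro h0
  have h1 := psi_val h
  rw [h0] at h1
  have h2 : ∀ y, radial i.1 i.2 y = 0 := by
    intro y
    have := congrFun h1 (0, y)
    simpa [wave] using this.symm
  have h3 : ∀ y : ℝ, y ≠ 0 → radialEven i.1 i.2 y = 0 := by
    intro y hy
    have := h2 y
    rw [radial_eq] at this
    exact (mul_eq_zero.1 this).resolve_left (pow_ne_zero _ hy)
  have h4 : radialEven i.1 i.2 = 0 := by
    refine Continuous.ext_on (dense_compl_singleton (0 : ℝ))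
      (contDiff_radialEven i.1 i.2).continuous continuous_const fun y hy => h3 y hy
  have h5 := radialEven_zero i.1 i.2
  rw [h4] at h5
  exact zero_ne_one h5

/-! ### The radial equation -/

/-- Obtained by comparing the two evaluations of Ω' on Ψ_{m,k}, instead of from Kummer's
differential equation. Any (m,k) is admissible for a suitable residue, namely m - 2k. -/
lemma radial_ode (m : ℤ) (k : ℕ) (y : ℝ) :
    (y : ℂ) ^ 2 * (deriv (deriv fun y => (radial m k y : ℂ)) y + (m - y ^ 2) * radial m k y) =
      k * (k - 1) * radial m k y := by
  set q : ZMod 4 := m - 2 * k with hq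
  have h : Admissible q (m, k) := by simp [Admissible, hq]
  have h1 := cas_wave (contDiff_radial_complex m k) (psi_val h)
  rw [cas_psi, Submodule.coe_smul, psi_val h] at h1
  have h2 := congrFun h1 (0, y)
  simpa [wave] using h2.symm

/-! ### Uniqueness of smooth solutions of the singular radial equation -/

lemma ode_unique {V f f' : ℝ → ℂ} (hV : ContinuousOn V (Set.Ioi 0))
    (hf : ∀ y, 0 < y → HasDerivAt f (f' y) y) (hf' : ∀ y, 0 < y → HasDerivAt f' (V y * f y) y)
    {y₀ : ℝ} (hy₀ : 0 < y₀) (h0 : f y₀ = 0) (h0' : f' y₀ = 0) {y : ℝ} (hy : 0 < y) : f y = 0 := by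
  -- The interval (a, b) contains y and y₀ and its closure stays in (0,∞). There V is bounded, so
  -- the first-order system for (f, f') is Lipschitz.
  set a := min y y₀ / 2 with ha
  set b := max y y₀ + 1 with hb
  have ha0 : 0 < a := by positivity
  have hay : a < min y y₀ := by rw [ha]; linarith [lt_min hy hy₀]
  obtain ⟨C, hC⟩ := isCompact_Icc.exists_bound_of_continuousOn
    (hV.mono fun t (ht : t ∈ Set.Icc a b) => lt_of_lt_of_le ha0 ht.1)
  have hL : ∀ t ∈ Set.Ioo a b, LipschitzOnWith (max 1 C.toNNReal)
      (fun x : ℂ × ℂ => (x.2, V t * x.1)) Set.univ := by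
    intro t ht
    refine LipschitzOnWith.of_dist_le_mul fun x _ z _ => ?_
    have hVt : ‖V t‖ ≤ (max 1 C.toNNReal : NNReal) := by
      refine (hC t ⟨ht.1.le, ht.2.le⟩).trans ?_
      rw [NNReal.coe_max]
      exact (Real.le_coe_toNNReal C).trans (le_max_right _ _)
    have h1 : (1 : ℝ) ≤ (max 1 C.toNNReal : NNReal) := by
      rw [NNReal.coe_max]
      exact le_max_left _ _
    rw [Prod.dist_eq, Prod.dist_eq]
    refine max_le ?_ ?_
    · calc dist x.2 z.2 ≤ 1 * max (dist x.1 z.1) (dist x.2 z.2) := by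
            rw [one_mul]; exact le_max_right _ _
        _ ≤ _ := by gcongr
    · simp only [dist_eq_norm, ← mul_sub, norm_mul]
      gcongr
      exact le_max_left _ _
  have h := ODE_solution_unique_of_mem_Ioo hL (t₀ := y₀)
    (f := fun t => (f t, f' t)) (g := fun _ => 0)
    ⟨hay.trans_le (min_le_right _ _), (le_max_right y y₀).trans_lt (lt_add_one _)⟩
    (fun t ht => ⟨(hf t (ha0.trans ht.1)).prodMk (hf' t (ha0.trans ht.1)), trivial⟩)
    (fun t _ => ⟨by
      convert hasDerivAt_const t (0 : ℂ × ℂ) using 1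
      simp, trivial⟩)
    (by simp [h0, h0'])
  have := h (x := y) ⟨hay.trans_le (min_le_left _ _), (le_max_left y y₀).trans_lt (lt_add_one _)⟩
  exact congrArg Prod.fst this

open Filter Topology

lemma exists_pos_radial_ne_zero (m : ℤ) (k : ℕ) : ∃ y : ℝ, 0 < y ∧ radial m k y ≠ 0 := by
  have h1 : ∀ᶠ y in 𝓝 (0 : ℝ), radialEven m k y ≠ 0 :=
    (contDiff_radialEven m k).continuous.continuousAt.eventually_ne (by simp [radialEven_zero])
  obtain ⟨y, hy, hy0⟩ :=
    ((h1.filter_mono nhdsWithin_le_nhds).and (self_mem_nhdsWithin (s := Set.Ioi (0 : ℝ)))).exists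
  refine ⟨y, hy0, ?_⟩
  rw [radial_eq]
  exact mul_ne_zero (pow_ne_zero _ (ne_of_gt hy0)) hy

/-- A smooth solution of the radial equation whose Wronskian with the regular solution vanishes at
the origin is a multiple of the regular solution on the positive half-line. -/
lemma radial_unique_pos {m : ℤ} {k : ℕ} {g : ℝ → ℂ} (hg : ContDiff ℝ ∞ g)
    (hode : ∀ y : ℝ, (y : ℂ) ^ 2 * (deriv (deriv g) y + (m - y ^ 2) * g y) = k * (k - 1) * g y)
    (hW : g 0 * (deriv (radial m k) 0 : ℝ) = deriv g 0 * radial m k 0) :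
    ∃ c : ℂ, ∀ y, 0 < y → g y = c * radial m k y := by
  set ρ : ℝ → ℂ := fun y => (radial m k y : ℂ) with hρ
  have hρs : ContDiff ℝ ∞ ρ := contDiff_radial_complex m k
  have hg1 : ContDiff ℝ ∞ (deriv g) := (contDiff_infty_iff_deriv.1 hg).2
  have hg2 : ContDiff ℝ ∞ (deriv (deriv g)) := (contDiff_infty_iff_deriv.1 hg1).2
  have hρ1 : ContDiff ℝ ∞ (deriv ρ) := (contDiff_infty_iff_deriv.1 hρs).2
  have hρ2 : ContDiff ℝ ∞ (deriv (deriv ρ)) := (contDiff_infty_iff_deriv.1 hρ1).2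
  have dg : ∀ y, HasDerivAt g (deriv g y) y := fun y => (hg.differentiable (by simp) y).hasDerivAt
  have dg1 : ∀ y, HasDerivAt (deriv g) (deriv (deriv g) y) y := fun y =>
    (hg1.differentiable (by simp) y).hasDerivAt
  have dρ : ∀ y, HasDerivAt ρ (deriv ρ y) y := fun y =>
    (hρs.differentiable (by simp) y).hasDerivAt
  have dρ1 : ∀ y, HasDerivAt (deriv ρ) (deriv (deriv ρ) y) y := fun y =>
    (hρ1.differentiable (by simp) y).hasDerivAt
  have ode : ∀ y : ℝ, (y : ℂ) ^ 2 * (deriv (deriv ρ) y + (m - y ^ 2) * ρ y) = k * (k - 1) * ρ y :=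
    radial_ode m k
  set W : ℝ → ℂ := fun y => g y * deriv ρ y - deriv g y * ρ y with hWdef
  have dW : ∀ y, HasDerivAt W (g y * deriv (deriv ρ) y - deriv (deriv g) y * ρ y) y := by
    intro y
    refine (((dg y).mul (dρ1 y)).sub ((dg1 y).mul (dρ y))).congr_deriv ?_
    ring
  -- The equations give W' = 0 only where y ≠ 0; continuity of W' extends this to the origin. So the
  -- Wronskian is constant through the singular point and can be evaluated there.
  have zero : (fun y => g y * deriv (deriv ρ) y - deriv (deriv g) y * ρ y) = fun _ => 0 := by
    refine Continuous.ext_on (dense_compl_singleton (0 : ℝ))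
      ((hg.continuous.mul hρ2.continuous).sub (hg2.continuous.mul hρs.continuous))
      continuous_const fun y hy => ?_
    have hy' : (y : ℂ) ^ 2 ≠ 0 := pow_ne_zero _ (by exact_mod_cast hy)
    refine mul_left_cancel₀ hy' ?_
    linear_combination g y * ode y - ρ y * hode y
  have const : ∀ y, W y = 0 := by
    intro y
    rw [is_const_of_deriv_eq_zero (fun z => (dW z).differentiableAt)
      (fun z => by rw [(dW z).deriv]; exact congrFun zero z) y 0]
    simp only [hWdef, hρ, deriv_radial_complex, hW, sub_self]
  obtain ⟨y₀, hy₀, hne⟩ := exists_pos_radial_ne_zero m k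
  have hne' : ρ y₀ ≠ 0 := by simpa [hρ] using hne
  refine ⟨g y₀ / ρ y₀, fun y hy => ?_⟩
  -- The constant matches the values at y₀; the derivatives then match because the Wronskian
  -- vanishes at y₀.
  set c := g y₀ / ρ y₀ with hc
  have hcy : c * ρ y₀ = g y₀ := div_mul_cancel₀ _ hne'
  have key := ode_unique (V := fun y : ℝ => k * (k - 1) / (y : ℂ) ^ 2 - m + y ^ 2)
    (f := fun y => g y - c * ρ y) (f' := fun y => deriv g y - c * deriv ρ y) ?_
    (fun y _ => (dg y).sub ((dρ y).const_mul c))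
    (fun y hy => ((dg1 y).sub ((dρ1 y).const_mul c)).congr_deriv ?_) hy₀ ?_ ?_ hy
  · exact sub_eq_zero.1 key
  · have h0 : Continuous fun y : ℝ => (y : ℂ) := Complex.continuous_ofReal
    refine ContinuousOn.add (ContinuousOn.sub (ContinuousOn.div continuousOn_const
      (h0.pow 2).continuousOn fun y hy => ?_) continuousOn_const) (h0.pow 2).continuousOn
    exact pow_ne_zero _ (by exact_mod_cast (ne_of_gt hy))
  · have hy' : (y : ℂ) ≠ 0 := by exact_mod_cast hy.ne'
    field_simp
    linear_combination hode y - c * ode y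
  · simp [hcy]
  · have h := const y₀
    simp only [hWdef] at h
    refine mul_right_cancel₀ hne' ?_
    linear_combination -h - deriv ρ y₀ * hcy

lemma radial_unique {m : ℤ} {k : ℕ} {g : ℝ → ℂ} (hg : ContDiff ℝ ∞ g)
    (hode : ∀ y : ℝ, (y : ℂ) ^ 2 * (deriv (deriv g) y + (m - y ^ 2) * g y) = k * (k - 1) * g y)
    (hpar : ∀ y, g (-y) = (-1) ^ k * g y) : ∃ c : ℂ, ∀ y, g y = c * radial m k y := by
  have hd : ∀ y, deriv g (-y) = (-1) ^ (k + 1) * deriv g y := by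
    intro y
    have h1 : deriv (fun y => g (-y)) y = -deriv g (-y) := deriv_comp_neg g y
    have h2 : deriv (fun y => (-1) ^ k * g y) y = (-1) ^ k * deriv g y :=
      deriv_const_mul _ (hg.differentiable (by simp) y)
    rw [funext hpar, h2] at h1
    rw [pow_succ]
    linear_combination h1
  have hW : g 0 * (deriv (radial m k) 0 : ℝ) = deriv g 0 * radial m k 0 := by
    rw [deriv_radial, radial]
    -- The Wronskian at 0 vanishes for three reasons. For k = 0 both functions are even, so both
    -- derivatives vanish; for k = 1 both are odd; for k ≥ 2 the regular solution vanishes to second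
    -- order.
    rcases k with _ | _ | k
    · have := hd 0
      have h0 : deriv g 0 = 0 := by
        norm_num at this
        exact self_eq_neg.1 this
      simp [h0]
    · have := hpar 0
      have h0 : g 0 = 0 := by
        norm_num at this
        exact self_eq_neg.1 this
      simp [h0]
    · simp
  obtain ⟨c, hc⟩ := radial_unique_pos hg hode hW
  refine ⟨c, fun y => ?_⟩
  have hρ := contDiff_radial_complex m k
  refine congrFun (Continuous.ext_on (f := g) (g := fun y => c * radial m k y)
    (dense_compl_singleton (0 : ℝ)) hg.continuous (continuous_const.mul hρ.continuous) ?_) y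
  intro y hy
  rcases lt_or_gt_of_ne (show y ≠ 0 from hy) with h | h
  · have h1 := hc (-y) (neg_pos.2 h)
    rw [hpar, radial_neg] at h1
    push_cast at h1
    have h2 : ((-1 : ℂ) ^ k) ≠ 0 := pow_ne_zero _ (by norm_num)
    refine mul_left_cancel₀ h2 ?_
    linear_combination h1
  · exact hc y h

lemma iteratedDeriv_pow_mul_zero (k : ℕ) {φ : ℝ → ℂ} (hφ : ContDiff ℝ ∞ φ) :
    iteratedDeriv k (fun y : ℝ => (y : ℂ) ^ k * φ y) 0 = k.factorial * φ 0 := by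
  induction k generalizing φ with
  | zero => simp
  | succ k ih =>
    have hφ1 : ContDiff ℝ ∞ (deriv φ) := (contDiff_infty_iff_deriv.1 hφ).2
    have hid : ContDiff ℝ ∞ fun y : ℝ => (y : ℂ) := Complex.ofRealCLM.contDiff
    have hd : deriv (fun y : ℝ => (y : ℂ) ^ (k + 1) * φ y) =
        fun y : ℝ => (y : ℂ) ^ k * ((k + 1) * φ y + y * deriv φ y) := by
      funext y
      have h1 : HasDerivAt (fun y : ℝ => (y : ℂ)) 1 y := Complex.ofRealCLM.hasDerivAt
      have h := (h1.pow (k + 1)).mul (hφ.differentiable (by simp) y).hasDerivAt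
      refine h.deriv.trans ?_
      simp only [Nat.add_sub_cancel, Pi.pow_apply]
      push_cast
      ring
    rw [iteratedDeriv_succ', hd, ih ((contDiff_const.mul hφ).add (hid.mul hφ1)),
      Nat.factorial_succ]
    push_cast
    ring

/-- On the positive half-line g is a multiple cρ of the regular solution ρ ~ y^k. The k-th
derivative of g at 0 therefore equals c·k! by right limits, but it is also zero, being the value at
0 of an odd function. Smoothness at the origin is essential: the equation alone would allow gluing
cρ to -cρ. -/
lemma radial_unique_odd {m : ℤ} {k : ℕ} (hk : 2 ≤ k) {g : ℝ → ℂ} (hg : ContDiff ℝ ∞ g)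
    (hode : ∀ y : ℝ, (y : ℂ) ^ 2 * (deriv (deriv g) y + (m - y ^ 2) * g y) = k * (k - 1) * g y)
    (hpar : ∀ y, g (-y) = (-1) ^ (k + 1) * g y) : g = 0 := by
  have hW : g 0 * (deriv (radial m k) 0 : ℝ) = deriv g 0 * radial m k 0 := by
    rw [deriv_radial, radial]
    obtain ⟨k, rfl⟩ := Nat.exists_eq_add_of_le' hk
    simp
  obtain ⟨c, hc⟩ := radial_unique_pos hg hode hW
  have hρ := contDiff_radial_complex m k
  have hcρ : ContDiff ℝ ∞ fun y => c * (radial m k y : ℂ) := contDiff_const.mul hρ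
  have hk' : ((k : ℕ) : WithTop ℕ∞) ≤ ∞ := by exact_mod_cast le_top
  have h0 : iteratedDeriv k g 0 = 0 := by
    have h1 := iteratedDeriv_comp_neg k g 0
    rw [funext hpar, iteratedDeriv_const_mul_field, neg_zero, Complex.real_smul, pow_succ] at h1
    push_cast at h1
    have h2 : ((-1 : ℂ) ^ k) ≠ 0 := pow_ne_zero _ (by norm_num)
    have h3 : -iteratedDeriv k g 0 = iteratedDeriv k g 0 := by
      refine mul_left_cancel₀ h2 ?_
      linear_combination h1
    exact self_eq_neg.1 h3.symm
  -- The two functions agree only for y > 0; continuity of their k-th derivatives carries the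
  -- equality to 0 from the right.
  have h1 : iteratedDeriv k g 0 = iteratedDeriv k (fun y => c * (radial m k y : ℂ)) 0 := by
    have t1 := ((hg.of_le hk').continuous_iteratedDeriv k le_rfl).continuousWithinAt
      (s := Set.Ioi 0) (x := 0)
    have t2 := ((hcρ.of_le hk').continuous_iteratedDeriv k le_rfl).continuousWithinAt
      (s := Set.Ioi 0) (x := 0)
    refine tendsto_nhds_unique t1.tendsto (t2.tendsto.congr' ?_)
    filter_upwards [self_mem_nhdsWithin] with y hy
    refine (Filter.EventuallyEq.iteratedDeriv_eq k ?_).symm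
    filter_upwards [Ioi_mem_nhds hy] with z hz
    exact hc z hz
  have h2 : iteratedDeriv k (fun y => c * (radial m k y : ℂ)) 0 = c * k.factorial := by
    have hE : ContDiff ℝ ∞ fun y => (radialEven m k y : ℂ) :=
      Complex.ofRealCLM.contDiff.comp (contDiff_radialEven m k)
    have h3 := iteratedDeriv_pow_mul_zero k hE
    rw [iteratedDeriv_const_mul_field, radial_eq]
    push_cast
    rw [h3, radialEven_zero]
    simp
  have hc0 : c = 0 := by
    rw [h0, h2] at h1
    simpa [Nat.factorial_ne_zero] using h1.symm
  have hpos : ∀ y, 0 < y → g y = 0 := fun y hy => by rw [hc y hy, hc0, zero_mul]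
  refine Continuous.ext_on (dense_compl_singleton (0 : ℝ)) hg.continuous continuous_const ?_
  intro y hy
  rcases lt_or_gt_of_ne (show y ≠ 0 from hy) with h | h
  · have h1 := hpos (-y) (neg_pos.2 h)
    rw [hpar] at h1
    exact (mul_eq_zero.1 h1).resolve_left (pow_ne_zero _ (by norm_num))
  · exact hpos y h

/-! ### Weight vectors and `K`-finite vectors -/

lemma rot_val (F : Pic q) (p : ℝ × ℝ) : (rot q F).1 p = -fderiv ℝ F.1 p (1, 0) := by
  have hsc := Real.sin_sq_add_cos_sq p.1
  change opC _ _ sl2E F.1 p - opC _ _ sl2F F.1 p = _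
  have h1 : fieldC sl2E p - fieldC sl2F p = -(1, 0) := by
    ext
    · simp [fieldC, angCoef, sl2E, sl2F, sl2Mk]
      linarith
    · simp [fieldC, radCoef, sl2E, sl2F, sl2Mk]
  have h2 : multC (-1 / 2) (Complex.I / 2) sl2E p = multC (-1 / 2) (Complex.I / 2) sl2F p := by
    simp [multC, radCoef, radCoef', sl2E, sl2F, sl2Mk]
  simp only [opC, firstOrder, h2]
  rw [add_sub_add_right_eq_sub, ← map_sub, h1, map_neg]

lemma hasDerivAt_theta (F : Pic q) (θ y : ℝ) :
    HasDerivAt (fun t => F.1 (t, y)) (-(rot q F).1 (θ, y)) θ := by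
  have h1 := (F.2.1.differentiable (by simp) (θ, y)).hasFDerivAt
  have h2 : HasDerivAt (fun t : ℝ => (t, y)) (1, 0) θ := (hasDerivAt_id θ).prodMk (hasDerivAt_const _ _)
  rw [rot_val, neg_neg]
  exact h1.comp_hasDerivAt θ h2

lemma hasDerivAt_exp_mul (F : Pic q) (μ : ℂ) (θ y : ℝ) :
    HasDerivAt (fun t : ℝ => Complex.exp (μ * t) * F.1 (t, y))
      (-(Complex.exp (μ * θ) * (rot q F - μ • F).1 (θ, y))) θ := by
  have h1 : HasDerivAt (fun t : ℝ => Complex.exp (μ * t)) (Complex.exp (μ * θ) * (μ * 1)) θ :=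
    ((Complex.ofRealCLM.hasDerivAt (x := θ)).const_mul μ).cexp
  refine (h1.mul (hasDerivAt_theta F θ y)).congr_deriv ?_
  simp only [Submodule.coe_sub, Submodule.coe_smul, Pi.sub_apply, Pi.smul_apply, smul_eq_mul]
  ring

lemma exp_mul_of_rot_eq {F : Pic q} {μ : ℂ} (h : rot q F = μ • F) (θ y : ℝ) :
    Complex.exp (μ * θ) * F.1 (θ, y) = F.1 (0, y) := by
  have h1 := is_const_of_deriv_eq_zero
    (fun t => (hasDerivAt_exp_mul F μ t y).differentiableAt)
    (fun t => by rw [(hasDerivAt_exp_mul F μ t y).deriv, h]; simp) θ 0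
  simpa using h1

lemma periodic (F : Pic q) (y : ℝ) : F.1 (4 * Real.pi, y) = F.1 (0, y) := by
  have h := F.2.2 4 0 y
  have h4 : ((-1 : ℝ)) ^ (4 : ℤ) = 1 := by norm_num
  rw [I_zpow_congr (b := 0) (Int.modEq_zero_iff_dvd.2 ⟨-q.val, by ring⟩), h4] at h
  simpa using h

lemma rot_sub_eq_zero {G : Pic q} {μ : ℂ}
    (h : rot q (rot q G - μ • G) = μ • (rot q G - μ • G)) : rot q G = μ • G := by
  set G₁ := rot q G - μ • G with hG₁
  have e1 := exp_mul_of_rot_eq h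
  have e2 : ∀ θ y : ℝ, Complex.exp (μ * θ) * G.1 (θ, y) + θ * G₁.1 (0, y) = G.1 (0, y) := by
    intro θ y
    have hd : ∀ t : ℝ, HasDerivAt (fun t : ℝ => Complex.exp (μ * t) * G.1 (t, y)
        + t * G₁.1 (0, y)) 0 t := by
      intro t
      refine ((hasDerivAt_exp_mul G μ t y).add
        ((Complex.ofRealCLM.hasDerivAt (x := t)).mul_const (G₁.1 (0, y)))).congr_deriv ?_
      rw [← e1 t y]
      simp [hG₁]
    have h1 := is_const_of_deriv_eq_zero (fun t => (hd t).differentiableAt)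
      (fun t => (hd t).deriv) θ 0
    simpa using h1
  have e3 : ∀ y : ℝ, G₁.1 (0, y) = 0 := by
    intro y
    by_contra hne
    have h1 := e1 (4 * Real.pi) y
    have h2 := e2 (4 * Real.pi) y
    rw [periodic] at h1 h2
    have h3 : Complex.exp (μ * (4 * Real.pi : ℝ)) = 1 := mul_right_cancel₀ hne (by rw [h1, one_mul])
    rw [h3, one_mul, add_eq_left] at h2
    refine hne ((mul_eq_zero.1 h2).resolve_left ?_)
    exact_mod_cast (by positivity : (4 * Real.pi) ≠ 0)
  have e4 : G₁ = 0 := by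
    apply Subtype.ext
    funext p
    have h1 := e1 p.1 p.2
    rw [e3] at h1
    exact (mul_eq_zero.1 h1).resolve_left (Complex.exp_ne_zero _)
  exact sub_eq_zero.1 e4

/-- A nonzero eigenfunction e^{-μθ}F(0,y) has period 4π only if e^{4πμ} = 1. -/
lemma exists_weight {F : Pic q} {μ : ℂ} (h : rot q F = μ • F) (hF : F ≠ 0) :
    ∃ m : ℤ, μ = Complex.I * m / 2 := by
  obtain ⟨y, hy⟩ : ∃ y, F.1 (0, y) ≠ 0 := by
    by_contra! hcon
    apply hF
    apply Subtype.ext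
    funext p
    have h1 := exp_mul_of_rot_eq h p.1 p.2
    rw [hcon] at h1
    exact (mul_eq_zero.1 h1).resolve_left (Complex.exp_ne_zero _)
  have h1 := exp_mul_of_rot_eq h (4 * Real.pi) y
  rw [periodic] at h1
  have h3 : Complex.exp (μ * (4 * Real.pi : ℝ)) = 1 := mul_right_cancel₀ hy (by rw [h1, one_mul])
  obtain ⟨n, hn⟩ := Complex.exp_eq_one_iff.1 h3
  have hpi : (Real.pi : ℂ) ≠ 0 := by exact_mod_cast Real.pi_ne_zero
  refine ⟨n, ?_⟩
  push_cast at hn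
  refine mul_right_cancel₀ hpi ?_
  linear_combination hn / 4

lemma eq_wave_of_rot {F : Pic q} {m : ℤ} (h : rot q F = (Complex.I * m / 2) • F) :
    F.1 = wave m fun y => F.1 (0, y) := by
  funext p
  have h1 := exp_mul_of_rot_eq h p.1 p.2
  simp only [wave]
  rw [← h1, ← mul_assoc, ← Complex.exp_add]
  ring_nf
  simp

lemma eigenspace_of_mem_maxGenEigenspace {F : Pic q} {μ : ℂ} {n : ℕ}
    (h : ((rot q - algebraMap ℂ _ μ) ^ n) F = 0) : rot q F = μ • F := by
  induction n with
  | zero => simp only [pow_zero, Module.End.one_apply] at h; simp [h]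
  | succ n ih =>
    rcases n with _ | n
    · simpa [sub_eq_zero] using h
    · apply ih
      rw [pow_succ', pow_succ'] at h
      rw [pow_succ']
      set G := ((rot q - algebraMap ℂ _ μ) ^ n) F with hG
      simp only [Module.End.mul_apply, LinearMap.sub_apply, Module.algebraMap_end_apply] at h ⊢
      rw [← hG] at h ⊢
      exact sub_eq_zero.2 (rot_sub_eq_zero (sub_eq_zero.1 h))

/-- A finite-dimensional invariant subspace is spanned by generalized eigenvectors. -/
lemma le_of_generalized_eigenvectors {V : Type*} [AddCommGroup V] [Module ℂ V]
    (f : Module.End ℂ V) {Q P : Submodule ℂ V} [FiniteDimensional ℂ Q] (hQ : ∀ x ∈ Q, f x ∈ Q)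
    (h : ∀ (μ : ℂ) (n : ℕ), ∀ x ∈ Q, ((f - algebraMap ℂ _ μ) ^ n) x = 0 → x ∈ P) : Q ≤ P := by
  have htop := Module.End.iSup_maxGenEigenspace_eq_top (f.restrict hQ)
  have h1 : ⊤ ≤ P.comap Q.subtype := by
    rw [← htop, iSup_le_iff]
    intro μ x hx
    obtain ⟨n, hn⟩ := (Module.End.mem_maxGenEigenspace (f.restrict hQ) μ x).1 hx
    have hval : ∀ (n : ℕ) (z : Q), (((f.restrict hQ - μ • 1) ^ n) z : Q).1 =
        ((f - algebraMap ℂ _ μ) ^ n) z.1 := by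
      intro n
      induction n with
      | zero => intro z; simp
      | succ n ih =>
        intro z
        rw [pow_succ, pow_succ, Module.End.mul_apply, Module.End.mul_apply, ih]
        rfl
    refine h μ n x.1 x.2 ?_
    rw [← hval, hn]
    rfl
  intro x hx
  exact h1 (x := ⟨x, hx⟩) trivial

/-- A finite-dimensional rotation-invariant space is spanned by its weight vectors. -/
lemma le_of_weight_vectors {Q P : Submodule ℂ (Pic q)} (hfin : FiniteDimensional ℂ Q)
    (hQ : ∀ F ∈ Q, rot q F ∈ Q)
    (h : ∀ (m : ℤ), ∀ F ∈ Q, rot q F = (Complex.I * m / 2) • F → F ∈ P) : Q ≤ P := by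
  refine le_of_generalized_eigenvectors (rot q) hQ fun μ n x hx hn => ?_
  have h2 := eigenspace_of_mem_maxGenEigenspace hn
  by_cases hx0 : x = 0
  · rw [hx0]
    exact P.zero_mem
  · obtain ⟨m, rfl⟩ := exists_weight h2 hx0
    exact h m x hx h2

/-- The span of the translates is finite-dimensional, hence closed for pointwise convergence. It
therefore contains the limits of difference quotients in τ, which give the action of `rot`. -/
lemma exists_rot_invariant {F : Pic q} (hF : F ∈ kFinite q (-1 / 2) (Complex.I / 2)) :
    ∃ P : Submodule ℂ (Pic q), FiniteDimensional ℂ P ∧ (∀ G ∈ P, rot q G ∈ P) ∧ F ∈ P := by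
  set T := Submodule.span ℂ (Set.range (kTranslate F.1)) with hT
  have hfin : FiniteDimensional ℂ T := hF
  have htrans : ∀ τ, ∀ f ∈ T, kTranslate f τ ∈ T := by
    intro τ f hf
    induction hf using Submodule.span_induction with
    | mem f hf =>
      obtain ⟨σ, rfl⟩ := hf
      refine Submodule.subset_span ⟨τ + σ, ?_⟩
      funext p
      simp only [kTranslate]
      rw [sub_add_eq_sub_sub]
    | zero => exact T.zero_mem
    | add f g _ _ hf hg => exact T.add_mem hf hg
    | smul c f _ hf => exact T.smul_mem c hf
  have hclosed : IsClosed (T : Set (ℝ × ℝ → ℂ)) := Submodule.closed_of_finiteDimensional T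
  refine ⟨T.comap (Pic q).subtype, ?_, fun G hG => ?_, ?_⟩
  · exact FiniteDimensional.of_injective
      (((Pic q).subtype.domRestrict (T.comap (Pic q).subtype)).codRestrict T fun x => x.2)
      fun x y hxy => Subtype.ext (Subtype.ext (congrArg (fun z : T => z.1) hxy))
  · have hlim : Tendsto (fun τ : ℝ => (τ : ℂ)⁻¹ • (kTranslate G.1 τ - G.1)) (𝓝[≠] 0)
        (𝓝 (rot q G).1) := by
      rw [tendsto_pi_nhds]
      intro p
      have h1 : HasDerivAt (fun τ : ℝ => p.1 - τ) (-1) 0 := by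
        simpa using (hasDerivAt_id (0 : ℝ)).const_sub p.1
      have h2 := hasDerivAt_theta G (p.1 - 0) p.2
      have h3 := h2.scomp (0 : ℝ) h1
      rw [hasDerivAt_iff_tendsto_slope] at h3
      simp only [sub_zero, neg_smul, one_smul, neg_neg] at h3
      refine h3.congr fun τ => ?_
      simp [slope_def_module, kTranslate]
    refine hclosed.mem_of_tendsto hlim (Eventually.of_forall fun τ => ?_)
    exact T.smul_mem _ (T.sub_mem (htrans τ _ hG) hG)
  · refine Submodule.subset_span ⟨0, ?_⟩
    funext p
    simp [kTranslate]

lemma psi_mem_kFinite (i : ℤ × ℕ) : psi q i ∈ kFinite q (-1 / 2) (Complex.I / 2) := by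
  by_cases h : Admissible q i
  · have hle : Submodule.span ℂ (Set.range (kTranslate (psi q i).1)) ≤
        Submodule.span ℂ {(psi q i).1} := by
      rw [Submodule.span_le]
      rintro _ ⟨τ, rfl⟩
      refine Submodule.mem_span_singleton.2 ⟨Complex.exp (Complex.I * i.1 * τ / 2), ?_⟩
      funext p
      rw [psi_val h]
      simp only [Pi.smul_apply, smul_eq_mul, kTranslate, wave, ← mul_assoc, ← Complex.exp_add]
      congr 2
      push_cast
      ring
    exact Submodule.finiteDimensional_of_le hle
  · rw [psi_of_not h]
    exact zero_mem _

/-! ### Spans of families of the vectors `Ψ_{m,k}` and the `K`-finite solutions -/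

/-- The span of the vectors `Ψ_{m,k}` with `(m, k)` in a set of indices. -/
def psiSpan (q : ZMod 4) (A : Set (ℤ × ℕ)) : Submodule ℂ (Pic q) := Submodule.span ℂ (psi q '' A)

lemma psi_mem_psiSpan {A : Set (ℤ × ℕ)} {i : ℤ × ℕ} (h : i ∈ A) : psi q i ∈ psiSpan q A :=
  Submodule.subset_span ⟨i, h, rfl⟩

lemma psiSpan_le {A : Set (ℤ × ℕ)} {P : Submodule ℂ (Pic q)} :
    psiSpan q A ≤ P ↔ ∀ i ∈ A, psi q i ∈ P := by
  rw [psiSpan, Submodule.span_le, Set.image_subset_iff]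
  rfl

lemma psiSpan_mono {A B : Set (ℤ × ℕ)} (h : A ⊆ B) : psiSpan q A ≤ psiSpan q B :=
  Submodule.span_mono (Set.image_mono h)

lemma psiSpan_union (A B : Set (ℤ × ℕ)) : psiSpan q (A ∪ B) = psiSpan q A ⊔ psiSpan q B := by
  rw [psiSpan, Set.image_union, Submodule.span_union]
  rfl

lemma psiSpan_iUnion {ι : Sort*} (A : ι → Set (ℤ × ℕ)) :
    psiSpan q (⋃ j, A j) = ⨆ j, psiSpan q (A j) := by
  rw [psiSpan, Set.image_iUnion, Submodule.span_iUnion]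
  rfl

lemma spanPsi_eq {k : ℕ} {S : Set ℤ} (hS : ∀ m ∈ S, Admissible q (m, k)) :
    spanPsi q k S = psiSpan q {i | i.2 = k ∧ i.1 ∈ S} := by
  unfold spanPsi psiSpan
  congr 1
  ext F
  constructor
  · rintro ⟨m, hm, hF⟩
    exact ⟨(m, k), ⟨rfl, hm⟩, Subtype.ext ((psi_val (hS m hm)).trans hF.symm)⟩
  · rintro ⟨⟨m, l⟩, ⟨rfl, hm⟩, rfl⟩
    exact ⟨m, hm, psi_val (hS m hm)⟩

lemma solSpace_eq (k : ℕ) : solSpace q k = psiSpan q {i | i.2 = k ∧ Admissible q i} := by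
  rw [solSpace, spanPsi_eq (q := q) (S := {m | (m : ZMod 4) = 2 * (k : ZMod 4) + q}) fun m hm => hm]
  congr 1
  ext ⟨m, l⟩
  constructor <;> rintro ⟨rfl, h⟩ <;> exact ⟨rfl, h⟩

lemma cas_eq_of_weight {F : Pic q} {m : ℤ} {c : ℂ} (hr : rot q F = (Complex.I * m / 2) • F)
    (hc : cas q F = c • F) :
    ContDiff ℝ ∞ (fun y => F.1 (0, y)) ∧ ∀ y : ℝ, (y : ℂ) ^ 2 *
      (deriv (deriv fun y => F.1 (0, y)) y + (m - y ^ 2) * F.1 (0, y)) = c * F.1 (0, y) := by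
  have hg : ContDiff ℝ ∞ (fun y => F.1 (0, y)) :=
    F.2.1.comp (contDiff_const.prodMk contDiff_id)
  refine ⟨hg, fun y => ?_⟩
  have h1 := cas_wave hg (eq_wave_of_rot hr)
  rw [hc] at h1
  have h2 := congrFun h1 (0, y)
  simpa [wave] using h2.symm

/-- The equivariance for j = 1 relates (π, -y) to (0, y). A weight vector knows its dependence on θ,
so this becomes a relation between F(0,-y) and F(0,y). -/
lemma parity_of_weight {F : Pic q} {m : ℤ} (hr : rot q F = (Complex.I * m / 2) • F) (y : ℝ) :
    F.1 (0, -y) = Complex.I ^ (m - q.val) * F.1 (0, y) := by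
  have h1 := F.2.2 1 0 y
  have h2 : Complex.exp (-Complex.I * m * (0 + (1 : ℤ) * Real.pi : ℝ) / 2) = Complex.I ^ (-m) := by
    rw [exp_shift]
    simp
  rw [eq_wave_of_rot hr] at h1
  simp only [wave, h2, zpow_one, neg_one_mul, one_mul] at h1
  have h3 : Complex.I ^ m * Complex.I ^ (-m) = 1 := by
    rw [← zpow_add₀ Complex.I_ne_zero, add_neg_cancel, zpow_zero]
  rw [sub_eq_add_neg, zpow_add₀ Complex.I_ne_zero]
  simp [-ZMod.natCast_val] at h1
  rw [zpow_neg] at h3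
  rw [zpow_neg (n := (q.val : ℤ)), zpow_natCast]
  linear_combination Complex.I ^ m * h1 - F.1 (0, -y) * h3

lemma I_zpow_two_mul (k : ℕ) : Complex.I ^ (2 * k : ℤ) = (-1) ^ k := by
  rw [zpow_mul, zpow_natCast]
  congr 1
  exact_mod_cast Complex.I_sq

lemma parity_of_admissible {F : Pic q} {m : ℤ} {k : ℕ}
    (hr : rot q F = (Complex.I * m / 2) • F) (h : Admissible q (m, k)) (y : ℝ) :
    F.1 (0, -y) = (-1) ^ k * F.1 (0, y) := by
  rw [parity_of_weight hr, ← I_zpow_two_mul]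
  congr 1
  apply I_zpow_congr
  have := (admissible_iff.1 h).sub_right (q.val : ℤ)
  rwa [add_sub_cancel_right] at this

lemma eq_smul_psi {F : Pic q} {m : ℤ} {k : ℕ} (hr : rot q F = (Complex.I * m / 2) • F)
    (hc : cas q F = (k * (k - 1) : ℂ) • F) (h : Admissible q (m, k)) :
    ∃ c : ℂ, F = c • psi q (m, k) := by
  obtain ⟨hg, hode⟩ := cas_eq_of_weight hr hc
  obtain ⟨c, hcy⟩ := radial_unique hg hode (parity_of_admissible hr h)
  refine ⟨c, Subtype.ext ?_⟩
  rw [Submodule.coe_smul, psi_val h, eq_wave_of_rot hr, ← wave_smul]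
  congr 1
  funext y
  exact hcy y

lemma eq_zero_of_wave {F : Pic q} {m : ℤ} (hr : rot q F = (Complex.I * m / 2) • F)
    (h : ∀ y, F.1 (0, y) = 0) : F = 0 := by
  apply Subtype.ext
  rw [eq_wave_of_rot hr]
  funext p
  simp [wave, h]

lemma eq_zero_of_admissible_succ {F : Pic q} {m : ℤ} {k : ℕ} (hk : 2 ≤ k)
    (hr : rot q F = (Complex.I * m / 2) • F) (hc : cas q F = (k * (k - 1) : ℂ) • F)
    (h : Admissible q (m, k + 1)) : F = 0 := by
  obtain ⟨hg, hode⟩ := cas_eq_of_weight hr hc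
  exact eq_zero_of_wave hr (congrFun (radial_unique_odd hk hg hode (parity_of_admissible hr h)))

/-- Here m - q is odd, so reflecting y twice multiplies F(0,y) by i^{2(m-q)} = -1. -/
lemma eq_zero_of_not_admissible {F : Pic q} {m : ℤ} {k : ℕ}
    (hr : rot q F = (Complex.I * m / 2) • F) (h : ¬Admissible q (m, k))
    (h' : ¬Admissible q (m, k + 1)) : F = 0 := by
  refine eq_zero_of_wave hr fun y => ?_
  have h1 := parity_of_weight hr y
  have h2 := parity_of_weight hr (-y)
  rw [neg_neg, h1, ← mul_assoc, ← zpow_add₀ Complex.I_ne_zero,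
    I_zpow_congr (b := 2)] at h2
  · have h3 : Complex.I ^ (2 : ℤ) = -1 := by exact_mod_cast Complex.I_sq
    rw [h3, neg_one_mul] at h2
    exact self_eq_neg.1 h2
  · simp only [admissible_iff, Int.ModEq] at h h' ⊢
    push_cast at h'
    omega

/-- Since Ω' commutes with rotations, its eigenspace meets a finite-dimensional rotation-invariant
space in another such space. It is therefore enough to treat weight vectors. -/
lemma kFiniteSol_le {lam : ℂ} {P : Submodule ℂ (Pic q)}
    (h : ∀ (m : ℤ) (F : Pic q), rot q F = (Complex.I * m / 2) • F → cas q F = (2 * lam) • F →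
      F ∈ P) : kFiniteSol q lam ≤ P := by
  rintro F ⟨hF1, hF2⟩
  obtain ⟨P', hfin, hinv, hF⟩ := exists_rot_invariant hF2
  have hle : P' ⊓ (cas q).eigenspace (2 * lam) ≤ P := by
    refine le_of_weight_vectors (Submodule.finiteDimensional_of_le inf_le_left)
      (fun G hG => ⟨hinv G hG.1, ?_⟩) fun m G hG hr => h m G hr (Module.End.mem_eigenspace_iff.1 hG.2)
    rw [SetLike.mem_coe, Module.End.mem_eigenspace_iff, ← Module.End.mul_apply, cas_rot,
      Module.End.mul_apply, Module.End.mem_eigenspace_iff.1 hG.2, map_smul]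
  exact hle ⟨hF, hF1⟩

lemma psi_mem_kFiniteSol (m : ℤ) (k : ℕ) {lam : ℂ} (h : 2 * lam = k * (k - 1)) :
    psi q (m, k) ∈ kFiniteSol q lam :=
  ⟨Module.End.mem_eigenspace_iff.2 (by rw [cas_psi, h]), psi_mem_kFinite _⟩

theorem solSpace_eq_kFiniteSol {l : ℕ} (hl : 2 ≤ l) :
    solSpace q l = kFiniteSol q ((l : ℂ) * ((l : ℂ) - 1) / 2) := by
  have hlam : 2 * ((l : ℂ) * ((l : ℂ) - 1) / 2) = l * (l - 1) := by ring
  rw [solSpace_eq]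
  apply le_antisymm
  · rw [psiSpan_le]
    rintro ⟨m, k⟩ ⟨rfl, -⟩
    exact psi_mem_kFiniteSol _ _ hlam
  · refine kFiniteSol_le fun m F hr hc => ?_
    rw [hlam] at hc
    -- The residue of m modulo 4 decides: parity l gives a multiple of Ψ_{m,l}, while parity l+1 and
    -- odd m - q leave only zero.
    by_cases h : Admissible q (m, l)
    · obtain ⟨c, rfl⟩ := eq_smul_psi hr hc h
      exact Submodule.smul_mem _ _ (psi_mem_psiSpan ⟨rfl, h⟩)
    · by_cases h' : Admissible q (m, l + 1)
      · rw [eq_zero_of_admissible_succ hl hr hc h']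
        exact Submodule.zero_mem _
      · rw [eq_zero_of_not_admissible hr h h']
        exact Submodule.zero_mem _

lemma solSpace_zero_sup_one :
    solSpace q 0 ⊔ solSpace q 1 = psiSpan q {i | i.2 < 2 ∧ Admissible q i} := by
  rw [solSpace_eq, solSpace_eq, ← psiSpan_union]
  congr 1
  ext i
  simp only [Set.mem_union, Set.mem_ofPred_eq, ← or_and_right]
  refine and_congr_left fun _ => ?_
  omega

theorem solSpace_zero_sup_one_eq_kFiniteSol : solSpace q 0 ⊔ solSpace q 1 = kFiniteSol q 0 := by
  rw [solSpace_zero_sup_one]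
  apply le_antisymm
  · rw [psiSpan_le]
    rintro ⟨m, k⟩ ⟨hk, -⟩
    refine psi_mem_kFiniteSol _ _ ?_
    have hk' : k < 2 := hk
    interval_cases k <;> simp
  · refine kFiniteSol_le fun m F hr hc => ?_
    rw [mul_zero] at hc
    -- The eigenvalue k(k-1) is 0 for both k = 0 and k = 1, so even solutions land in H_0 and odd
    -- ones in H_1.
    by_cases h : Admissible q (m, 0)
    · obtain ⟨c, rfl⟩ := eq_smul_psi hr (by simpa using hc) h
      exact Submodule.smul_mem _ _ (psi_mem_psiSpan ⟨by simp, h⟩)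
    · by_cases h' : Admissible q (m, 0 + 1)
      · obtain ⟨c, rfl⟩ := eq_smul_psi hr (by simpa using hc) h'
        exact Submodule.smul_mem _ _ (psi_mem_psiSpan ⟨by simp, h'⟩)
      · rw [eq_zero_of_not_admissible hr h h']
        exact Submodule.zero_mem _

/-! ### Independence of the vectors `Ψ_{m,k}` -/

/-- A combination of rotation and Casimir operator with simple spectrum on the `Ψ_{m,k}`. -/
def separator (q : ZMod 4) : Module.End ℂ (Pic q) := (2 : ℂ) • rot q + cas q

/-- The eigenvalues of `separator`. -/
def sepValue (i : ℤ × ℕ) : ℂ := i.2 * (i.2 - 1) + Complex.I * i.1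

lemma separator_psi (i : ℤ × ℕ) : separator q (psi q i) = sepValue i • psi q i := by
  obtain ⟨m, k⟩ := i
  simp only [separator, sepValue, LinearMap.add_apply, LinearMap.smul_apply, rot_psi, cas_psi]
  module

lemma sepValue_inj {i j : ℤ × ℕ} (h : sepValue i = sepValue j) :
    i.1 = j.1 ∧ (i.2 : ℤ) * (i.2 - 1) = j.2 * (j.2 - 1) := by
  have h1 := congrArg Complex.re h
  have h2 := congrArg Complex.im h
  simp [sepValue] at h1 h2
  exact ⟨h2, by exact_mod_cast h1⟩

/-- The imaginary part gives m and the real part gives k(k-1), so only k and 1-k can be confused.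
The congruence m ≡ 2k+q fixes the parity of k and excludes this. -/
lemma sepValue_injOn : Set.InjOn sepValue {i | Admissible q i} := by
  rintro ⟨m, k⟩ hi ⟨m', k'⟩ hj h
  obtain ⟨h1, h2⟩ := sepValue_inj h
  simp only at h1 h2
  subst h1
  have h3 : ((k : ℤ) - k') * (k + k' - 1) = 0 := by linear_combination h2
  have hi' := admissible_iff.1 hi
  have hj' := admissible_iff.1 hj
  simp only [Int.ModEq] at hi' hj'
  rcases mul_eq_zero.1 h3 with h4 | h4
  · rw [Prod.mk.injEq]
    exact ⟨rfl, by omega⟩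
  · omega

lemma linearIndependent_psi :
    LinearIndependent ℂ fun i : {i : ℤ × ℕ // Admissible q i} => psi q i := by
  have hinj : Function.Injective fun i : {i : ℤ × ℕ // Admissible q i} => sepValue i.1 :=
    fun i j h => Subtype.ext (sepValue_injOn i.2 j.2 h)
  exact Module.End.eigenvectors_linearIndependent' (separator q) _ hinj _ fun i =>
    ⟨Module.End.mem_eigenspace_iff.2 (separator_psi i.1), psi_ne_zero i.2⟩

lemma disjoint_psiSpan {A B : Set (ℤ × ℕ)} (hA : ∀ i ∈ A, Admissible q i)
    (hB : ∀ i ∈ B, Admissible q i) (hAB : Disjoint A B) :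
    Disjoint (psiSpan q A) (psiSpan q B) := by
  have himage : ∀ C : Set (ℤ × ℕ), (∀ i ∈ C, Admissible q i) →
      psi q '' C = (fun i : {i : ℤ × ℕ // Admissible q i} => psi q i) '' (Subtype.val ⁻¹' C) := by
    intro C hC
    ext F
    constructor
    · rintro ⟨i, hi, rfl⟩
      exact ⟨⟨i, hC i hi⟩, hi, rfl⟩
    · rintro ⟨i, hi, rfl⟩
      exact ⟨i, hi, rfl⟩
  rw [psiSpan, psiSpan, himage A hA, himage B hB]
  exact linearIndependent_psi.disjoint_span_image (hAB.preimage _)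

lemma psi_notMem_psiSpan {A : Set (ℤ × ℕ)} (hA : ∀ i ∈ A, Admissible q i) {i : ℤ × ℕ}
    (hi : Admissible q i) (hiA : i ∉ A) : psi q i ∉ psiSpan q A := by
  intro h
  have h1 := disjoint_psiSpan (q := q) (A := {i}) (B := A) (by rintro _ rfl; exact hi) hA
    (Set.disjoint_singleton_left.2 hiA)
  exact psi_ne_zero hi (Submodule.disjoint_def.1 h1 _ (psi_mem_psiSpan rfl) h)

theorem iSupIndep_solSpace : iSupIndep (solSpace q) := by
  intro k
  simp only [solSpace_eq, ← psiSpan_iUnion]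
  refine disjoint_psiSpan (fun i hi => hi.2) (fun i hi => ?_) ?_
  · obtain ⟨l, hl⟩ := Set.mem_iUnion.1 hi
    obtain ⟨_, h⟩ := Set.mem_iUnion.1 hl
    exact h.2
  · rw [Set.disjoint_left]
    intro i hi hi'
    obtain ⟨l, hl⟩ := Set.mem_iUnion.1 hi'
    obtain ⟨hne, h⟩ := Set.mem_iUnion.1 hl
    exact hne (h.1.symm.trans hi.1)

/-! ### Submodules spanned by vectors `Ψ_{m,k}` -/

/-- An invariant subspace contains the components of its elements along eigenvectors with distinct
eigenvalues. -/
lemma smul_mem_of_sum_mem {V ι : Type*} [AddCommGroup V] [Module ℂ V] {f : Module.End ℂ V}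
    {N : Submodule ℂ V} (hN : ∀ x ∈ N, f x ∈ N) {v : ι → V} {μ : ι → ℂ}
    (hv : ∀ i, f (v i) = μ i • v i) (s : Finset ι) (hμ : Set.InjOn μ s) (c : ι → ℂ)
    (hc : ∑ i ∈ s, c i • v i ∈ N) : ∀ i ∈ s, c i • v i ∈ N := by
  classical
  induction s using Finset.induction_on generalizing c with
  | empty => simp
  | insert a s ha ih =>
    -- Applying f - μ_a removes the component at a and rescales the others by the nonzero numbers
    -- μ_i - μ_a.
    have h1 : ∑ i ∈ s, (c i * (μ i - μ a)) • v i ∈ N := by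
      have h2 := N.sub_mem (hN _ hc) (N.smul_mem (μ a) hc)
      rw [map_sum, Finset.smul_sum, ← Finset.sum_sub_distrib, Finset.sum_insert ha] at h2
      have h3 : ∀ i, f (c i • v i) - μ a • c i • v i = (c i * (μ i - μ a)) • v i := by
        intro i
        rw [map_smul, hv]
        module
      simpa only [h3, sub_self, mul_zero, zero_smul, zero_add] using h2
    have h4 : ∀ i ∈ s, c i • v i ∈ N := by
      intro i hi
      have h5 := ih (hμ.mono (by simp)) _ h1 i hi
      have hne : μ i - μ a ≠ 0 := by
        rw [sub_ne_zero]
        intro h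
        have := hμ (by simp [hi]) (by simp) h
        exact ha (this ▸ hi)
      have h6 := N.smul_mem (μ i - μ a)⁻¹ h5
      rwa [smul_smul, mul_comm (c i), inv_mul_cancel_left₀ hne] at h6
    intro i hi
    rcases Finset.mem_insert.1 hi with rfl | hi
    · rw [Finset.sum_insert ha] at hc
      have := N.sub_mem hc (N.sum_mem h4)
      rwa [add_sub_cancel_right] at this
    · exact h4 i hi

lemma act_mem (N : LieSubmodule ℂ SchrAlg (Pic q)) (X : SchrAlg) {F : Pic q} (hF : F ∈ N) :
    act X F ∈ N := N.lie_mem hF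

lemma rot_mem (N : LieSubmodule ℂ SchrAlg (Pic q)) {F : Pic q} (hF : F ∈ N) : rot q F ∈ N :=
  sub_mem (act_mem N _ hF) (act_mem N _ hF)

lemma raise_mem (N : LieSubmodule ℂ SchrAlg (Pic q)) {F : Pic q} (hF : F ∈ N) : raise q F ∈ N :=
  add_mem (act_mem N _ hF)
    (N.toSubmodule.smul_mem _ (add_mem (act_mem N _ hF) (act_mem N _ hF)))

lemma lower_mem (N : LieSubmodule ℂ SchrAlg (Pic q)) {F : Pic q} (hF : F ∈ N) : lower q F ∈ N :=
  sub_mem (act_mem N _ hF)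
    (N.toSubmodule.smul_mem _ (add_mem (act_mem N _ hF) (act_mem N _ hF)))

lemma create_mem (N : LieSubmodule ℂ SchrAlg (Pic q)) {F : Pic q} (hF : F ∈ N) :
    create q F ∈ N :=
  add_mem (act_mem N _ hF) (N.toSubmodule.smul_mem _ (act_mem N _ hF))

lemma annih_mem (N : LieSubmodule ℂ SchrAlg (Pic q)) {F : Pic q} (hF : F ∈ N) :
    annih q F ∈ N :=
  sub_mem (N.toSubmodule.smul_mem _ (act_mem N _ hF)) (act_mem N _ hF)

lemma separator_mem (N : LieSubmodule ℂ SchrAlg (Pic q)) {F : Pic q} (hF : F ∈ N) :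
    separator q F ∈ N := by
  have hcas : cas q F ∈ N.toSubmodule := by
    rw [cas_eq]
    exact add_mem (sub_mem (add_mem (raise_mem N (lower_mem N hF))
      (N.toSubmodule.smul_mem _ (rot_mem N hF))) (rot_mem N (rot_mem N hF)))
      (N.toSubmodule.smul_mem _ hF)
  exact add_mem (N.toSubmodule.smul_mem _ (rot_mem N hF)) hcas

lemma psi_mem_of_sum_mem (N : LieSubmodule ℂ SchrAlg (Pic q)) (s : Finset (ℤ × ℕ))
    (hs : Set.InjOn sepValue s) (c : ℤ × ℕ → ℂ) (hc : ∑ i ∈ s, c i • psi q i ∈ N) {i : ℤ × ℕ}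
    (hi : i ∈ s) (hci : c i ≠ 0) : psi q i ∈ N := by
  have h := smul_mem_of_sum_mem (N := N.toSubmodule) (fun x hx => separator_mem N hx)
    separator_psi s hs c hc i hi
  exact (N.toSubmodule.smul_mem_iff hci).1 h

/-- The operator `separator` preserves N and has distinct eigenvalues on the Ψ_{m,k} in question, so
every component of F lies in N. This is what reduces submodules to sets of indices. -/
lemma le_psiSpan (N : LieSubmodule ℂ SchrAlg (Pic q)) {A : Set (ℤ × ℕ)}
    (hA : ∀ i ∈ A, Admissible q i) {F : Pic q} (hF : F ∈ N) (hFA : F ∈ psiSpan q A) :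
    F ∈ psiSpan q {i | i ∈ A ∧ psi q i ∈ N} := by
  obtain ⟨l, hl, rfl⟩ := (Finsupp.mem_span_image_iff_linearCombination ℂ).1 hFA
  rw [Finsupp.linearCombination_apply, Finsupp.sum] at hF ⊢
  refine Submodule.sum_mem _ fun i hi => Submodule.smul_mem _ _ (psi_mem_psiSpan ⟨hl hi, ?_⟩)
  exact psi_mem_of_sum_mem N l.support
    (sepValue_injOn.mono fun j hj => hA j (hl hj)) l hF hi (Finsupp.mem_support_iff.1 hi)

/-! ### Submodules as sets of indices closed under ladder steps -/

/-- `Step i j` means that the vector indexed by `j` occurs in the image of the one indexed by `i`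
under one of the ladder operators. -/
def Step (i j : ℤ × ℕ) : Prop :=
  (j.1 = i.1 + 4 ∧ j.2 = i.2 ∧ i.1 + 1 + 2 * i.2 ≠ 0) ∨
  (j.1 = i.1 - 4 ∧ j.2 = i.2 ∧ i.1 - 1 - 2 * i.2 ≠ 0) ∨
  (j.1 = i.1 + 2 ∧ j.2 = i.2 + 1 ∧ i.2 ≠ 1 ∧ i.1 + 1 + 2 * i.2 ≠ 0) ∨
  (j.1 = i.1 - 2 ∧ j.2 = i.2 + 1 ∧ i.2 ≠ 1 ∧ i.1 - 1 - 2 * i.2 ≠ 0) ∨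
  (j.1 = i.1 + 2 ∧ j.2 + 1 = i.2) ∨ (j.1 = i.1 - 2 ∧ j.2 + 1 = i.2)

lemma step_neg {m m' : ℤ} {k k' : ℕ} (h : Step (m, k) (m', k')) : Step (-m, k) (-m', k') := by
  simp only [Step] at h ⊢
  rcases h with h | h | h | h | h | h
  · exact Or.inr (Or.inl (by omega))
  · exact Or.inl (by omega)
  · exact Or.inr (Or.inr (Or.inr (Or.inl (by omega))))
  · exact Or.inr (Or.inr (Or.inl (by omega)))
  · exact Or.inr (Or.inr (Or.inr (Or.inr (Or.inr (by omega)))))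
  · exact Or.inr (Or.inr (Or.inr (Or.inr (Or.inl (by omega)))))

lemma coeff_ne_zero {n : ℤ} {k : ℕ} (hk : k ≠ 0) (hn : n ≠ 0) :
    (k * n / ((2 * k + 1) * (2 * k + 3)) : ℂ) ≠ 0 := by
  have h1 : (2 * (k : ℂ) + 1) ≠ 0 := by exact_mod_cast (by omega : 2 * k + 1 ≠ 0)
  have h2 : (2 * (k : ℂ) + 3) ≠ 0 := by exact_mod_cast (by omega : 2 * k + 3 ≠ 0)
  exact div_ne_zero (mul_ne_zero (by exact_mod_cast hk) (by exact_mod_cast hn)) (mul_ne_zero h1 h2)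

/-- Needed because `create` and `annih` produce two terms of equal weight. Their eigenvalues under
Ω' differ by 4k+2, so a submodule contains each term separately. -/
lemma mem_of_pair_mem (N : LieSubmodule ℂ SchrAlg (Pic q)) {m : ℤ} {k : ℕ} {a b : ℂ}
    (h : a • psi q (m, k) + b • psi q (m, k + 2) ∈ N) :
    (a ≠ 0 → psi q (m, k) ∈ N) ∧ (b ≠ 0 → psi q (m, k + 2) ∈ N) := by
  have hne : ((m, k) : ℤ × ℕ) ≠ (m, k + 2) := by simp
  have hinj : Set.InjOn sepValue (({(m, k), (m, k + 2)} : Finset (ℤ × ℕ)) : Set (ℤ × ℕ)) := by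
    have hv : sepValue (m, k) ≠ sepValue (m, k + 2) := by
      intro h
      have := (sepValue_inj h).2
      push_cast at this
      ring_nf at this
      omega
    intro i hi j hj hij
    simp only [Finset.coe_insert, Finset.coe_singleton, Set.mem_insert_iff,
      Set.mem_singleton_iff] at hi hj
    rcases hi with rfl | rfl <;> rcases hj with rfl | rfl
    · rfl
    · exact absurd hij hv
    · exact absurd hij.symm hv
    · rfl
  have hsum : ∑ i ∈ {(m, k), (m, k + 2)}, (if i = (m, k) then a else b) • psi q i ∈ N := by
    rw [Finset.sum_pair hne, if_pos rfl, if_neg hne.symm]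
    exact h
  refine ⟨fun ha => ?_, fun hb => ?_⟩
  · exact psi_mem_of_sum_mem N _ hinj _ hsum (by simp) (by simpa using ha)
  · exact psi_mem_of_sum_mem N _ hinj _ hsum (by simp) (by simpa using hb)

lemma psi_mem_of_step (N : LieSubmodule ℂ SchrAlg (Pic q)) {i j : ℤ × ℕ} (h : Step i j)
    (hi : psi q i ∈ N) : psi q j ∈ N := by
  obtain ⟨m, k⟩ := i
  obtain ⟨m', k'⟩ := j
  simp only [Step] at h
  rcases h with ⟨rfl, rfl, hne⟩ | ⟨rfl, rfl, hne⟩ | ⟨rfl, rfl, hk, hne⟩ | ⟨rfl, rfl, hk, hne⟩ |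
    ⟨rfl, rfl⟩ | ⟨rfl, rfl⟩
  · have h1 := raise_mem N hi
    rw [raise_psi] at h1
    refine (N.toSubmodule.smul_mem_iff (neg_ne_zero.2 (div_ne_zero ?_ two_ne_zero))).1 h1
    exact_mod_cast hne
  · have h1 := lower_mem N hi
    rw [lower_psi] at h1
    refine (N.toSubmodule.smul_mem_iff (div_ne_zero ?_ two_ne_zero)).1 h1
    exact_mod_cast hne
  · have h1 := create_mem N hi
    rcases k with _ | k
    · rw [create_psi_zero] at h1
      refine (N.toSubmodule.smul_mem_iff ?_).1 h1
      exact_mod_cast (by simpa [add_comm] using hne : 1 + m ≠ 0)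
    · rw [create_psi_succ] at h1
      refine (mem_of_pair_mem N h1).2 ?_
      have h2 := coeff_ne_zero (n := 2 * k + 3 + m) (k := k) (by omega) (by push_cast at hne; omega)
      push_cast at h2
      exact h2
  · have h1 := annih_mem N hi
    rcases k with _ | k
    · rw [annih_psi_zero] at h1
      refine (N.toSubmodule.smul_mem_iff ?_).1 h1
      exact_mod_cast (by push_cast at hne; omega : 1 - m ≠ 0)
    · rw [annih_psi_succ] at h1
      refine (mem_of_pair_mem N h1).2 ?_
      have h2 := coeff_ne_zero (n := 2 * k + 3 - m) (k := k) (by omega) (by push_cast at hne; omega)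
      push_cast at h2
      exact h2
  · have h1 := create_mem N hi
    rw [create_psi_succ] at h1
    refine (mem_of_pair_mem N h1).1 (neg_ne_zero.2 ?_)
    exact_mod_cast Nat.succ_ne_zero k'
  · have h1 := annih_mem N hi
    rw [annih_psi_succ] at h1
    refine (mem_of_pair_mem N h1).1 ?_
    exact_mod_cast Nat.succ_ne_zero k'

lemma psi_mem_of_reach (N : LieSubmodule ℂ SchrAlg (Pic q)) {i j : ℤ × ℕ}
    (h : Relation.ReflTransGen Step i j) (hi : psi q i ∈ N) : psi q j ∈ N := by
  induction h with
  | refl => exact hi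
  | tail _ hs ih => exact psi_mem_of_step N hs ih

/-- The rotation and ladder operators, together with the scalar by which the centre acts, span the
complexified image of 𝔤. -/
lemma act_mem_of_ladder {P : Submodule ℂ (Pic q)} (h0 : ∀ F ∈ P, rot q F ∈ P)
    (h1 : ∀ F ∈ P, raise q F ∈ P) (h2 : ∀ F ∈ P, lower q F ∈ P) (h3 : ∀ F ∈ P, create q F ∈ P)
    (h4 : ∀ F ∈ P, annih q F ∈ P) (X : SchrAlg) {F : Pic q} (hF : F ∈ P) : act X F ∈ P := by
  have hI : Complex.I * Complex.I = -1 := Complex.I_mul_I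
  have eH : act sl2H F = (1 / 2 : ℂ) • (raise q F + lower q F) := by
    simp only [raise, lower, LinearMap.add_apply, LinearMap.sub_apply, LinearMap.smul_apply]
    module
  have eE : act sl2E F = (-Complex.I / 4) • (raise q F - lower q F) + (1 / 2 : ℂ) • rot q F := by
    simp only [raise, lower, rot, LinearMap.add_apply, LinearMap.sub_apply, LinearMap.smul_apply]
    match_scalars <;> first | ring1 | linear_combination (1 / 2 : ℂ) * hI
  have eF : act sl2F F = (-Complex.I / 4) • (raise q F - lower q F) - (1 / 2 : ℂ) • rot q F := by
    simp only [raise, lower, rot, LinearMap.add_apply, LinearMap.sub_apply, LinearMap.smul_apply]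
    match_scalars <;> first | ring1 | linear_combination (1 / 2 : ℂ) * hI
  have eU : act heisU F = (1 / 2 : ℂ) • (create q F - annih q F) := by
    simp only [create, annih, LinearMap.add_apply, LinearMap.sub_apply, LinearMap.smul_apply]
    module
  have eV : act heisV F = (-Complex.I / 2) • (create q F + annih q F) := by
    simp only [create, annih, LinearMap.add_apply, LinearMap.sub_apply, LinearMap.smul_apply]
    match_scalars <;> first | ring1 | linear_combination hI
  have hadd := P.add_mem (h1 F hF) (h2 F hF)
  have hsub := P.smul_mem (-Complex.I / 4) (P.sub_mem (h1 F hF) (h2 F hF))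
  have hrot := P.smul_mem (1 / 2 : ℂ) (h0 F hF)
  rw [act_eq]
  simp only [LinearMap.add_apply, LinearMap.smul_apply, act_heisW, eH, eE, eF, eU, eV]
  refine P.add_mem (P.add_mem (P.add_mem (P.add_mem (P.add_mem ?_ ?_) ?_) ?_) ?_) ?_ <;>
    refine P.smul_mem _ ?_
  · exact P.smul_mem _ hadd
  · exact P.add_mem hsub hrot
  · exact P.sub_mem hsub hrot
  · exact P.smul_mem _ (P.sub_mem (h3 F hF) (h4 F hF))
  · exact P.smul_mem _ (P.add_mem (h3 F hF) (h4 F hF))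
  · exact P.smul_mem _ hF

lemma map_psiSpan_mem {A : Set (ℤ × ℕ)} {f : Module.End ℂ (Pic q)}
    (h : ∀ i ∈ A, f (psi q i) ∈ psiSpan q A) {F : Pic q} (hF : F ∈ psiSpan q A) :
    f F ∈ psiSpan q A :=
  (psiSpan_le (P := (psiSpan q A).comap f)).2 h hF

/-- The submodule spanned by the `Ψ_{m,k}` with indices in a set closed under `Step`. -/
def psiLie (q : ZMod 4) (A : Set (ℤ × ℕ)) (hA : ∀ i ∈ A, ∀ j, Step i j → j ∈ A) :
    LieSubmodule ℂ SchrAlg (Pic q) where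
  __ := psiSpan q A
  lie_mem {X F} hF := by
    -- A term with zero coefficient imposes nothing, so closure is needed only along genuine steps.
    have hmem : ∀ {i j : ℤ × ℕ} {c : ℂ}, i ∈ A → (c ≠ 0 → Step i j) →
        c • psi q j ∈ psiSpan q A := by
      intro i j c hi hs
      by_cases hc : c = 0
      · rw [hc, zero_smul]
        exact Submodule.zero_mem _
      · exact Submodule.smul_mem _ _ (psi_mem_psiSpan (hA i hi j (hs hc)))
    refine act_mem_of_ladder (P := psiSpan q A) (fun F => map_psiSpan_mem ?_)
      (fun F => map_psiSpan_mem ?_) (fun F => map_psiSpan_mem ?_) (fun F => map_psiSpan_mem ?_)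
      (fun F => map_psiSpan_mem ?_) X hF
    · rintro ⟨m, k⟩ hi
      rw [rot_psi]
      exact Submodule.smul_mem _ _ (psi_mem_psiSpan hi)
    · rintro ⟨m, k⟩ hi
      rw [raise_psi]
      refine hmem hi fun hc => Or.inl ⟨rfl, rfl, fun h => hc ?_⟩
      have h' : (m + 1 + 2 * k : ℂ) = 0 := by exact_mod_cast h
      rw [h']
      simp
    · rintro ⟨m, k⟩ hi
      rw [lower_psi]
      refine hmem hi fun hc => Or.inr (Or.inl ⟨rfl, rfl, fun h => hc ?_⟩)
      have h' : (m - 1 - 2 * k : ℂ) = 0 := by exact_mod_cast h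
      rw [h']
      simp
    · rintro ⟨m, k⟩ hi
      rcases k with _ | k
      · rw [create_psi_zero]
        refine hmem hi fun hc => Or.inr (Or.inr (Or.inl ⟨rfl, rfl, by simp, fun h => hc ?_⟩))
        have h' : (m + 1 : ℂ) = 0 := by exact_mod_cast (by simpa using h : m + 1 = 0)
        rw [add_comm, h']
      · rw [create_psi_succ]
        refine Submodule.add_mem _ (hmem hi fun _ => ?_) (hmem hi fun hc => ?_)
        · simp [Step]
        · refine Or.inr (Or.inr (Or.inl ⟨rfl, rfl, fun h => hc ?_, fun h => hc ?_⟩))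
          · have h' : k = 0 := by simpa using h
            simp [h']
          · have h' : (2 * k + 3 + m : ℂ) = 0 := by
              exact_mod_cast (by push_cast at h; linarith : 2 * (k : ℤ) + 3 + m = 0)
            simp [h']
    · rintro ⟨m, k⟩ hi
      rcases k with _ | k
      · rw [annih_psi_zero]
        refine hmem hi fun hc =>
          Or.inr (Or.inr (Or.inr (Or.inl ⟨rfl, rfl, by simp, fun h => hc ?_⟩)))
        have h' : (1 - m : ℂ) = 0 := by
          exact_mod_cast (by push_cast at h; linarith : 1 - m = 0)
        exact h'
      · rw [annih_psi_succ]
        refine Submodule.add_mem _ (hmem hi fun _ => ?_) (hmem hi fun hc => ?_)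
        · simp [Step]
        · refine Or.inr (Or.inr (Or.inr (Or.inl ⟨rfl, rfl, fun h => hc ?_, fun h => hc ?_⟩)))
          · have h' : k = 0 := by simpa using h
            simp [h']
          · have h' : (2 * k + 3 - m : ℂ) = 0 := by
              exact_mod_cast (by push_cast at h; linarith : 2 * (k : ℤ) + 3 - m = 0)
            simp [h']

lemma psiLie_toSubmodule {A : Set (ℤ × ℕ)} (hA : ∀ i ∈ A, ∀ j, Step i j → j ∈ A) :
    (psiLie q A hA).toSubmodule = psiSpan q A := rfl

/-- The quotient of two such submodules is irreducible if any two indices in the difference are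
connected by steps. -/
theorem psiLie_covBy {A B : Set (ℤ × ℕ)} (hA : ∀ i ∈ A, ∀ j, Step i j → j ∈ A)
    (hB : ∀ i ∈ B, ∀ j, Step i j → j ∈ B) (hadm : ∀ i ∈ B, Admissible q i) (hAB : A ⊆ B)
    (hne : ∃ i ∈ B, i ∉ A)
    (hconn : ∀ i ∈ B, i ∉ A → ∀ j ∈ B, j ∉ A → Relation.ReflTransGen Step i j) :
    psiLie q A hA ⋖ psiLie q B hB := by
  have hadmA : ∀ i ∈ A, Admissible q i := fun i hi => hadm i (hAB hi)
  refine ⟨lt_of_le_not_ge ?_ ?_, ?_⟩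
  · exact psiSpan_mono hAB
  · intro hle
    obtain ⟨i, hi, hiA⟩ := hne
    exact psi_notMem_psiSpan hadmA (hadm i hi) hiA (hle (psi_mem_psiSpan hi))
  · intro N hAN hNB
    have hNB' : ∀ F ∈ N, F ∈ psiSpan q B := fun F hF => hNB.le hF
    obtain ⟨F, hFN, hFA⟩ := SetLike.not_le_iff_exists.1 hAN.not_ge
    have h1 := le_psiSpan N hadm hFN (hNB' F hFN)
    -- F is a combination of vectors Ψ_i lying in N. If all their indices were in A, then F would be
    -- in the smaller submodule.
    obtain ⟨i, ⟨hiB, hiN⟩, hiA⟩ : ∃ i, (i ∈ B ∧ psi q i ∈ N) ∧ i ∉ A := by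
      by_contra! hcon
      exact hFA (psiSpan_mono (fun i hi => hcon i hi) h1)
    refine hNB.not_ge ?_
    change psiSpan q B ≤ N.toSubmodule
    rw [psiSpan_le]
    intro j hj
    by_cases hjA : j ∈ A
    · exact hAN.le (psi_mem_psiSpan hjA)
    · exact psi_mem_of_reach N (hconn i hiB hiA j hj hjA) hiN

/-! ### Connectedness -/

open Relation in
lemma reach_down_right (m : ℤ) (k n : ℕ) :
    ReflTransGen Step (m, k + n) (m + 2 * n, k) := by
  induction n generalizing m with
  | zero => simp [ReflTransGen.refl]
  | succ n ih =>
    refine ReflTransGen.head (b := (m + 2, k + n)) ?_ ?_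
    · exact Or.inr (Or.inr (Or.inr (Or.inr (Or.inl ⟨rfl, rfl⟩))))
    · convert ih (m + 2) using 2
      push_cast
      ring

open Relation in
lemma reach_down_left (m : ℤ) (k n : ℕ) :
    ReflTransGen Step (m, k + n) (m - 2 * n, k) := by
  induction n generalizing m with
  | zero => simp [ReflTransGen.refl]
  | succ n ih =>
    refine ReflTransGen.head (b := (m - 2, k + n)) ?_ ?_
    · exact Or.inr (Or.inr (Or.inr (Or.inr (Or.inr ⟨rfl, rfl⟩))))
    · convert ih (m - 2) using 2
      push_cast
      ring

-- After t upward moves the factor m+1+2k has grown by 4t, so the obstructions are those of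
-- horizontal moves on the starting level. The condition on levels excludes the move from level 1 to
-- level 2.
open Relation in
lemma reach_up (m : ℤ) (k n : ℕ) (hk : k + n ≤ 1 ∨ 2 ≤ k)
    (hm : ∀ t : ℕ, t < n → m + 1 + 2 * k + 4 * t ≠ 0) :
    ReflTransGen Step (m, k) (m + 2 * n, k + n) := by
  induction n with
  | zero => simp [ReflTransGen.refl]
  | succ n ih =>
    refine ReflTransGen.tail (ih (by omega) fun t ht => hm t (by omega)) ?_
    have := hm n (by omega)
    refine Or.inr (Or.inr (Or.inl ⟨?_, rfl, ?_, ?_⟩)) <;> push_cast <;> omega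

open Relation in
lemma reach_right (m : ℤ) (k n : ℕ) (hm : ∀ t : ℕ, t < n → m + 1 + 2 * k + 4 * t ≠ 0) :
    ReflTransGen Step (m, k) (m + 4 * n, k) := by
  induction n with
  | zero => simp [ReflTransGen.refl]
  | succ n ih =>
    refine ReflTransGen.tail (ih fun t ht => hm t (by omega)) ?_
    have := hm n (by omega)
    refine Or.inl ⟨?_, rfl, ?_⟩ <;> push_cast <;> omega

open Relation in
lemma reach_left (m : ℤ) (k n : ℕ) (hm : ∀ t : ℕ, t < n → m - 4 * t ≠ 2 * k + 1) :
    ReflTransGen Step (m, k) (m - 4 * n, k) := by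
  induction n with
  | zero => simp [ReflTransGen.refl]
  | succ n ih =>
    refine ReflTransGen.tail (ih fun t ht => hm t (by omega)) ?_
    have := hm n (by omega)
    refine Or.inr (Or.inl ⟨?_, rfl, ?_⟩) <;> push_cast <;> omega

open Relation in
/-- Two indices are connected if the target is reached from level `b` by raising and if no
obstruction lies between the positions on level `b`. -/
lemma reach_of_level (b : ℕ) {x m' : ℤ} {k' : ℕ} (hb : b ≤ k')
    (hk : k' ≤ 1 ∨ 2 ≤ b) (hx : (4 : ℤ) ∣ m' - 2 * (k' - b) - x)
    (hr : ∀ t : ℕ, min x (m' - 2 * (k' - b)) + 4 * t + 1 + 2 * b ≠ 0)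
    (hl : ∀ t : ℕ, m' - 2 * (k' - b) + 4 * t + 4 ≤ x →
      m' - 2 * (k' - b) + 4 * t + 4 ≠ 2 * b + 1) :
    ReflTransGen Step (x, b) (m', k') := by
  obtain ⟨n, rfl⟩ := Nat.exists_eq_add_of_le hb
  -- The path runs horizontally on level b from x to y, then up the diagonal from (y, b) to the
  -- target.
  set y : ℤ := m' - 2 * n with hy
  have hyn : m' - 2 * (((b + n : ℕ) : ℤ) - b) = y := by rw [hy]; push_cast; ring
  rw [hyn] at hx hr hl
  obtain ⟨d, hd⟩ := hx
  have hup : ReflTransGen Step (y, b) (m', b + n) := by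
    have h := reach_up y b n hk ?_
    · convert h using 2
      rw [hy]; ring
    · intro t _ h0
      by_cases hxy : x ≤ y
      -- With y - x = 4d, the position y + 4t is x + 4(t + d), which is the form covered by the
      -- hypothesis on x.
      · have := hr (t + d.toNat)
        rw [min_eq_left hxy] at this
        push_cast at this
        rw [Int.toNat_of_nonneg (by omega)] at this
        omega
      · have := hr t
        rw [min_eq_right (by omega)] at this
        omega
  refine ReflTransGen.trans ?_ hup
  by_cases hxy : x ≤ y
  · have h := reach_right x b d.toNat ?_
    · rw [Int.toNat_of_nonneg (by omega)] at h
      convert h using 2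
      omega
    · intro t _ h0
      have := hr t
      rw [min_eq_left hxy] at this
      omega
  · have h := reach_left x b (-d).toNat ?_
    · rw [Int.toNat_of_nonneg (by omega)] at h
      convert h using 2
      omega
    · intro t ht h0
      -- With n = -d, the position x - 4t reached after t lowerings is y + 4(n-1-t) + 4.
      have := hl ((-d).toNat - 1 - t)
      push_cast [Nat.sub_sub, Nat.cast_sub (show 1 + t ≤ (-d).toNat by omega)] at this
      rw [Int.toNat_of_nonneg (by omega)] at this
      omega

open Relation in
lemma reach_of_right (b : ℕ) {m m' : ℤ} {k k' : ℕ} (hk : b ≤ k) (hb : b ≤ k')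
    (hk' : k' ≤ 1 ∨ 2 ≤ b) (hx : (4 : ℤ) ∣ m' - 2 * (k' - b) - (m + 2 * (k - b)))
    (hr : ∀ t : ℕ, min (m + 2 * (k - b)) (m' - 2 * (k' - b)) + 4 * t + 1 + 2 * b ≠ 0)
    (hl : ∀ t : ℕ, m' - 2 * (k' - b) + 4 * t + 4 ≤ m + 2 * (k - b) →
      m' - 2 * (k' - b) + 4 * t + 4 ≠ 2 * b + 1) :
    ReflTransGen Step (m, k) (m', k') := by
  refine ReflTransGen.trans ?_ (reach_of_level b hb hk' hx hr hl)
  obtain ⟨n, rfl⟩ := Nat.exists_eq_add_of_le hk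
  convert reach_down_right m b n using 2
  push_cast
  ring

open Relation in
lemma reach_of_left (b : ℕ) {m m' : ℤ} {k k' : ℕ} (hk : b ≤ k) (hb : b ≤ k')
    (hk' : k' ≤ 1 ∨ 2 ≤ b) (hx : (4 : ℤ) ∣ m' - 2 * (k' - b) - (m - 2 * (k - b)))
    (hr : ∀ t : ℕ, min (m - 2 * (k - b)) (m' - 2 * (k' - b)) + 4 * t + 1 + 2 * b ≠ 0)
    (hl : ∀ t : ℕ, m' - 2 * (k' - b) + 4 * t + 4 ≤ m - 2 * (k - b) →
      m' - 2 * (k' - b) + 4 * t + 4 ≠ 2 * b + 1) :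
    ReflTransGen Step (m, k) (m', k') := by
  refine ReflTransGen.trans ?_ (reach_of_level b hb hk' hx hr hl)
  obtain ⟨n, rfl⟩ := Nat.exists_eq_add_of_le hk
  convert reach_down_left m b n using 2
  push_cast
  ring

open Relation in
lemma reach_neg {m m' : ℤ} {k k' : ℕ} (h : ReflTransGen Step (m, k) (m', k')) :
    ReflTransGen Step (-m, k) (-m', k') :=
  ReflTransGen.lift (p := Step) (fun i : ℤ × ℕ => (-i.1, i.2)) (fun _ _ hs => step_neg hs) _ _ h

/-! ### The composition series -/

lemma admissible_of_step {i j : ℤ × ℕ} (hi : Admissible q i) (hs : Step i j) : Admissible q j := by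
  simp only [admissible_iff, Int.ModEq, Step] at *
  rcases hs with h | h | h | h | h | h <;> omega

/-- Indices of the `Ψ_{m,k}` with `k < 2`. -/
def lowSet (q : ZMod 4) : Set (ℤ × ℕ) := {i | Admissible q i ∧ i.2 < 2}

lemma lowSet_closed : ∀ i ∈ lowSet q, ∀ j, Step i j → j ∈ lowSet q := by
  rintro i ⟨hi, hk⟩ j hs
  refine ⟨admissible_of_step hi hs, ?_⟩
  rcases hs with h | h | h | h | h | h <;> omega

lemma admissible_closed : ∀ i ∈ {i | Admissible q i}, ∀ j, Step i j → j ∈ {i | Admissible q i} :=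
  fun _ hi _ hs => admissible_of_step hi hs

lemma empty_closed : ∀ i ∈ (∅ : Set (ℤ × ℕ)), ∀ j, Step i j → j ∈ (∅ : Set (ℤ × ℕ)) :=
  fun _ hi => hi.elim

lemma psiSpan_empty : psiSpan q ∅ = ⊥ := by simp [psiSpan]

lemma psiSpan_lowSet : psiSpan q (lowSet q) = solSpace q 0 ⊔ solSpace q 1 := by
  rw [solSpace_zero_sup_one]
  congr 1
  ext i
  exact and_comm

lemma psiSpan_admissible : psiSpan q {i | Admissible q i} = ⨆ l, solSpace q l := by
  simp only [solSpace_eq, ← psiSpan_iUnion]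
  congr 1
  ext i
  simp

lemma exists_admissible_snd (q : ZMod 4) (k : ℕ) : Admissible q (2 * k + q.val, k) := by
  rw [admissible_iff]

theorem isCompositionSeries_even (hq : q = 0 ∨ q = 2) :
    IsCompositionSeries [⊥, solSpace q 0 ⊔ solSpace q 1, (⨆ l, solSpace q l)] := by
  have hv : q.val = 0 ∨ q.val = 2 := by rcases hq with rfl | rfl <;> decide
  refine ⟨[psiLie q ∅ empty_closed, psiLie q (lowSet q) lowSet_closed, psiLie q {i | Admissible q i} admissible_closed], ?_, ?_⟩
  · simp [psiLie_toSubmodule, psiSpan_empty, psiSpan_lowSet, psiSpan_admissible]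
  · simp only [List.isChain_cons_cons, List.isChain_singleton, and_true]
    constructor
    · refine psiLie_covBy _ _ (fun i hi => hi.1) (Set.empty_subset _)
        ⟨_, ⟨exists_admissible_snd q 0, by norm_num⟩, Set.notMem_empty _⟩ ?_
      rintro ⟨m, k⟩ ⟨hi, hk⟩ - ⟨m', k'⟩ ⟨hj, hk'⟩ -
      rw [admissible_iff, Int.ModEq] at hi hj
      simp only at hi hj hk hk'
      -- Here m is even, so the factors m+1+2k and m-1-2k are odd and obstruct nothing.
      refine reach_of_right 0 (by omega) (by omega) (by omega) (by omega) (fun t => ?_)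
        (fun t _ => ?_) <;> omega
    · refine psiLie_covBy _ _ (fun i hi => hi) (fun i hi => hi.1)
        ⟨_, exists_admissible_snd q 2, fun h => by simpa using h.2⟩ ?_
      rintro ⟨m, k⟩ hi hk ⟨m', k'⟩ hj hk'
      have hk1 : 2 ≤ k := not_lt.1 fun h => hk ⟨hi, h⟩
      have hk2 : 2 ≤ k' := not_lt.1 fun h => hk' ⟨hj, h⟩
      rw [Set.mem_ofPred_eq, admissible_iff, Int.ModEq] at hi hj
      simp only at hi hj
      refine reach_of_right 2 (by omega) (by omega) (by omega) (by omega) (fun t => ?_)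
        (fun t _ => ?_) <;> omega

/-- Indices of the `Ψ_{m,k}` with `k < 2` and `m ≥ 2k + 1`. -/
def lowPlus : Set (ℤ × ℕ) := {i | Admissible 1 i ∧ i.2 < 2 ∧ 2 * (i.2 : ℤ) + 1 ≤ i.1}

/-- Indices of the `Ψ_{m,k}` with `k < 2` or `m ≥ 2k + 1`. -/
def midPlus : Set (ℤ × ℕ) := {i | Admissible 1 i ∧ (i.2 < 2 ∨ 2 * (i.2 : ℤ) + 1 ≤ i.1)}

/-- Indices of the `Ψ_{m,k}` with `k < 2` and `m ≤ -(2k + 1)`. -/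
def lowMinus : Set (ℤ × ℕ) := {i | Admissible (-1) i ∧ i.2 < 2 ∧ i.1 ≤ -(2 * (i.2 : ℤ) + 1)}

/-- Indices of the `Ψ_{m,k}` with `k < 2` or `m ≤ -(2k + 1)`. -/
def midMinus : Set (ℤ × ℕ) := {i | Admissible (-1) i ∧ (i.2 < 2 ∨ i.1 ≤ -(2 * (i.2 : ℤ) + 1))}

lemma admissible_one {m : ℤ} {k : ℕ} : Admissible 1 (m, k) ↔ m % 4 = (2 * k + 1) % 4 :=
  admissible_iff

lemma admissible_neg_one {m : ℤ} {k : ℕ} : Admissible (-1) (m, k) ↔ m % 4 = (2 * k + 3) % 4 :=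
  admissible_iff

/-- For q = 1 the number m-2k-1 is a multiple of 4, and a step changes it by 0 or ±4. At 0, each
move that would decrease it has a zero coefficient, so the region m ≥ 2k+1 cannot be left. -/
lemma lowPlus_closed : ∀ i ∈ lowPlus, ∀ j, Step i j → j ∈ lowPlus := by
  rintro ⟨m, k⟩ ⟨hi, hk, hm⟩ ⟨m', k'⟩ hs
  refine ⟨admissible_of_step hi hs, ?_⟩
  rw [admissible_one] at hi
  simp only [Step] at hs hk hm ⊢
  rcases hs with h | h | h | h | h | h <;> omega

lemma midPlus_closed : ∀ i ∈ midPlus, ∀ j, Step i j → j ∈ midPlus := by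
  rintro ⟨m, k⟩ ⟨hi, hm⟩ ⟨m', k'⟩ hs
  refine ⟨admissible_of_step hi hs, ?_⟩
  rw [admissible_one] at hi
  simp only [Step] at hs hm ⊢
  rcases hs with h | h | h | h | h | h <;> omega

lemma lowMinus_closed : ∀ i ∈ lowMinus, ∀ j, Step i j → j ∈ lowMinus := by
  rintro ⟨m, k⟩ ⟨hi, hk, hm⟩ ⟨m', k'⟩ hs
  refine ⟨admissible_of_step hi hs, ?_⟩
  rw [admissible_neg_one] at hi
  simp only [Step] at hs hk hm ⊢
  rcases hs with h | h | h | h | h | h <;> omega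

lemma midMinus_closed : ∀ i ∈ midMinus, ∀ j, Step i j → j ∈ midMinus := by
  rintro ⟨m, k⟩ ⟨hi, hm⟩ ⟨m', k'⟩ hs
  refine ⟨admissible_of_step hi hs, ?_⟩
  rw [admissible_neg_one] at hi
  simp only [Step] at hs hm ⊢
  rcases hs with h | h | h | h | h | h <;> omega

lemma solPlus_eq (k : ℕ) :
    solPlus 1 k = psiSpan 1 {i | i.2 = k ∧ Admissible 1 i ∧ 2 * (i.2 : ℤ) + 1 ≤ i.1} := by
  rw [solPlus, spanPsi_eq (fun m hm => admissible_one.2 hm.2)]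
  congr 1
  ext ⟨m, l⟩
  constructor
  · rintro ⟨rfl, h1, h2⟩
    exact ⟨rfl, admissible_one.2 h2, h1⟩
  · rintro ⟨rfl, h2, h1⟩
    exact ⟨rfl, h1, admissible_one.1 h2⟩

lemma solMinus_eq (k : ℕ) :
    solMinus (-1) k = psiSpan (-1) {i | i.2 = k ∧ Admissible (-1) i ∧ i.1 ≤ -(2 * (i.2 : ℤ) + 1)} := by
  have hadm : ∀ (m : ℤ) (k : ℕ), m ≡ -(2 * (k : ℤ) + 1) [ZMOD 4] ↔ Admissible (-1) (m, k) := by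
    intro m k
    rw [admissible_neg_one, Int.ModEq]
    omega
  rw [solMinus, spanPsi_eq (fun m hm => (hadm m k).1 hm.2)]
  congr 1
  ext ⟨m, l⟩
  constructor
  · rintro ⟨rfl, h1, h2⟩
    exact ⟨rfl, (hadm _ _).1 h2, h1⟩
  · rintro ⟨rfl, h2, h1⟩
    exact ⟨rfl, h1, (hadm _ _).2 h2⟩

lemma psiSpan_lowPlus : psiSpan 1 lowPlus = solPlus 1 0 ⊔ solPlus 1 1 := by
  rw [solPlus_eq, solPlus_eq, ← psiSpan_union]
  congr 1
  ext ⟨m, k⟩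
  simp only [lowPlus, Set.mem_union, Set.mem_ofPred_eq, ← or_and_right]
  rw [show k < 2 ↔ k = 0 ∨ k = 1 by omega]
  tauto

lemma psiSpan_lowMinus : psiSpan (-1) lowMinus = solMinus (-1) 0 ⊔ solMinus (-1) 1 := by
  rw [solMinus_eq, solMinus_eq, ← psiSpan_union]
  congr 1
  ext ⟨m, k⟩
  simp only [lowMinus, Set.mem_union, Set.mem_ofPred_eq, ← or_and_right]
  rw [show k < 2 ↔ k = 0 ∨ k = 1 by omega]
  tauto

lemma psiSpan_midPlus : psiSpan 1 midPlus =
    solSpace 1 0 ⊔ solSpace 1 1 ⊔ (⨆ l ≥ 2, solPlus 1 l) := by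
  simp only [solPlus_eq, ← psiSpan_iUnion, ← psiSpan_lowSet]
  rw [← psiSpan_union]
  congr 1
  ext ⟨m, k⟩
  simp only [midPlus, lowSet, Set.mem_union, Set.mem_ofPred_eq, Set.mem_iUnion, exists_prop]
  constructor
  · rintro ⟨h, hk⟩
    by_cases hk2 : k < 2
    · exact Or.inl ⟨h, hk2⟩
    · exact Or.inr ⟨k, by omega, rfl, h, hk.resolve_left hk2⟩
  · rintro (⟨h, hk⟩ | ⟨l, hl, rfl, h, hk⟩)
    · exact ⟨h, Or.inl hk⟩
    · exact ⟨h, Or.inr hk⟩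

lemma psiSpan_midMinus : psiSpan (-1) midMinus =
    solSpace (-1) 0 ⊔ solSpace (-1) 1 ⊔ (⨆ l ≥ 2, solMinus (-1) l) := by
  simp only [solMinus_eq, ← psiSpan_iUnion, ← psiSpan_lowSet]
  rw [← psiSpan_union]
  congr 1
  ext ⟨m, k⟩
  simp only [midMinus, lowSet, Set.mem_union, Set.mem_ofPred_eq, Set.mem_iUnion, exists_prop]
  constructor
  · rintro ⟨h, hk⟩
    by_cases hk2 : k < 2
    · exact Or.inl ⟨h, hk2⟩
    · exact Or.inr ⟨k, by omega, rfl, h, hk.resolve_left hk2⟩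
  · rintro (⟨h, hk⟩ | ⟨l, hl, rfl, h, hk⟩)
    · exact ⟨h, Or.inl hk⟩
    · exact ⟨h, Or.inr hk⟩

open Relation

/-- Two indices `(m, k)`, `(m', k')` with `m, m' ≥ 2k + 1` are connected. -/
lemma reach_plus (b : ℕ) {m m' : ℤ} {k k' : ℕ} (hi : Admissible 1 (m, k))
    (hj : Admissible 1 (m', k')) (hb : b ≤ k) (hb' : b ≤ k') (hk : k' ≤ 1 ∨ 2 ≤ b)
    (hm' : 2 * (k' : ℤ) + 1 ≤ m') :
    ReflTransGen Step (m, k) (m', k') := by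
  rw [admissible_one] at hi hj
  -- On level b all positions are ≡ 1-2b modulo 4, so -(2b+1) never occurs. The only wall 2b+1 is
  -- not to the right of the goal m' - 2(k'-b), hence is never crossed leftwards.
  refine reach_of_right b hb hb' hk (by omega) (fun t => ?_) (fun t _ => ?_) <;> omega

/-- Two indices `(m, k)`, `(m', k')` with `m, m' < 2k + 1` are connected. -/
lemma reach_plus_compl (b : ℕ) {m m' : ℤ} {k k' : ℕ} (hi : Admissible 1 (m, k))
    (hj : Admissible 1 (m', k')) (hb : b ≤ k) (hb' : b ≤ k') (hk : k' ≤ 1 ∨ 2 ≤ b)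
    (hm : m < 2 * (k : ℤ) + 1) :
    ReflTransGen Step (m, k) (m', k') := by
  rw [admissible_one] at hi hj
  -- Descending to the left keeps m-2k constant, so the path arrives on level b left of the wall
  -- 2b+1; from there leftward moves do not meet it, and rightward moves are free.
  refine reach_of_left b hb hb' hk (by omega) (fun t => ?_) (fun t _ => ?_) <;> omega

lemma admissible_neg {m : ℤ} {k : ℕ} (h : Admissible (-1) (m, k)) : Admissible 1 (-m, k) := by
  rw [admissible_one]
  rw [admissible_neg_one] at h
  omega

/-- The reflection m ↦ -m preserves `Step` and exchanges the index sets for q = 1 and q = -1. -/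
lemma reach_minus (b : ℕ) {m m' : ℤ} {k k' : ℕ} (hi : Admissible (-1) (m, k))
    (hj : Admissible (-1) (m', k')) (hb : b ≤ k) (hb' : b ≤ k') (hk : k' ≤ 1 ∨ 2 ≤ b)
    (hm' : m' ≤ -(2 * (k' : ℤ) + 1)) :
    ReflTransGen Step (m, k) (m', k') := by
  have h := reach_neg (reach_plus b (admissible_neg hi) (admissible_neg hj) hb hb' hk
    (by omega))
  rwa [neg_neg, neg_neg] at h

lemma reach_minus_compl (b : ℕ) {m m' : ℤ} {k k' : ℕ} (hi : Admissible (-1) (m, k))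
    (hj : Admissible (-1) (m', k')) (hb : b ≤ k) (hb' : b ≤ k') (hk : k' ≤ 1 ∨ 2 ≤ b)
    (hm : -(2 * (k : ℤ) + 1) < m) :
    ReflTransGen Step (m, k) (m', k') := by
  have h := reach_neg (reach_plus_compl b (admissible_neg hi) (admissible_neg hj) hb hb' hk
    (by omega))
  rwa [neg_neg, neg_neg] at h

theorem isCompositionSeries_one :
    IsCompositionSeries [⊥, solPlus 1 0 ⊔ solPlus 1 1, solSpace 1 0 ⊔ solSpace 1 1,
      solSpace 1 0 ⊔ solSpace 1 1 ⊔ (⨆ l ≥ 2, solPlus 1 l), (⨆ l, solSpace 1 l)] := by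
  refine ⟨[psiLie 1 ∅ empty_closed, psiLie 1 _ lowPlus_closed, psiLie 1 (lowSet 1) lowSet_closed,
    psiLie 1 _ midPlus_closed, psiLie 1 {i | Admissible 1 i} admissible_closed], ?_, ?_⟩
  · simp only [List.map_cons, List.map_nil, psiLie_toSubmodule, psiSpan_empty, psiSpan_lowPlus,
      psiSpan_lowSet, psiSpan_midPlus, psiSpan_admissible]
  · simp only [List.isChain_cons_cons, List.isChain_singleton, and_true]
    refine ⟨?_, ?_, ?_, ?_⟩
    · refine psiLie_covBy _ _ (fun i hi => hi.1) (Set.empty_subset _)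
        ⟨(1, 0), ⟨admissible_one.2 rfl, by norm_num, by norm_num⟩, Set.notMem_empty _⟩ ?_
      rintro ⟨m, k⟩ ⟨hi, hk, -⟩ - ⟨m', k'⟩ ⟨hj, hk', hm'⟩ -
      exact reach_plus 0 hi hj (Nat.zero_le _) (Nat.zero_le _) (Or.inl (Nat.le_of_lt_succ hk'))
        hm'
    · refine psiLie_covBy _ _ (fun i hi => hi.1) (fun i hi => ⟨hi.1, hi.2.1⟩)
        ⟨(-3, 0), ⟨admissible_one.2 rfl, by norm_num⟩, fun h => by simpa using h.2.2⟩ ?_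
      rintro ⟨m, k⟩ ⟨hi, hk⟩ hA ⟨m', k'⟩ ⟨hj, hk'⟩ hA'
      exact reach_plus_compl 0 hi hj (Nat.zero_le _) (Nat.zero_le _)
        (Or.inl (Nat.le_of_lt_succ hk')) (not_le.1 fun h => hA ⟨hi, hk, h⟩)
    · refine psiLie_covBy _ _ (fun i hi => hi.1) (fun i hi => ⟨hi.1, Or.inl hi.2⟩)
        ⟨(5, 2), ⟨admissible_one.2 rfl, Or.inr (by norm_num)⟩, fun h => by simpa using h.2⟩ ?_
      rintro ⟨m, k⟩ ⟨hi, -⟩ hA ⟨m', k'⟩ ⟨hj, hk'⟩ hA'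
      have h2 : ¬k < 2 := fun h => hA ⟨hi, h⟩
      have h2' : ¬k' < 2 := fun h => hA' ⟨hj, h⟩
      exact reach_plus 2 hi hj (not_lt.1 h2) (not_lt.1 h2') (Or.inr le_rfl)
        (hk'.resolve_left h2')
    · refine psiLie_covBy _ _ (fun i hi => hi) (fun i hi => hi.1)
        ⟨(1, 2), admissible_one.2 rfl, fun h => by simpa using h.2⟩ ?_
      rintro ⟨m, k⟩ hi hA ⟨m', k'⟩ hj hA'
      exact reach_plus_compl 2 hi hj (not_lt.1 fun h => hA ⟨hi, Or.inl h⟩)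
        (not_lt.1 fun h => hA' ⟨hj, Or.inl h⟩) (Or.inr le_rfl)
        (not_le.1 fun h => hA ⟨hi, Or.inr h⟩)

theorem isCompositionSeries_neg_one :
    IsCompositionSeries [⊥, solMinus (-1) 0 ⊔ solMinus (-1) 1, solSpace (-1) 0 ⊔ solSpace (-1) 1,
      solSpace (-1) 0 ⊔ solSpace (-1) 1 ⊔ (⨆ l ≥ 2, solMinus (-1) l),
      (⨆ l, solSpace (-1) l)] := by
  refine ⟨[psiLie (-1) ∅ empty_closed, psiLie (-1) _ lowMinus_closed, psiLie (-1) (lowSet (-1)) lowSet_closed,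
    psiLie (-1) _ midMinus_closed, psiLie (-1) {i | Admissible (-1) i} admissible_closed], ?_, ?_⟩
  · simp only [List.map_cons, List.map_nil, psiLie_toSubmodule, psiSpan_empty, psiSpan_lowMinus,
      psiSpan_lowSet, psiSpan_midMinus, psiSpan_admissible]
  · simp only [List.isChain_cons_cons, List.isChain_singleton, and_true]
    refine ⟨?_, ?_, ?_, ?_⟩
    · refine psiLie_covBy _ _ (fun i hi => hi.1) (Set.empty_subset _)
        ⟨(-1, 0), ⟨admissible_neg_one.2 rfl, by norm_num, by norm_num⟩, Set.notMem_empty _⟩ ?_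
      rintro ⟨m, k⟩ ⟨hi, hk, -⟩ - ⟨m', k'⟩ ⟨hj, hk', hm'⟩ -
      exact reach_minus 0 hi hj (Nat.zero_le _) (Nat.zero_le _) (Or.inl (Nat.le_of_lt_succ hk'))
        hm'
    · refine psiLie_covBy _ _ (fun i hi => hi.1) (fun i hi => ⟨hi.1, hi.2.1⟩)
        ⟨(3, 0), ⟨admissible_neg_one.2 rfl, by norm_num⟩, fun h => by simpa using h.2.2⟩ ?_
      rintro ⟨m, k⟩ ⟨hi, hk⟩ hA ⟨m', k'⟩ ⟨hj, hk'⟩ hA'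
      exact reach_minus_compl 0 hi hj (Nat.zero_le _) (Nat.zero_le _)
        (Or.inl (Nat.le_of_lt_succ hk')) (not_le.1 fun h => hA ⟨hi, hk, h⟩)
    · refine psiLie_covBy _ _ (fun i hi => hi.1) (fun i hi => ⟨hi.1, Or.inl hi.2⟩)
        ⟨(-5, 2), ⟨admissible_neg_one.2 rfl, Or.inr (by norm_num)⟩, fun h => by simpa using h.2⟩ ?_
      rintro ⟨m, k⟩ ⟨hi, -⟩ hA ⟨m', k'⟩ ⟨hj, hk'⟩ hA'
      have h2 : ¬k < 2 := fun h => hA ⟨hi, h⟩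
      have h2' : ¬k' < 2 := fun h => hA' ⟨hj, h⟩
      exact reach_minus 2 hi hj (not_lt.1 h2) (not_lt.1 h2') (Or.inr le_rfl)
        (hk'.resolve_left h2')
    · refine psiLie_covBy _ _ (fun i hi => hi) (fun i hi => hi.1)
        ⟨(-1, 2), admissible_neg_one.2 rfl, fun h => by simpa using h.2⟩ ?_
      rintro ⟨m, k⟩ hi hA ⟨m', k'⟩ hj hA'
      exact reach_minus_compl 2 hi hj (not_lt.1 fun h => hA ⟨hi, Or.inl h⟩)
        (not_lt.1 fun h => hA' ⟨hj, Or.inl h⟩) (Or.inr le_rfl)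
        (not_le.1 fun h => hA ⟨hi, Or.inr h⟩)

end SchrodingerRep
end

open SchrodingerRep in
theorem mainTheorem1 (q : ZMod 4) :
    (∀ l : ℕ, 2 ≤ l → solSpace q l = kFiniteSol q ((l : ℂ) * ((l : ℂ) - 1) / 2)) ∧
    solSpace q 0 ⊔ solSpace q 1 = kFiniteSol q 0 ∧
    iSupIndep (solSpace q) ∧
    (q = 0 ∨ q = 2 →
      IsCompositionSeries [⊥, solSpace q 0 ⊔ solSpace q 1, (⨆ l, solSpace q l)]) ∧
    (q = -1 →
      IsCompositionSeries [⊥, solMinus q 0 ⊔ solMinus q 1, solSpace q 0 ⊔ solSpace q 1,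
        solSpace q 0 ⊔ solSpace q 1 ⊔ (⨆ l ≥ 2, solMinus q l), (⨆ l, solSpace q l)]) ∧
    (q = 1 →
      IsCompositionSeries [⊥, solPlus q 0 ⊔ solPlus q 1, solSpace q 0 ⊔ solSpace q 1,
        solSpace q 0 ⊔ solSpace q 1 ⊔ (⨆ l ≥ 2, solPlus q l), (⨆ l, solSpace q l)]) := by
  refine ⟨fun l hl => solSpace_eq_kFiniteSol hl, solSpace_zero_sup_one_eq_kFiniteSol,
    iSupIndep_solSpace, isCompositionSeries_even, ?_, ?_⟩
  · rintro rfl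
    exact isCompositionSeries_neg_one
  · rintro rfl
    exact isCompositionSeries_one
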